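/- Let $0<m<n$ be integers and $k=n-1$; indices are taken in $\mathbb{Z}/n\mathbb{Z}$. Let $\widetilde S_n$ be the affine symmetric group, generated by $s_i$ ($i\in\mathbb{Z}/n\mathbb{Z}$) with $s_i^2=1$, $s_is_{i+1}s_i=s_{i+1}s_is_{i+1}$ (omitted if $n=2$) and $s_is_j=s_js_i$ for $i-j\neq\pm1$, with length function $\ell$. An element $w$ is *0-Grassmannian* if every reduced word of $w$ ends with $s_0$ (the identity included); $\widetilde S_n^0$ is the set of these elements. For a proper subset $J\subsetneq\mathbb{Z}/n\mathbb{Z}$ let $d_J$ (resp. $u_J$) be the product of the $s_j$, $j\in J$, each taken once, in an order in which $s_{i+1}$ precedes $s_i$ (resp. $s_i$ precedes $s_{i+1}$) whenever $i,i+1\in J$; the $d_J$ are the *cyclically decreasing*, the $u_J$ the *cyclically increasing* elements. Let $\mathbb{A}$ be the affine nilCoxeter algebra: the $\mathbb{Z}$-algebra generated by $A_i$ ($i\in\mathbb{Z}/n\mathbb{Z}$) with $A_i^2=0$, $A_iA_{i+1}A_i=A_{i+1}A_iA_{i+1}$ (omitted if $n=2$) and $A_iA_j=A_jA_i$ for $i-j\ne\pm1$.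 Put $A_w=A_{i_1}\cdots A_{i_l}$ for any reduced word $w=s_{i_1}\cdots s_{i_l}$, and, for $0\le i<n$, $\mathbf h_i=\sum_{|J|=i}A_{d_J}$ and $\mathbf e_i=\sum_{|J|=i}A_{u_J}$. Let $\mathbb{A}_{m,n}$ be the quotient of $\mathbb{A}$ by the relations $A_iA_{i+1}A_i=A_{i+1}A_iA_{i+1}=0$ for all $i$, $A_w=0$ for every cyclically decreasing $w$ with $\ell(w)>n-m$, and $A_w=0$ for every cyclically increasing $w$ with $\ell(w)>m$. A bar denotes the image in $\mathbb{A}_{m,n}$. For $w\in\widetilde S_n$ let $F_w=\sum x_1^{\ell(w_1)}x_2^{\ell(w_2)}\cdots$ be the affine Stanley symmetric function, the sum being over all factorizations $w=w_1w_2\cdots$ into cyclically decreasing elements, almost all equal to $1$, with $\sum_i\ell(w_i)=\ell(w)$. The $k$-Schur functions $s^{(k)}_w$, $w\in\widetilde S_n^0$, form the basis of $\mathbb{Z}[h_1,\dots,h_{n-1}]$ dual to $\{F_u: u\in\widetilde S_n^0\}$ for the Hall pairing (in which $\langle h_\lambda,F\rangle$ is the coefficient of $x^\lambda$ in $F$).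 The *noncommutative $k$-Schur function* $\mathbf s^{(k)}_w\in\mathbb{A}$ is the image of $s^{(k)}_w$ under $h_\lambda\mapsto\mathbf h_{\lambda_1}\mathbf h_{\lambda_2}\cdots$, and $\mathbf s^{(m,n)}_w$ is the image of $\mathbf s^{(k)}_w$ in $\mathbb{A}_{m,n}$. An *$n$-connected ribbon* is an element $u_{J^c}d_J$ with $\emptyset\neq J\subsetneq\mathbb{Z}/n\mathbb{Z}$, where $J^c$ is the complement of $J$. Let $r_m=u_{[-m,-1]}\,d_{[0,n-m-1]}=s_{-m}s_{-m+1}\cdots s_{-1}\,s_{n-m-1}\cdots s_1s_0$. **Theorem 4.5.** In $\mathbb{A}_{m,n}$ we have $$\mathbf s^{(m,n)}_{r_m}=\sum_{|J|=n-m}\overline{A_{u_{J^c}d_J}}=\overline{\mathbf e}_m\,\overline{\mathbf h}_{n-m},$$ where $J$ runs over all subsets of $\mathbb{Z}/n\mathbb{Z}$ with $n-m$ elements. Moreover, $r_m$ is the unique $n$-connected ribbon that is 0-Grassmannian and whose image $\overline{A_{r_m}}$ in $\mathbb{A}_{m,n}$ is nonzero. -/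

import Mathlib

noncomputable section

namespace AffNil

/-- The Coxeter matrix of type `A_{n-1}^{(1)}`, indexed by `ZMod n`. For `n = 2` the two generators
satisfy no braid relation (entry `0` stands for `∞`). -/
def affineMatrix (n : ℕ) : CoxeterMatrix (ZMod n) where
  M i j := if i = j then 1 else if i = j + 1 ∨ j = i + 1 then (if n = 2 then 0 else 3) else 2
  isSymm := by
    refine Matrix.IsSymm.ext fun i j => ?_
    by_cases h : i = j
    · subst h; rfl
    · simp only [if_neg h, if_neg (Ne.symm h), or_comm]
  diagonal i := by simp
  off_diagonal i j h := by
    rw [if_neg h]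
    split_ifs <;> decide

/-- The affine symmetric group, presented by the simple generators `s_i`, `i ∈ ZMod n`. -/
abbrev AffSym (n : ℕ) : Type := (affineMatrix n).Group

/-- The standard Coxeter system on the affine symmetric group. -/
abbrev cs (n : ℕ) : CoxeterSystem (affineMatrix n) (AffSym n) := (affineMatrix n).toCoxeterSystem

/-- `w` is `0`-Grassmannian: every reduced word of `w` ends with `s_0` (the identity, whose only
reduced word is empty, is included); equivalently `w` is the minimal length representative of its
coset modulo the subgroup generated by the `s_i` with `i ≠ 0`. -/
def IsZeroGrassmannian (n : ℕ) (w : AffSym n) : Prop :=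
  ∀ ω : List (ZMod n), (cs n).IsReduced ω → (cs n).wordProd ω = w → ∀ i ∈ ω.getLast?, i = 0

/-- A word is cyclically decreasing: every letter occurs at most once, and `i + 1` precedes `i`
whenever both occur. -/
def IsCycDecWord (n : ℕ) (ω : List (ZMod n)) : Prop :=
  ω.Nodup ∧ ∀ i, i ∈ ω → i + 1 ∈ ω → [i + 1, i].Sublist ω

/-- A word is cyclically increasing: every letter occurs at most once, and `i` precedes `i + 1`
whenever both occur. -/
def IsCycIncWord (n : ℕ) (ω : List (ZMod n)) : Prop :=
  ω.Nodup ∧ ∀ i, i ∈ ω → i + 1 ∈ ω → [i, i + 1].Sublist ω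

/-- `d_J`, for a proper subset `J`: the unique element that is the product of a cyclically
decreasing word whose set of letters is `J`. (A junk value if `J` is everything.) -/
def cycDec (n : ℕ) (J : Finset (ZMod n)) : AffSym n :=
  Classical.epsilon fun w =>
    ∃ ω, IsCycDecWord n ω ∧ (∀ j, j ∈ ω ↔ j ∈ J) ∧ (cs n).wordProd ω = w

/-- `u_J`, for a proper subset `J`: the unique element that is the product of a cyclically
increasing word whose set of letters is `J`. (A junk value if `J` is everything.) -/
def cycInc (n : ℕ) (J : Finset (ZMod n)) : AffSym n :=
  Classical.epsilon fun w =>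
    ∃ ω, IsCycIncWord n ω ∧ (∀ j, j ∈ ω ↔ j ∈ J) ∧ (cs n).wordProd ω = w

/-- Cyclically decreasing elements: the `d_J` for proper subsets `J`. -/
def IsCycDec (n : ℕ) [NeZero n] (w : AffSym n) : Prop :=
  ∃ J : Finset (ZMod n), J ≠ Finset.univ ∧ w = cycDec n J

/-- Cyclically increasing elements: the `u_J` for proper subsets `J`. -/
def IsCycInc (n : ℕ) [NeZero n] (w : AffSym n) : Prop :=
  ∃ J : Finset (ZMod n), J ≠ Finset.univ ∧ w = cycInc n J

/-- `v 0 * v 1 * v 2 * ⋯` (eventually `1`) is a cyclically decreasing decomposition of `w`. -/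
def IsCycDecDecomposition (n : ℕ) [NeZero n] (w : AffSym n) (v : ℕ → AffSym n) : Prop :=
  (∀ i, IsCycDec n (v i)) ∧
    ∃ N, (∀ i, N ≤ i → v i = 1) ∧ ((List.range N).map v).prod = w ∧
      ∑ i ∈ Finset.range N, (cs n).length (v i) = (cs n).length w

/-- The affine Stanley symmetric function `F_w`, as a power series in `x_0, x_1, …`: the
coefficient of `x^a` is the number of cyclically decreasing decompositions of `w` whose `i`-th
factor has length `a i`. -/
def affineStanley (n : ℕ) [NeZero n] (w : AffSym n) : MvPowerSeries ℕ ℤ :=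
  fun a => (Nat.card {v : ℕ → AffSym n //
    IsCycDecDecomposition n w v ∧ ∀ i, (cs n).length (v i) = a i} : ℤ)

/-- The ring `ℤ[h_1, …, h_{n-1}]` of symmetric functions; the variable `X i` is the complete
homogeneous symmetric function `h_{i+1}`. -/
abbrev SymH (n : ℕ) : Type := MvPolynomial (Fin (n - 1)) ℤ

/-- The partition `λ_1 ≥ λ_2 ≥ ⋯` for which the monomial with exponent vector `a` is
`h_λ = h_{λ_1} h_{λ_2} ⋯`. -/
def monomialParts (n : ℕ) (a : Fin (n - 1) →₀ ℕ) : List ℕ :=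
  ((Finsupp.toMultiset a).map fun i => (i : ℕ) + 1).sort (· ≥ ·)

/-- The Hall pairing of `f ∈ ℤ[h_1, …, h_{n-1}]` with a symmetric power series `F`. Since
`⟨h_λ, m_μ⟩ = δ_{λμ}`, the number `⟨h_λ, F⟩` is the coefficient of `x^λ` in `F`. -/
def hallPairing (n : ℕ) (f : SymH n) (F : MvPowerSeries ℕ ℤ) : ℤ :=
  ∑ a ∈ f.support, f.coeff a * MvPowerSeries.coeff (monomialParts n a).toFinsupp F

/-- `f` is the member with index `w` of the basis of `ℤ[h_1, …, h_{n-1}]` dual, for the Hall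
pairing, to the affine Schur functions `F_u`, `u` being `0`-Grassmannian. -/
def IsKSchur (n : ℕ) [NeZero n] (w : AffSym n) (f : SymH n) : Prop :=
  ∀ u : AffSym n, IsZeroGrassmannian n u →
    (u = w → hallPairing n f (affineStanley n u) = 1) ∧
    (u ≠ w → hallPairing n f (affineStanley n u) = 0)

/-- The `k`-Schur function `s_w^{(k)}`, `k = n - 1`, of a `0`-Grassmannian element `w`. -/
def kSchur (n : ℕ) [NeZero n] (w : AffSym n) : SymH n :=
  Classical.epsilon (IsKSchur n w)

/-- Defining relations of the affine nilCoxeter algebra (no braid relation if `n = 2`). -/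
inductive NilRel (n : ℕ) : FreeAlgebra ℤ (ZMod n) → FreeAlgebra ℤ (ZMod n) → Prop
  | sq (i : ZMod n) : NilRel n (FreeAlgebra.ι ℤ i * FreeAlgebra.ι ℤ i) 0
  | braid (hn : n ≠ 2) (i : ZMod n) :
      NilRel n (FreeAlgebra.ι ℤ i * FreeAlgebra.ι ℤ (i + 1) * FreeAlgebra.ι ℤ i)
        (FreeAlgebra.ι ℤ (i + 1) * FreeAlgebra.ι ℤ i * FreeAlgebra.ι ℤ (i + 1))
  | comm (i j : ZMod n) (h₁ : i - j ≠ 1) (h₂ : i - j ≠ -1) :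
      NilRel n (FreeAlgebra.ι ℤ i * FreeAlgebra.ι ℤ j) (FreeAlgebra.ι ℤ j * FreeAlgebra.ι ℤ i)

/-- The affine nilCoxeter algebra over `ℤ`. -/
abbrev NilAlg (n : ℕ) : Type := RingQuot (NilRel n)

/-- The generator `A_i`. -/
def gen (n : ℕ) (i : ZMod n) : NilAlg n :=
  RingQuot.mkAlgHom ℤ (NilRel n) (FreeAlgebra.ι ℤ i)

/-- `A_w = A_{i_1} ⋯ A_{i_l}` for a reduced word `i_1 ⋯ i_l` of `w`; the result does not depend on
the reduced word, so one is chosen. -/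
def elt (n : ℕ) (w : AffSym n) : NilAlg n :=
  (((cs n).exists_isReduced w).choose.map (gen n)).prod

/-- The element `𝐡_i`, the sum of `A_{d_J}` over `|J| = i`, used for `i < n`. -/
def ncH (n : ℕ) [NeZero n] (i : ℕ) : NilAlg n :=
  ∑ J ∈ Finset.powersetCard i (Finset.univ : Finset (ZMod n)), elt n (cycDec n J)

/-- The element `𝐞_i`, the sum of `A_{u_J}` over `|J| = i`, used for `i < n`. -/
def ncE (n : ℕ) [NeZero n] (i : ℕ) : NilAlg n :=
  ∑ J ∈ Finset.powersetCard i (Finset.univ : Finset (ZMod n)), elt n (cycInc n J)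

/-- The isomorphism of `ℤ[h_1, …, h_{n-1}]` onto the affine Fomin-Stanley algebra that sends `h_i`
to `𝐡_i`, given on the monomial basis by `h_λ ↦ 𝐡_{λ_1} 𝐡_{λ_2} ⋯`. (The `𝐡_i` commute.) -/
def ncEval (n : ℕ) [NeZero n] (f : SymH n) : NilAlg n :=
  ∑ a ∈ f.support, f.coeff a • ((monomialParts n a).map (ncH n)).prod

/-- The noncommutative `k`-Schur function of a `0`-Grassmannian element `w`. -/
def ncKSchur (n : ℕ) [NeZero n] (w : AffSym n) : NilAlg n := ncEval n (kSchur n w)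

/-- The further relations that define the quotient algebra `𝔸_{m,n}`. -/
inductive QuotRel (m n : ℕ) [NeZero n] : NilAlg n → NilAlg n → Prop
  | up (i : ZMod n) : QuotRel m n (gen n i * gen n (i + 1) * gen n i) 0
  | down (i : ZMod n) : QuotRel m n (gen n (i + 1) * gen n i * gen n (i + 1)) 0
  | dec (w : AffSym n) (hw : IsCycDec n w) (hl : n - m < (cs n).length w) :
      QuotRel m n (elt n w) 0
  | inc (w : AffSym n) (hw : IsCycInc n w) (hl : m < (cs n).length w) :
      QuotRel m n (elt n w) 0

/-- The quotient algebra `𝔸_{m,n}`. -/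
abbrev QuotAlg (m n : ℕ) [NeZero n] : Type := RingQuot (QuotRel m n)

/-- The projection of the affine nilCoxeter algebra onto `𝔸_{m,n}`. -/
def proj (m n : ℕ) [NeZero n] : NilAlg n →+* QuotAlg m n := RingQuot.mkRingHom (QuotRel m n)

/-- `n`-connected ribbons `u_{J^c} d_J`. Both `J` and its complement have to be proper subsets,
since otherwise `u_{J^c}` or `d_J` is not defined. -/
def IsRibbon (n : ℕ) [NeZero n] (w : AffSym n) : Prop :=
  ∃ J : Finset (ZMod n), J.Nonempty ∧ J ≠ Finset.univ ∧ w = cycInc n Jᶜ * cycDec n J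

/-- The set `{a, a + 1, …, b}` of residues modulo `n`. -/
def cycInterval (n : ℕ) (a b : ℤ) : Finset (ZMod n) :=
  (Finset.Icc a b).image fun z : ℤ => (z : ZMod n)

/-- The element `r_m = u_{[-m,-1]} d_{[0,n-m-1]}`. -/
def ribbonR (m n : ℕ) : AffSym n :=
  cycInc n (cycInterval n (-(m : ℤ)) (-1)) *
    cycDec n (cycInterval n 0 ((n : ℤ) - (m : ℤ) - 1))

end AffNil

end

/-! The first identity holds before passing to the quotient: in the nilCoxeter algebra the
noncommutative k-Schur function of r_m equals 𝐞_m 𝐡_{n-m} (`ncKSchur_ribbonR`). The coefficient of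
A_u in a product of the 𝐡_i counts cyclically decreasing decompositions of u, so the Hall pairing of
f with F_u is the coefficient of A_u in the image of f (`hallPairing_affineStanley`). Duality thus
prescribes the coefficients of the image at the 0-Grassmannian u. These coefficients determine f, by
a triangularity over bounded partitions (`coef_rowElt`, `eq_zero_of_coef_eq_zero`), and the only
0-Grassmannian term of 𝐞_m 𝐡_{n-m} is A_{r_m}, with coefficient one (`coef_ncE_mul_ncH`): a
Grassmannian element has only one candidate for a right factor d_J of given size, namely a cyclic
interval, and this in turn forces the left factor u_I.

For this 𝐞_m has to be a polynomial in the 𝐡_i, and the 𝐡_i have to commute. Over a proper set of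
letters both follow from factored generating functions and a Yang-Baxter exchange. Pairs (I, J) that
together cover all residues are matched by the rotation u_I d_J = d_{J+1} u_{I+1}
(`cycInc_mul_cycDec_of_union`). Inclusion-exclusion over I ∪ J combines the two cases. Lengths,
descents and identities between elements are checked on permutations of ℤ, and coefficients make
sense because the A_w are independent in the regular representation.

In the quotient u_I d_J vanishes as soon as I meets J, so only the ribbons survive in the product. A
0-Grassmannian ribbon has an interval for J, and the length relations fix the size of this interval.
That A_{r_m} survives is shown by a representation of the quotient on m particles hopping on a
circle of n sites (`hopRep`, `proj_ribbonR_ne_zero`). -/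

noncomputable section

namespace AffNil

attribute [-simp] CoxeterMatrix.toCoxeterSystem_simple

variable {n : ℕ}

/-! ### Realization of the affine symmetric group by permutations of ℤ -/

section Perm

variable [Fact (1 < n)]

/-- The action of the generator `s_i` on `ℤ`: it exchanges `x` and `x + 1` for all `x ≡ i`. -/
def affSwap (i : ZMod n) : Equiv.Perm ℤ :=
  Function.Involutive.toPerm
    (fun x : ℤ => if (x : ZMod n) = i then x + 1 else if (x : ZMod n) = i + 1 then x - 1 else x) (by
      intro x
      by_cases h : (x : ZMod n) = i
      · simp [h]
      · by_cases h' : (x : ZMod n) = i + 1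
        · simp [h']
        · simp [h, h'])

theorem affSwap_apply (i : ZMod n) (x : ℤ) : affSwap i x =
    if (x : ZMod n) = i then x + 1 else if (x : ZMod n) = i + 1 then x - 1 else x := rfl

theorem affSwap_self (x : ℤ) : affSwap (x : ZMod n) x = x + 1 := by simp [affSwap_apply]

theorem affSwap_of_eq {i : ZMod n} {x : ℤ} (h : (x : ZMod n) = i) : affSwap i x = x + 1 := by
  simp [affSwap_apply, h]

theorem affSwap_of_eq_add_one {i : ZMod n} {x : ℤ} (h : (x : ZMod n) = i + 1) :
    affSwap i x = x - 1 := by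
  simp [affSwap_apply, h]

theorem affSwap_of_ne {i : ZMod n} {x : ℤ} (h : (x : ZMod n) ≠ i) (h' : (x : ZMod n) ≠ i + 1) :
    affSwap i x = x := by
  simp [affSwap_apply, h, h']

theorem affSwap_mul_self (i : ZMod n) : affSwap i * affSwap i = 1 := by
  ext x
  exact Function.Involutive.toPerm_involutive _ x

theorem affSwap_commute {i j : ZMod n} (h₁ : i ≠ j + 1) (h₂ : j ≠ i + 1) :
    affSwap i * affSwap j = affSwap j * affSwap i := by
  by_cases hij : i = j
  · rw [hij]
  ext x
  simp only [Equiv.Perm.mul_apply]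
  have h₃ : i + 1 ≠ j + 1 := fun h => hij (add_right_cancel h)
  by_cases hi : (x : ZMod n) = i
  · rw [affSwap_of_eq hi, affSwap_of_ne (i := j) (x := x) (by rwa [hi]) (by rwa [hi]), affSwap_of_eq hi, affSwap_of_ne]
    · push_cast; rw [hi]; exact h₂.symm
    · push_cast; rw [hi]; exact h₃
  by_cases hi' : (x : ZMod n) = i + 1
  · rw [affSwap_of_eq_add_one hi', affSwap_of_ne (i := j) (x := x) (by rw [hi']; exact h₂.symm)
      (by rwa [hi']),
      affSwap_of_eq_add_one hi', affSwap_of_ne]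
    · push_cast; rw [hi', add_sub_cancel_right]; exact hij
    · push_cast; rw [hi', add_sub_cancel_right]; exact h₁
  rw [affSwap_of_ne hi hi']
  by_cases hj : (x : ZMod n) = j
  · rw [affSwap_of_eq hj, affSwap_of_ne]
    · push_cast; rw [hj]; exact h₁.symm
    · push_cast; rw [hj]; exact h₃.symm
  by_cases hj' : (x : ZMod n) = j + 1
  · rw [affSwap_of_eq_add_one hj', affSwap_of_ne]
    · push_cast; rw [hj', add_sub_cancel_right]; exact Ne.symm hij
    · push_cast; rw [hj', add_sub_cancel_right]; exact h₂
  rw [affSwap_of_ne hj hj', affSwap_of_ne hi hi']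

theorem two_ne_zero_of_ne_two (hn : n ≠ 2) : (1 : ZMod n) + 1 ≠ 0 := by
  have h1 : 1 < n := Fact.out
  intro h
  have : ((2 : ℕ) : ZMod n) = 0 := by rw [← h]; norm_num
  rw [ZMod.natCast_eq_zero_iff] at this
  exact hn (le_antisymm (Nat.le_of_dvd two_pos this) h1)

/-- Both sides exchange x and x + 2 for all x ≡ i and fix everything else; n ≠ 2 keeps i and i + 2
distinct. -/
theorem affSwap_braid (hn : n ≠ 2) (i : ZMod n) :
    affSwap i * affSwap (i + 1) * affSwap i = affSwap (i + 1) * affSwap i * affSwap (i + 1) := by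
  have h2 : i + 1 + 1 ≠ i := by
    rw [add_assoc]; exact fun h => two_ne_zero_of_ne_two hn (by simpa using h)
  have h1 : i + 1 ≠ i := by simp
  have h1' : i + 1 + 1 ≠ i + 1 := by simp
  ext x
  simp only [Equiv.Perm.mul_apply]
  by_cases hi : (x : ZMod n) = i
  · rw [affSwap_of_eq hi, affSwap_of_eq (i := i + 1) (x := x + 1) (by push_cast; rw [hi]),
      affSwap_of_ne (i := i + 1) (x := x) (by rw [hi]; exact h1.symm) (by rw [hi]; exact h2.symm),
      affSwap_of_eq hi, affSwap_of_eq (i := i + 1) (x := x + 1) (by push_cast; rw [hi]),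
      affSwap_of_ne]
    · push_cast; rw [hi]; exact h2
    · push_cast; rw [hi]; exact h1'
  by_cases hi' : (x : ZMod n) = i + 1
  · rw [affSwap_of_eq_add_one hi', affSwap_of_ne (i := i + 1) (x := x - 1)
      (by push_cast; rw [hi', add_sub_cancel_right]; exact h1.symm)
      (by push_cast; rw [hi', add_sub_cancel_right]; exact h2.symm),
      affSwap_of_eq (i := i) (x := x - 1) (by push_cast; rw [hi', add_sub_cancel_right]),
      affSwap_of_eq (i := i + 1) hi', affSwap_of_ne (i := i) (x := x + 1)
      (by push_cast; rw [hi']; exact h2) (by push_cast; rw [hi']; exact h1'),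
      affSwap_of_eq_add_one (i := i + 1)]
    · ring
    · push_cast; rw [hi']
  by_cases hi2 : (x : ZMod n) = i + 1 + 1
  · rw [affSwap_of_ne hi hi', affSwap_of_eq_add_one hi2, affSwap_of_eq_add_one (i := i) (x := x - 1),
      affSwap_of_ne]
    · push_cast; rw [hi2, add_sub_cancel_right, add_sub_cancel_right]; exact h1.symm
    · push_cast; rw [hi2, add_sub_cancel_right, add_sub_cancel_right]; exact h2.symm
    · push_cast; rw [hi2, add_sub_cancel_right]
  · rw [affSwap_of_ne hi hi', affSwap_of_ne hi' hi2, affSwap_of_ne hi hi', affSwap_of_ne hi' hi2]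

theorem affSwap_isLiftable : (affineMatrix n).IsLiftable (affSwap (n := n)) := by
  have key : ∀ i : ZMod n, n ≠ 2 → (affSwap i * affSwap (i + 1)) ^ 3 = 1 := by
    intro i hn
    have : (affSwap i * affSwap (i + 1)) ^ 3 = (affSwap i * affSwap (i + 1) * affSwap i) *
      (affSwap (i + 1) * affSwap i * affSwap (i + 1)) := by simp only [pow_succ, pow_zero, one_mul, mul_assoc]
    rw [this, affSwap_braid hn]
    simp only [mul_assoc]
    rw [← mul_assoc (affSwap (i + 1)) (affSwap (i + 1)), affSwap_mul_self, one_mul,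
      ← mul_assoc (affSwap i) (affSwap i), affSwap_mul_self, one_mul, affSwap_mul_self]
  intro i j
  by_cases hij : i = j
  · subst hij
    rw [(affineMatrix n).diagonal, pow_one, affSwap_mul_self]
  simp only [affineMatrix, if_neg hij]
  split_ifs with h hn
  · simp
  · rcases h with h | h
    · have := key j hn
      rw [h, ← inv_inj, ← inv_pow, mul_inv_rev, inv_one]
      rwa [inv_eq_of_mul_eq_one_left (affSwap_mul_self _),
        inv_eq_of_mul_eq_one_left (affSwap_mul_self _)]
    · rw [h]; exact key i hn
  · push Not at h
    rw [pow_two, mul_assoc, ← mul_assoc (affSwap j), ← affSwap_commute h.1 h.2, mul_assoc (affSwap i),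
      affSwap_mul_self, mul_one, affSwap_mul_self]

/-- The realization of the affine symmetric group by permutations of `ℤ`. -/
def perm : AffSym n →* Equiv.Perm ℤ := (cs n).lift ⟨affSwap, affSwap_isLiftable⟩

@[simp]
theorem perm_simple (i : ZMod n) : perm ((cs n).simple i) = affSwap i :=
  (cs n).lift_apply_simple affSwap_isLiftable i

theorem affSwap_add (i : ZMod n) (x : ℤ) : affSwap i (x + n) = affSwap i x + n := by
  simp only [affSwap_apply]
  push_cast
  simp only [CharP.cast_eq_zero, add_zero]
  split_ifs <;> ring

theorem perm_add (w : AffSym n) : ∀ x : ℤ, perm w (x + n) = perm w x + n := by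
  induction w using (cs n).simple_induction_left with
  | one => simp
  | mul_simple_left w i ih => intro x; simp [ih, affSwap_add]

theorem simple_commute {i j : ZMod n} (h₁ : i ≠ j + 1) (h₂ : j ≠ i + 1) :
    (cs n).simple i * (cs n).simple j = (cs n).simple j * (cs n).simple i := by
  by_cases hij : i = j
  · rw [hij]
  have := (cs n).simple_mul_simple_pow i j
  have hM : (affineMatrix n) i j = 2 := by simp [affineMatrix, hij, h₁, h₂]
  rw [hM, pow_two, mul_eq_one_iff_eq_inv] at this
  simpa using this

theorem simple_braid (hn : n ≠ 2) (i : ZMod n) :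
    (cs n).simple i * (cs n).simple (i + 1) * (cs n).simple i =
      (cs n).simple (i + 1) * (cs n).simple i * (cs n).simple (i + 1) := by
  have := (cs n).simple_mul_simple_pow i (i + 1)
  have hM : (affineMatrix n) i (i + 1) = 3 := by simp [affineMatrix, hn]
  rw [hM] at this
  have h3 : ((cs n).simple i * (cs n).simple (i + 1)) ^ 3 =
      ((cs n).simple i * (cs n).simple (i + 1) * (cs n).simple i) *
      ((cs n).simple (i + 1) * (cs n).simple i * (cs n).simple (i + 1)) := by
    simp only [pow_succ, pow_zero, one_mul, mul_assoc]
  rw [h3, mul_eq_one_iff_eq_inv] at this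
  simpa [mul_assoc] using this

end Perm

end AffNil

end

/-! ### Descents read off the permutation, and Matsumoto's theorem -/

noncomputable section
namespace AffNil
attribute [-simp] CoxeterMatrix.toCoxeterSystem_simple
set_option linter.unusedSectionVars false
variable {n : ℕ} [Fact (1 < n)]

/-- Induction on the length, with w = v s_j for a right descent j. If j is not adjacent to x, then
s_j and s_x commute and v inherits the ascent at x. If it is adjacent, either v also has an ascent
at x and two inequalities for v are chained, or v = u s_x; then w s_x = u s_x s_j s_x = u s_j s_x
s_j is long, so j is an ascent of u, which is the inequality needed. -/
theorem perm_lt_of_length_lt (w : AffSym n) (x : ℤ)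
    (h : (cs n).length w < (cs n).length (w * (cs n).simple (x : ZMod n))) :
    perm w x < perm w (x + 1) := by
  induction hl : (cs n).length w using Nat.strong_induction_on generalizing w x with
  | _ l ih =>
  by_cases hw : w = 1
  · subst hw; simp
  obtain ⟨j, hj⟩ := (cs n).exists_rightDescent_of_ne_one hw
  obtain ⟨v, rfl⟩ : ∃ v, w = v * (cs n).simple j := ⟨w * (cs n).simple j, by simp⟩
  have hv : (cs n).length (v * (cs n).simple j) = (cs n).length v + 1 := by
    rw [(cs n).isRightDescent_iff] at hj
    simpa using hj.symm
  -- a product of `w * s` with one or two further generators cannot be too short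
  have hlen : ∀ u t : AffSym n, v * (cs n).simple j * (cs n).simple (x : ZMod n) = u * t →
      (cs n).length v + 1 < (cs n).length u + (cs n).length t := by
    intro u t hut
    have := (cs n).length_mul_le u t
    rw [← hut] at this
    omega
  have hlt : ∀ (u : AffSym n) (y : ℤ), (cs n).length u < l →
      (cs n).length (u * (cs n).simple (y : ZMod n)) ≠ (cs n).length u - 1 ∨
        (cs n).length u = 0 → perm u y < perm u (y + 1) := by
    intro u y hu hne
    refine ih _ hu u y ?_ rfl
    rcases (cs n).length_mul_simple u (y : ZMod n) with h | h
    · omega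
    · omega
  rw [map_mul, perm_simple, Equiv.Perm.mul_apply, Equiv.Perm.mul_apply]
  have hxj : j ≠ (x : ZMod n) := by
    rintro rfl
    rw [(cs n).simple_mul_simple_cancel_right] at h
    omega
  by_cases h1 : j = (x : ZMod n) + 1
  · have hjx : j = ((x + 1 : ℤ) : ZMod n) := by push_cast; exact h1
    have ev : perm v (x + 1) < perm v (x + 1 + 1) :=
      ih _ (by omega) v (x + 1) (by rw [← hjx]; omega) rfl
    -- Without a braid relation, j = x + 1 ≡ x - 1 and the periodicity v(x + 1) = v(x - 1) + 2 takes
    -- its place.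
    by_cases hn : n = 2
    · have e1 : affSwap j x = x - 1 := affSwap_of_eq_add_one (by
        subst hn; rw [h1, add_assoc]; exact (by
          rw [show (1 : ZMod 2) + 1 = 0 from rfl, add_zero]))
      have e2 : affSwap j (x + 1) = x + 2 := by rw [affSwap_of_eq hjx.symm]; ring
      rw [e1, e2]
      have e3 := perm_add v (x - 1)
      subst hn
      push_cast at e3
      rw [show x - 1 + 2 = x + 1 by ring] at e3
      rw [show x + 1 + 1 = x + 2 by ring] at ev
      omega
    have e1 : affSwap j x = x := by
      refine affSwap_of_ne hxj.symm ?_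
      rw [h1, add_assoc]
      exact fun h => two_ne_zero_of_ne_two hn (by simpa using h)
    have e2 : affSwap j (x + 1) = x + 1 + 1 := affSwap_of_eq hjx.symm
    rw [e1, e2]
    by_cases hvi : (cs n).length v < (cs n).length (v * (cs n).simple (x : ZMod n))
    · exact (ih _ (by omega) v x hvi rfl).trans ev
    obtain ⟨u, rfl⟩ : ∃ u, v = u * (cs n).simple (x : ZMod n) :=
      ⟨v * (cs n).simple (x : ZMod n), by simp⟩
    rw [(cs n).simple_mul_simple_cancel_right] at hvi
    have hu : (cs n).length (u * (cs n).simple (x : ZMod n)) = (cs n).length u + 1 := by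
      rcases (cs n).length_mul_simple u (x : ZMod n) with h | h <;> omega
    have a1 : perm u x < perm u (x + 1) := ih _ (by omega) u x (by omega) rfl
    have a2 : perm u (x + 1) < perm u (x + 1 + 1) := by
      refine ih _ (by omega) u (x + 1) ?_ rfl
      have := hlen (u * (cs n).simple j) ((cs n).simple (x : ZMod n) * (cs n).simple j) (by
        rw [h1]
        have := simple_braid hn (x : ZMod n)
        simp only [mul_assoc] at this ⊢
        rw [this])
      have h2 := (cs n).length_mul_le ((cs n).simple (x : ZMod n)) ((cs n).simple j)
      rw [(cs n).length_simple, (cs n).length_simple] at h2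
      rw [← hjx]
      rcases (cs n).length_mul_simple u j with h | h <;> omega
    rw [map_mul, perm_simple, Equiv.Perm.mul_apply, Equiv.Perm.mul_apply, affSwap_self,
      affSwap_of_ne (x := x + 1 + 1)]
    · exact a2
    · push_cast; rw [add_assoc]
      exact fun h => two_ne_zero_of_ne_two hn (by simpa using h)
    · push_cast; simp
  by_cases h2 : (x : ZMod n) = j + 1
  · have hjx : j = ((x - 1 : ℤ) : ZMod n) := by push_cast; rw [h2, add_sub_cancel_right]
    have ev : perm v (x - 1) < perm v x := by
      have := ih _ (by omega) v (x - 1) (by rw [← hjx]; omega) rfl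
      rwa [sub_add_cancel] at this
    have hn : n ≠ 2 := by
      intro hn
      refine h1 ?_
      subst hn
      rw [h2, add_assoc, show (1 : ZMod 2) + 1 = 0 from rfl, add_zero]
    have e1 : affSwap j x = x - 1 := affSwap_of_eq_add_one h2
    have e2 : affSwap j (x + 1) = x + 1 := by
      refine affSwap_of_ne ?_ ?_
      · push_cast; exact fun h => h1 h.symm
      · push_cast; rw [h2]; simp
    rw [e1, e2]
    by_cases hvi : (cs n).length v < (cs n).length (v * (cs n).simple (x : ZMod n))
    · exact ev.trans (ih _ (by omega) v x hvi rfl)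
    obtain ⟨u, rfl⟩ : ∃ u, v = u * (cs n).simple (x : ZMod n) :=
      ⟨v * (cs n).simple (x : ZMod n), by simp⟩
    rw [(cs n).simple_mul_simple_cancel_right] at hvi
    have hu : (cs n).length (u * (cs n).simple (x : ZMod n)) = (cs n).length u + 1 := by
      rcases (cs n).length_mul_simple u (x : ZMod n) with h | h <;> omega
    have a2 : perm u (x - 1) < perm u (x - 1 + 1) := by
      refine ih _ (by omega) u (x - 1) ?_ rfl
      have := hlen (u * (cs n).simple j) ((cs n).simple (x : ZMod n) * (cs n).simple j) (by
        rw [h2]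
        have := simple_braid hn j
        simp only [mul_assoc] at this ⊢
        rw [this])
      have h2 := (cs n).length_mul_le ((cs n).simple (x : ZMod n)) ((cs n).simple j)
      rw [(cs n).length_simple, (cs n).length_simple] at h2
      rw [← hjx]
      rcases (cs n).length_mul_simple u j with h | h <;> omega
    rw [map_mul, perm_simple, Equiv.Perm.mul_apply, Equiv.Perm.mul_apply,
      affSwap_of_ne (x := x - 1), affSwap_of_eq_add_one (x := x + 1)]
    · simpa using a2
    · push_cast; rfl
    · rw [← hjx]; exact hxj
    · rw [← hjx]; exact h1
  · have e1 : affSwap j x = x := affSwap_of_ne hxj.symm h2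
    have e2 : affSwap j (x + 1) = x + 1 := by
      refine affSwap_of_ne ?_ ?_
      · push_cast; exact fun h => h1 h.symm
      · push_cast; intro h; exact hxj (add_right_cancel h).symm
    rw [e1, e2]
    refine ih _ (by omega) v x ?_ rfl
    have := hlen (v * (cs n).simple (x : ZMod n)) ((cs n).simple j) (by
      rw [mul_assoc, mul_assoc, simple_commute h1 h2])
    rw [(cs n).length_simple] at this
    omega

theorem length_lt_iff (w : AffSym n) (x : ℤ) :
    (cs n).length w < (cs n).length (w * (cs n).simple (x : ZMod n)) ↔
      perm w x < perm w (x + 1) := by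
  refine ⟨perm_lt_of_length_lt w x, fun h => ?_⟩
  by_contra hlt
  have := perm_lt_of_length_lt (w * (cs n).simple (x : ZMod n)) x (by
    rw [(cs n).simple_mul_simple_cancel_right]
    have := (cs n).length_mul_simple_ne w (x : ZMod n)
    omega)
  rw [map_mul, perm_simple, Equiv.Perm.mul_apply, Equiv.Perm.mul_apply, affSwap_self,
    affSwap_of_eq_add_one (x := x + 1) (by push_cast; rfl), add_sub_cancel_right] at this
  exact lt_asymm h this

theorem isRightDescent_iff_perm (w : AffSym n) (x : ℤ) :
    (cs n).IsRightDescent w (x : ZMod n) ↔ perm w (x + 1) < perm w x := by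
  have h := length_lt_iff w x
  have h1 := (cs n).length_mul_simple_ne w (x : ZMod n)
  have h2 : perm w x ≠ perm w (x + 1) := fun h => by simpa using (perm w).injective h
  unfold CoxeterSystem.IsRightDescent
  omega

/-- A nontrivial element has a right descent, where its permutation decreases, unlike the identity.
-/
theorem perm_injective : Function.Injective (perm (n := n)) := by
  rw [injective_iff_map_eq_one]
  intro w hw
  by_contra hne
  obtain ⟨j, hj⟩ := (cs n).exists_rightDescent_of_ne_one hne
  obtain ⟨x, rfl⟩ := ZMod.intCast_surjective j
  rw [isRightDescent_iff_perm, hw] at hj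
  simp at hj

theorem length_mul_simple_of_not {w : AffSym n} {i : ZMod n}
    (h : ¬ (cs n).IsRightDescent w i) :
    (cs n).length (w * (cs n).simple i) = (cs n).length w + 1 :=
  (cs n).not_isRightDescent_iff.1 h

/-! ### The nilCoxeter algebra -/

theorem gen_sq (i : ZMod n) : gen n i * gen n i = 0 := by
  rw [gen, ← map_mul, RingQuot.mkAlgHom_rel ℤ (NilRel.sq i), map_zero]

theorem gen_comm {i j : ZMod n} (h₁ : i ≠ j + 1) (h₂ : j ≠ i + 1) :
    gen n i * gen n j = gen n j * gen n i := by
  rw [gen, gen, ← map_mul, RingQuot.mkAlgHom_rel ℤ (NilRel.comm i j _ _), map_mul]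
  · exact fun h => h₁ (by rw [← h]; ring)
  · exact fun h => h₂ (by rw [sub_eq_iff_eq_add] at h; rw [h]; ring)

theorem gen_braid (hn : n ≠ 2) (i : ZMod n) :
    gen n i * gen n (i + 1) * gen n i = gen n (i + 1) * gen n i * gen n (i + 1) := by
  simp only [gen, ← map_mul]
  rw [RingQuot.mkAlgHom_rel ℤ (NilRel.braid hn i)]

/-- The product of generators of the nilCoxeter algebra along a word. -/
def genProd (ω : List (ZMod n)) : NilAlg n := (ω.map (gen n)).prod

@[simp] theorem genProd_nil : genProd ([] : List (ZMod n)) = 1 := rfl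

theorem genProd_append (ω ω' : List (ZMod n)) : genProd (ω ++ ω') = genProd ω * genProd ω' := by
  simp [genProd]

theorem genProd_cons (i : ZMod n) (ω : List (ZMod n)) :
    genProd (i :: ω) = gen n i * genProd ω := by
  simp [genProd]

theorem genProd_singleton (i : ZMod n) : genProd [i] = gen n i := by simp [genProd]

theorem isReduced_concat {ω : List (ZMod n)} {i : ZMod n} (hω : (cs n).IsReduced ω)
    (h : ¬ (cs n).IsRightDescent ((cs n).wordProd ω) i) : (cs n).IsReduced (ω ++ [i]) := by
  unfold CoxeterSystem.IsReduced at *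
  rw [(cs n).wordProd_append, (cs n).wordProd_singleton, length_mul_simple_of_not h, hω]
  simp

theorem IsReduced.of_concat {ω : List (ZMod n)} {i : ZMod n} (h : (cs n).IsReduced (ω ++ [i])) :
    (cs n).IsReduced ω ∧ (cs n).IsRightDescent ((cs n).wordProd (ω ++ [i])) i := by
  have h1 : (cs n).IsReduced ω := by simpa using h.take ω.length
  refine ⟨h1, ?_⟩
  unfold CoxeterSystem.IsRightDescent
  rw [h.eq, (cs n).wordProd_append, (cs n).wordProd_singleton,
    (cs n).simple_mul_simple_cancel_right, h1.eq]
  simp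

/-- Matsumoto's theorem, for the nilCoxeter algebra. -/
theorem genProd_eq_of_isReduced (ω ω' : List (ZMod n)) (hω : (cs n).IsReduced ω)
    (hω' : (cs n).IsReduced ω') (h : (cs n).wordProd ω = (cs n).wordProd ω') :
    genProd ω = genProd ω' := by
  induction hl : ω.length using Nat.strong_induction_on generalizing ω ω' with
  | _ l ih =>
  have hll : ω'.length = ω.length := by rw [← hω.eq, ← hω'.eq, h]
  rcases List.eq_nil_or_concat' ω with rfl | ⟨α, i, rfl⟩
  · rw [List.length_nil, List.length_eq_zero_iff] at hll
    rw [hll]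
  rcases List.eq_nil_or_concat' ω' with rfl | ⟨β, j, rfl⟩
  · simp at hll
  obtain ⟨hα, hi⟩ := IsReduced.of_concat hω
  obtain ⟨hβ, hj⟩ := IsReduced.of_concat hω'
  simp only [List.length_append, List.length_singleton] at hl hll
  by_cases hij : i = j
  · subst hij
    rw [(cs n).wordProd_append, (cs n).wordProd_append, mul_left_inj] at h
    rw [genProd_append, genProd_append, ih _ (by omega) α β hα hβ h rfl]
  -- common continuation: a word for `w` ending in a given suffix
  rw [← h] at hj
  set w := (cs n).wordProd (α ++ [i]) with hw
  have hwlen : (cs n).length w = l := by rw [hω.eq, ← hl]; simp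
  have hwα : (cs n).wordProd α = w * (cs n).simple i := by
    rw [hw, (cs n).wordProd_append, (cs n).wordProd_singleton,
      (cs n).simple_mul_simple_cancel_right]
  have hwβ : (cs n).wordProd β = w * (cs n).simple j := by
    rw [h, (cs n).wordProd_append, (cs n).wordProd_singleton,
      (cs n).simple_mul_simple_cancel_right]
  -- Descents at x and x + 1 mean w(x) > w(x + 1) > w(x + 2), which periodicity excludes for n = 2.
  -- Hence both sides of the braid relation can be split off on the right of w; γ is a reduced word
  -- for the rest, and the induction hypothesis compares α and β with words that begin with γ.
  have adj : ∀ i j : ZMod n, j = i + 1 → ∀ α β : List (ZMod n), (cs n).IsReduced α →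
      (cs n).IsReduced β → α.length + 1 = l → β.length + 1 = l →
      (cs n).wordProd α = w * (cs n).simple i → (cs n).wordProd β = w * (cs n).simple j →
      (cs n).IsRightDescent w i → (cs n).IsRightDescent w j →
      genProd α * gen n i = genProd β * gen n j := by
    rintro i _ rfl α β hα hβ hlα hlβ hwα hwβ hi hj
    obtain ⟨x, rfl⟩ := ZMod.intCast_surjective i
    rw [show (x : ZMod n) + 1 = ((x + 1 : ℤ) : ZMod n) by push_cast; rfl,
      isRightDescent_iff_perm] at hj
    have hi' := hi
    rw [isRightDescent_iff_perm] at hi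
    have hn : n ≠ 2 := by
      rintro rfl
      have := perm_add w x
      push_cast at this
      rw [add_assoc] at hj
      norm_num at hj
      omega
    have hx2 : (x : ZMod n) + 1 + 1 ≠ (x : ZMod n) := by
      rw [add_assoc]; exact fun h => two_ne_zero_of_ne_two hn (by simpa using h)
    have d1 : (cs n).IsRightDescent (w * (cs n).simple (x : ZMod n)) ((x + 1 : ℤ) : ZMod n) := by
      rw [isRightDescent_iff_perm, map_mul, perm_simple, Equiv.Perm.mul_apply,
        Equiv.Perm.mul_apply, affSwap_of_ne (x := x + 1 + 1) (by push_cast; exact hx2)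
        (by push_cast; simp), affSwap_of_eq_add_one (x := x + 1) (by push_cast; rfl),
        add_sub_cancel_right]
      exact hj.trans hi
    have d2 : (cs n).IsRightDescent (w * (cs n).simple (x : ZMod n) *
        (cs n).simple ((x + 1 : ℤ) : ZMod n)) (x : ZMod n) := by
      rw [isRightDescent_iff_perm, map_mul, perm_simple, Equiv.Perm.mul_apply,
        Equiv.Perm.mul_apply, affSwap_self, affSwap_of_ne (x := x) (by push_cast; simp)
        (by push_cast; exact hx2.symm), map_mul, perm_simple, Equiv.Perm.mul_apply,
        Equiv.Perm.mul_apply, affSwap_self, affSwap_of_ne (x := x + 1 + 1)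
        (by push_cast; exact hx2) (by push_cast; simp)]
      exact hj
    push_cast at d1 d2
    rw [(cs n).isRightDescent_iff] at d1 d2 hi'
    obtain ⟨γ, hγ, hγw⟩ := (cs n).exists_isReduced (w * (cs n).simple (x : ZMod n) *
      (cs n).simple ((x : ZMod n) + 1) * (cs n).simple (x : ZMod n))
    have e1 : genProd α = genProd (γ ++ [(x : ZMod n), (x : ZMod n) + 1]) := by
      have hp : (cs n).wordProd (γ ++ [(x : ZMod n), (x : ZMod n) + 1]) = (cs n).wordProd α := by
        rw [hwα, (cs n).wordProd_append, ← hγw]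
        simp [(cs n).wordProd_cons, ← mul_assoc]
      refine ih _ (by omega) _ _ hα ?_ hp.symm rfl
      unfold CoxeterSystem.IsReduced
      rw [hp, hα.eq, List.length_append, ← hγ.eq, ← hγw]
      simp
      omega
    have hbr := simple_braid hn (x : ZMod n)
    have e2 : genProd β = genProd (γ ++ [(x : ZMod n) + 1, (x : ZMod n)]) := by
      have hp : (cs n).wordProd (γ ++ [(x : ZMod n) + 1, (x : ZMod n)]) = (cs n).wordProd β := by
        rw [hwβ, (cs n).wordProd_append, ← hγw, mul_assoc w, mul_assoc w, hbr]
        simp [(cs n).wordProd_cons, ← mul_assoc]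
      refine ih _ (by omega) _ _ hβ ?_ hp.symm rfl
      unfold CoxeterSystem.IsReduced
      rw [hp, hβ.eq, List.length_append, ← hγ.eq, ← hγw]
      simp
      omega
    rw [e1, e2]
    have := gen_braid hn (x : ZMod n)
    simp only [genProd_append, genProd_cons, genProd_nil, mul_one, mul_assoc] at this ⊢
    rw [this]
  rw [genProd_append, genProd_append, genProd_singleton, genProd_singleton]
  by_cases h1 : j = i + 1
  · exact adj i j h1 α β hα hβ (by omega) (by omega) hwα hwβ hi hj
  by_cases h2 : i = j + 1
  · exact (adj j i h2 β α hβ hα (by omega) (by omega) hwβ hwα hj hi).symm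
  -- The letters are not adjacent, so w has the reduced words γ j i and γ i j.
  have d1 : (cs n).IsRightDescent (w * (cs n).simple i) j := by
    obtain ⟨y, rfl⟩ := ZMod.intCast_surjective j
    rw [isRightDescent_iff_perm] at hj ⊢
    rw [map_mul, perm_simple, Equiv.Perm.mul_apply, Equiv.Perm.mul_apply,
      affSwap_of_ne (x := y) (Ne.symm hij) h1, affSwap_of_ne (x := y + 1)]
    · exact hj
    · push_cast; exact Ne.symm h2
    · push_cast; exact fun h => hij (add_right_cancel h).symm
  rw [(cs n).isRightDescent_iff] at d1 hi
  obtain ⟨γ, hγ, hγw⟩ := (cs n).exists_isReduced (w * (cs n).simple i * (cs n).simple j)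
  have e1 : genProd α = genProd (γ ++ [j]) := by
    have hp : (cs n).wordProd (γ ++ [j]) = (cs n).wordProd α := by
      rw [hwα, (cs n).wordProd_append, ← hγw]
      simp
    refine ih _ (by omega) _ _ hα ?_ hp.symm rfl
    unfold CoxeterSystem.IsReduced
    rw [hp, hα.eq, List.length_append, ← hγ.eq, ← hγw]
    simp
    omega
  have e2 : genProd β = genProd (γ ++ [i]) := by
    have hp : (cs n).wordProd (γ ++ [i]) = (cs n).wordProd β := by
      rw [hwβ, (cs n).wordProd_append, ← hγw, mul_assoc w, simple_commute h2 h1]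
      simp [← mul_assoc]
    refine ih _ (by omega) _ _ hβ ?_ hp.symm rfl
    unfold CoxeterSystem.IsReduced
    rw [hp, hβ.eq, List.length_append, ← hγ.eq, ← hγw]
    simp
    omega
  rw [e1, e2, genProd_append, genProd_append, genProd_singleton, genProd_singleton, mul_assoc,
    mul_assoc, gen_comm h2 h1]

theorem elt_wordProd {ω : List (ZMod n)} (hω : (cs n).IsReduced ω) :
    elt n ((cs n).wordProd ω) = genProd ω := by
  have h := ((cs n).exists_isReduced ((cs n).wordProd ω)).choose_spec
  exact genProd_eq_of_isReduced _ _ h.1 hω h.2.symm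

@[simp] theorem elt_one : elt n (1 : AffSym n) = 1 := by
  have := elt_wordProd (n := n) (ω := []) (by simp [CoxeterSystem.IsReduced])
  simpa using this

theorem elt_simple (i : ZMod n) : elt n ((cs n).simple i) = gen n i := by
  have := elt_wordProd (n := n) (ω := [i]) (by simp [CoxeterSystem.IsReduced])
  simpa [genProd] using this

open scoped Classical in
theorem elt_mul_gen (w : AffSym n) (i : ZMod n) : elt n w * gen n i =
    if (cs n).IsRightDescent w i then 0 else elt n (w * (cs n).simple i) := by
  have key : ∀ v : AffSym n, ¬ (cs n).IsRightDescent v i →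
      elt n v * gen n i = elt n (v * (cs n).simple i) := by
    intro v hv
    obtain ⟨ω, hω, rfl⟩ := (cs n).exists_isReduced v
    have := elt_wordProd (isReduced_concat hω hv)
    rw [(cs n).wordProd_append, (cs n).wordProd_singleton] at this
    rw [this, genProd_append, genProd_singleton, elt_wordProd hω]
  split_ifs with h
  · have h' := (cs n).isRightDescent_iff_not_isRightDescent_mul.1 h
    have := key _ h'
    rw [(cs n).simple_mul_simple_cancel_right] at this
    rw [← this, mul_assoc, gen_sq, mul_zero]
  · exact key w h

theorem elt_mul_elt (w v : AffSym n) : elt n w * elt n v =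
    if (cs n).length (w * v) = (cs n).length w + (cs n).length v then elt n (w * v) else 0 := by
  obtain ⟨ω, hω, rfl⟩ := (cs n).exists_isReduced v
  rw [elt_wordProd hω, hω.eq]
  induction ω using List.reverseRecOn with
  | nil => simp
  | append_singleton ω i ih =>
    obtain ⟨hω', hi⟩ := IsReduced.of_concat hω
    rw [genProd_append, genProd_singleton, ← mul_assoc, ih hω', (cs n).wordProd_append,
      (cs n).wordProd_singleton, List.length_append, List.length_singleton, ← mul_assoc]
    have hle := (cs n).length_mul_le w ((cs n).wordProd ω)
    rw [hω'.eq] at hle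
    split_ifs with h1 h2 h2
    · rw [elt_mul_gen, if_neg]
      unfold CoxeterSystem.IsRightDescent
      omega
    · rw [elt_mul_gen, if_pos]
      unfold CoxeterSystem.IsRightDescent
      rcases (cs n).length_mul_simple (w * (cs n).wordProd ω) i with h | h <;> omega
    · rcases (cs n).length_mul_simple (w * (cs n).wordProd ω) i with h | h <;> omega
    · rw [zero_mul]

theorem elt_mul_elt_of_length {w v : AffSym n}
    (h : (cs n).length (w * v) = (cs n).length w + (cs n).length v) :
    elt n w * elt n v = elt n (w * v) := by
  rw [elt_mul_elt, if_pos h]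

/-! ### The regular representation of the nilCoxeter algebra -/

/-- Left multiplication by `A_i` in the basis `A_w`. -/
def regGen (i : ZMod n) : Module.End ℤ (AffSym n →₀ ℤ) :=
  Finsupp.linearCombination ℤ fun w =>
    if (cs n).length ((cs n).simple i * w) = 1 + (cs n).length w then
      Finsupp.single ((cs n).simple i * w) 1 else 0

theorem regGen_single (i : ZMod n) (w : AffSym n) : regGen i (Finsupp.single w 1) =
    if (cs n).length ((cs n).simple i * w) = 1 + (cs n).length w then
      Finsupp.single ((cs n).simple i * w) 1 else 0 := by
  simp [regGen]

/-- The value depends only on the length and the product of the word, which is why these operators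
satisfy the nilCoxeter relations. -/
theorem regGen_prod_single (ω : List (ZMod n)) (w : AffSym n) :
    (ω.map regGen).prod (Finsupp.single w 1) =
      if (cs n).length ((cs n).wordProd ω * w) = ω.length + (cs n).length w then
        Finsupp.single ((cs n).wordProd ω * w) 1 else 0 := by
  induction ω with
  | nil => simp
  | cons i ω ih =>
    rw [List.map_cons, List.prod_cons, Module.End.mul_apply, ih, (cs n).wordProd_cons, mul_assoc,
      List.length_cons]
    have h1 := (cs n).length_mul_le ((cs n).wordProd ω) w
    have h2 := (cs n).length_wordProd_le ω
    have h3 := (cs n).length_simple_mul ((cs n).wordProd ω * w) i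
    split_ifs with h4 h5 h5
    · rw [regGen_single, if_pos (by omega)]
    · rw [regGen_single, if_neg (by omega)]
    · omega
    · rw [map_zero]

/-- The regular representation of the nilCoxeter algebra. -/
def reg : NilAlg n →ₐ[ℤ] Module.End ℤ (AffSym n →₀ ℤ) :=
  RingQuot.liftAlgHom ℤ ⟨FreeAlgebra.lift ℤ regGen, by
    have ext : ∀ ω ω' : List (ZMod n), ω.length = ω'.length →
        (cs n).wordProd ω = (cs n).wordProd ω' →
        (ω.map regGen).prod = (ω'.map regGen).prod := by
      intro ω ω' h1 h2
      refine Finsupp.lhom_ext' fun w => LinearMap.ext_ring ?_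
      simp only [LinearMap.comp_apply, Finsupp.lsingle_apply, regGen_prod_single, h1, h2]
    intro x y h
    cases h with
    | sq i =>
      simp only [map_mul, FreeAlgebra.lift_ι_apply, map_zero]
      refine Finsupp.lhom_ext' fun w => LinearMap.ext_ring ?_
      have := regGen_prod_single [i, i] w
      rw [if_neg (by simp [(cs n).wordProd_cons])] at this
      simpa using this
    | braid hn i =>
      have := ext [i, i + 1, i] [i + 1, i, i + 1] rfl (by
        simpa [(cs n).wordProd_cons, mul_assoc] using simple_braid hn i)
      simpa [mul_assoc] using this
    | comm i j h₁ h₂ =>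
      have := ext [i, j] [j, i] rfl (by
        simpa [(cs n).wordProd_cons] using simple_commute (n := n) (i := i) (j := j)
          (fun h => h₁ (by rw [h]; ring)) (fun h => h₂ (by rw [h]; ring)))
      simpa using this⟩

theorem reg_gen (i : ZMod n) : reg (gen n i) = regGen i := by
  rw [gen, reg, RingQuot.liftAlgHom_mkAlgHom_apply, FreeAlgebra.lift_ι_apply]

theorem reg_elt (w : AffSym n) : reg (elt n w) (Finsupp.single 1 1) = Finsupp.single w 1 := by
  obtain ⟨ω, hω, rfl⟩ := (cs n).exists_isReduced w
  have h : reg (genProd ω) = (ω.map regGen).prod := by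
    rw [genProd, map_list_prod, List.map_map]
    congr 2
    funext i
    exact reg_gen i
  rw [elt_wordProd hω, h, regGen_prod_single, mul_one, hω.eq]
  simp

/-- The coefficient of `A_u` of an element of the nilCoxeter algebra. -/
def coef (u : AffSym n) : NilAlg n →+ ℤ where
  toFun a := reg a (Finsupp.single 1 1) u
  map_zero' := by simp
  map_add' a b := by simp

open scoped Classical in
theorem coef_elt (u w : AffSym n) : coef u (elt n w) = if w = u then 1 else 0 := by
  have h : coef u (elt n w) = reg (elt n w) (Finsupp.single 1 1) u := rfl
  rw [h, reg_elt, Finsupp.single_apply]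

end AffNil
end

noncomputable section
namespace AffNil
attribute [-simp] CoxeterMatrix.toCoxeterSystem_simple
set_option linter.unusedSectionVars false
variable {n : ℕ} [Fact (1 < n)]

/-! ### Cyclically decreasing and increasing words -/

theorem pair_sublist_iff {α : Type*} {p q : α} {l₁ l₂ : List α} (h : (l₁ ++ p :: l₂).Nodup) :
    [p, q].Sublist (l₁ ++ p :: l₂) ↔ q ∈ l₂ := by
  constructor
  · intro hs
    obtain ⟨a, b, hab, ha, hb⟩ := List.sublist_append_iff.1 hs
    have hp : p ∉ l₁ := fun hp => (List.nodup_append.1 h).2.2 p hp p (by simp) rfl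
    match a, hab with
    | [], hab =>
      rw [List.nil_append] at hab
      rw [← hab, List.cons_sublist_cons] at hb
      simpa using hb
    | c :: a, hab =>
      rw [List.cons_append, List.cons.injEq] at hab
      exact absurd (ha.subset (by simp [hab.1])) hp
  · intro hq
    have : [p, q].Sublist (p :: l₂) := by simpa [List.cons_sublist_cons] using hq
    exact this.trans (List.sublist_append_right _ _)

theorem isCycIncWord_iff_reverse (ω : List (ZMod n)) :
    IsCycIncWord n ω ↔ IsCycDecWord n ω.reverse := by
  unfold IsCycIncWord IsCycDecWord
  rw [List.nodup_reverse]
  simp only [List.mem_reverse]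
  refine and_congr_right fun _ => forall_congr' fun i => imp_congr_right fun _ =>
    imp_congr_right fun _ => ?_
  rw [← List.reverse_sublist]
  simp

theorem IsCycDecWord.tail {a : ZMod n} {ω : List (ZMod n)} (h : IsCycDecWord n (a :: ω)) :
    IsCycDecWord n ω := by
  obtain ⟨h1, h2⟩ := h
  rw [List.nodup_cons] at h1
  refine ⟨h1.2, fun i hi hi' => ?_⟩
  have := h2 i (by simp [hi]) (by simp [hi'])
  rw [List.sublist_cons_iff] at this
  rcases this with h | ⟨r, hr, -⟩
  · exact h
  · rw [List.cons.injEq] at hr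
    exact absurd (hr.1 ▸ hi') h1.1

theorem IsCycDecWord.head_add_one_notMem {a : ZMod n} {ω : List (ZMod n)}
    (h : IsCycDecWord n (a :: ω)) : a + 1 ∉ a :: ω := by
  intro ha
  have h1 := h.1
  have := h.2 a (by simp) ha
  rw [List.sublist_cons_iff] at this
  rw [List.nodup_cons] at h1
  rcases this with h | ⟨r, hr, -⟩
  · exact h1.1 (h.subset (by simp))
  · rw [List.cons.injEq] at hr
    simp at hr

theorem IsCycDecWord.erase {a : ZMod n} {α β : List (ZMod n)}
    (h : IsCycDecWord n (α ++ a :: β)) : IsCycDecWord n (α ++ β) := by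
  obtain ⟨h1, h2⟩ := h
  have ha : a ∉ α ++ β := by
    have := (List.perm_middle.nodup_iff.1 h1)
    exact (List.nodup_cons.1 this).1
  refine ⟨(List.nodup_cons.1 (List.perm_middle.nodup_iff.1 h1)).2, fun i hi hi' => ?_⟩
  have hs := h2 i (by simp at hi ⊢; tauto) (by simp at hi' ⊢; tauto)
  have e : (α ++ a :: β).erase a = α ++ β := by
    rw [List.erase_append_right _ (fun h => ha (by simp [h]))]
    simp
  have := hs.erase a
  rw [e, List.erase_of_not_mem] at this
  · exact this
  · intro hmem
    simp only [List.mem_cons, List.not_mem_nil, or_false] at hmem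
    rcases hmem with rfl | rfl
    · exact ha hi'
    · exact ha hi

/-- The product along a cyclically decreasing word depends only on its set of letters. -/
theorem prod_map_eq_of_isCycDecWord {M : Type*} [Monoid M] {f : ZMod n → M}
    (hf : ∀ i j, i ≠ j + 1 → j ≠ i + 1 → f i * f j = f j * f i) {ω ω' : List (ZMod n)}
    (h : IsCycDecWord n ω) (h' : IsCycDecWord n ω') (hmem : ∀ j, j ∈ ω ↔ j ∈ ω') :
    (ω.map f).prod = (ω'.map f).prod := by
  induction ω generalizing ω' with
  | nil =>
    have : ω' = [] := List.eq_nil_iff_forall_not_mem.2 fun j hj => by simpa using (hmem j).2 hj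
    rw [this]
  | cons a ω ih =>
    obtain ⟨α, β, rfl⟩ := List.append_of_mem ((hmem a).1 (by simp))
    have hnd := h'.1
    have hnd' := List.nodup_cons.1 (List.perm_middle.nodup_iff.1 hnd)
    -- A letter x before a in ω' is not a - 1, which has to follow a, and not a + 1, which is absent
    -- because a comes first in ω. So a can be moved to the front.
    have hα : ∀ x ∈ α, f a * f x = f x * f a := by
      intro x hx
      refine hf _ _ ?_ ?_
      · rintro rfl
        have := h'.2 x (by simp [hx]) (by simp)
        rw [pair_sublist_iff hnd] at this
        exact (List.nodup_append.1 hnd'.2).2.2 x hx x this rfl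
      · rintro rfl
        exact h.head_add_one_notMem ((hmem _).2 (by simp [hx]))
    have hc : f a * (α.map f).prod = (α.map f).prod * f a := by
      clear hnd hnd' h' hmem
      induction α with
      | nil => simp
      | cons x α ih =>
        rw [List.map_cons, List.prod_cons, ← mul_assoc, hα x (by simp), mul_assoc,
          ih (fun y hy => hα y (by simp [hy])), mul_assoc]
    have := ih h.tail h'.erase (by
      intro j
      have hj := hmem j
      have ha : a ∉ ω := (List.nodup_cons.1 h.1).1
      by_cases hja : j = a
      · subst hja
        exact iff_of_false ha hnd'.1
      · simpa [hja] using hj)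
    rw [List.map_cons, List.prod_cons, this, List.map_append, List.prod_append, ← mul_assoc, hc,
      List.map_append, List.prod_append, List.map_cons, List.prod_cons, mul_assoc]

/-- Reversal exchanges the two kinds of words, so this is the decreasing case in the opposite
monoid. -/
theorem prod_map_eq_of_isCycIncWord {M : Type*} [Monoid M] {f : ZMod n → M}
    (hf : ∀ i j, i ≠ j + 1 → j ≠ i + 1 → f i * f j = f j * f i) {ω ω' : List (ZMod n)}
    (h : IsCycIncWord n ω) (h' : IsCycIncWord n ω') (hmem : ∀ j, j ∈ ω ↔ j ∈ ω') :
    (ω.map f).prod = (ω'.map f).prod := by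
  rw [isCycIncWord_iff_reverse] at h h'
  have := prod_map_eq_of_isCycDecWord (f := fun i => MulOpposite.op (f i))
    (fun i j h₁ h₂ => by rw [← MulOpposite.op_mul, ← MulOpposite.op_mul, hf j i h₂ h₁]) h h'
    (by simpa using hmem)
  apply MulOpposite.op_injective
  rw [MulOpposite.op_list_prod, MulOpposite.op_list_prod, List.map_map, List.map_map,
    ← List.map_reverse, ← List.map_reverse]
  exact this

theorem IsCycDecWord.append {ω₁ ω₂ : List (ZMod n)} (h₁ : IsCycDecWord n ω₁)
    (h₂ : IsCycDecWord n ω₂) (hd : ∀ j ∈ ω₁, j ∉ ω₂) (hn : ∀ j ∈ ω₁, j + 1 ∉ ω₂) :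
    IsCycDecWord n (ω₁ ++ ω₂) := by
  refine ⟨List.nodup_append.2 ⟨h₁.1, h₂.1, fun a ha b hb hab => hd a ha (hab ▸ hb)⟩, ?_⟩
  intro i hi hi'
  rw [List.mem_append] at hi hi'
  rcases hi with hi | hi <;> rcases hi' with hi' | hi'
  · exact (h₁.2 i hi hi').trans (List.sublist_append_left _ _)
  · exact absurd hi' (hn i hi)
  · exact List.Sublist.append (List.singleton_sublist.2 hi') (List.singleton_sublist.2 hi)
  · exact (h₂.2 i hi hi').trans (List.sublist_append_right _ _)

theorem isCycDecWord_singleton (i : ZMod n) : IsCycDecWord n [i] := by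
  refine ⟨by simp, fun j hj hj' => ?_⟩
  simp only [List.mem_singleton] at hj hj'
  rw [← hj'] at hj
  simp at hj

section Sets

variable [NeZero n]

theorem eq_univ_of_add_one_mem {J : Finset (ZMod n)} (hJ : J.Nonempty)
    (h : ∀ j ∈ J, j + 1 ∈ J) : J = Finset.univ := by
  obtain ⟨a, ha⟩ := hJ
  have key : ∀ k : ℕ, a + k ∈ J := by
    intro k
    induction k with
    | zero => simpa using ha
    | succ k ih => have := h _ ih; push_cast; rwa [← add_assoc]
  ext j
  simp only [Finset.mem_univ, iff_true]
  have := key (j - a).val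
  rwa [ZMod.natCast_zmod_val, add_sub_cancel] at this

theorem exists_add_one_notMem {J : Finset (ZMod n)} (hJ : J.Nonempty) (h : J ≠ Finset.univ) :
    ∃ j ∈ J, j + 1 ∉ J := by
  by_contra hc
  push Not at hc
  exact h (eq_univ_of_add_one_mem hJ hc)

/-- A nonempty proper set has an element j with j + 1 missing, and such a j may stand first. -/
theorem exists_isCycDecWord {J : Finset (ZMod n)} (hJ : J ≠ Finset.univ) :
    ∃ ω, IsCycDecWord n ω ∧ ∀ j, j ∈ ω ↔ j ∈ J := by
  induction hc : J.card generalizing J with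
  | zero =>
    rw [Finset.card_eq_zero] at hc
    exact ⟨[], ⟨by simp, by simp⟩, by simp [hc]⟩
  | succ c ih =>
    obtain ⟨j, hj, hj'⟩ := exists_add_one_notMem (Finset.card_pos.1 (by omega)) hJ
    obtain ⟨ω, hω, hωJ⟩ := ih (J := J.erase j) (by
      intro h
      have := Finset.mem_univ j
      rw [← h] at this
      simp at this) (by rw [Finset.card_erase_of_mem hj, hc]; rfl)
    refine ⟨[j] ++ ω, (isCycDecWord_singleton j).append hω (by simp [hωJ])
      (by simp [hωJ, hj']), fun i => ?_⟩
    by_cases hi : i = j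
    · simp [hi, hj]
    · simp [hωJ, hi]

theorem exists_isCycIncWord {J : Finset (ZMod n)} (hJ : J ≠ Finset.univ) :
    ∃ ω, IsCycIncWord n ω ∧ ∀ j, j ∈ ω ↔ j ∈ J := by
  obtain ⟨ω, h1, h2⟩ := exists_isCycDecWord hJ
  exact ⟨ω.reverse, by rwa [isCycIncWord_iff_reverse, List.reverse_reverse], by simpa using h2⟩

end Sets

theorem cycDec_eq {J : Finset (ZMod n)} {ω : List (ZMod n)} (h : IsCycDecWord n ω)
    (hJ : ∀ j, j ∈ ω ↔ j ∈ J) : cycDec n J = (cs n).wordProd ω := by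
  obtain ⟨ω', h', hJ', e⟩ := Classical.epsilon_spec (p := fun w => ∃ ω, IsCycDecWord n ω ∧
    (∀ j, j ∈ ω ↔ j ∈ J) ∧ (cs n).wordProd ω = w) ⟨_, ω, h, hJ, rfl⟩
  exact e.symm.trans (prod_map_eq_of_isCycDecWord (fun i j => simple_commute) h' h
    fun j => (hJ' j).trans (hJ j).symm)

theorem cycInc_eq {J : Finset (ZMod n)} {ω : List (ZMod n)} (h : IsCycIncWord n ω)
    (hJ : ∀ j, j ∈ ω ↔ j ∈ J) : cycInc n J = (cs n).wordProd ω := by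
  obtain ⟨ω', h', hJ', e⟩ := Classical.epsilon_spec (p := fun w => ∃ ω, IsCycIncWord n ω ∧
    (∀ j, j ∈ ω ↔ j ∈ J) ∧ (cs n).wordProd ω = w) ⟨_, ω, h, hJ, rfl⟩
  exact e.symm.trans (prod_map_eq_of_isCycIncWord (fun i j => simple_commute) h' h
    fun j => (hJ' j).trans (hJ j).symm)

/-- Only the generator with residue x moves an integer across the cut between x and x + 1, so both
half-lines are preserved. -/
theorem perm_wordProd_of_notMem {ω : List (ZMod n)} {x : ℤ} (hx : (x : ZMod n) ∉ ω) :
    (∀ y ≤ x, perm ((cs n).wordProd ω) y ≤ x) ∧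
      ∀ y, x + 1 ≤ y → x + 1 ≤ perm ((cs n).wordProd ω) y := by
  induction ω with
  | nil => simp
  | cons a ω ih =>
    rw [List.mem_cons, not_or] at hx
    obtain ⟨ih1, ih2⟩ := ih hx.2
    rw [(cs n).wordProd_cons, map_mul, perm_simple]
    have h1 : ∀ y ≤ x, affSwap a y ≤ x := by
      intro y hy
      rw [affSwap_apply]
      split_ifs with h h'
      · have : y ≠ x := by rintro rfl; exact hx.1 h
        omega
      · omega
      · omega
    have h2 : ∀ y, x + 1 ≤ y → x + 1 ≤ affSwap a y := by
      intro y hy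
      rw [affSwap_apply]
      split_ifs with h h'
      · omega
      · have : y ≠ x + 1 := by
          rintro rfl; push_cast at h'; exact hx.1 (add_right_cancel h')
        omega
      · omega
    exact ⟨fun y hy => h1 _ (ih1 y hy), fun y hy => h2 _ (ih2 y hy)⟩

/-- The last letter x does not occur earlier, so the prefix preserves the cut between x and x + 1
and has no descent there. -/
theorem isReduced_of_nodup {ω : List (ZMod n)} (h : ω.Nodup) : (cs n).IsReduced ω := by
  induction ω using List.reverseRecOn with
  | nil => simp [CoxeterSystem.IsReduced]
  | append_singleton ω i ih =>
    rw [List.nodup_append] at h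
    refine isReduced_concat (ih h.1) ?_
    obtain ⟨x, rfl⟩ := ZMod.intCast_surjective i
    have hx : (x : ZMod n) ∉ ω := fun hx => h.2.2 _ hx _ (by simp) rfl
    rw [isRightDescent_iff_perm]
    have := perm_wordProd_of_notMem hx
    have h1 := this.1 x le_rfl
    have h2 := this.2 (x + 1) le_rfl
    omega

/-! ### Products and permutations of the elements d_J and u_J -/

section Elements

variable [NeZero n]

theorem elt_cycDec_eq {J : Finset (ZMod n)} {ω : List (ZMod n)} (h : IsCycDecWord n ω)
    (hJ : ∀ j, j ∈ ω ↔ j ∈ J) : elt n (cycDec n J) = genProd ω := by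
  rw [cycDec_eq h hJ, elt_wordProd (isReduced_of_nodup h.1)]

theorem elt_cycInc_eq {J : Finset (ZMod n)} {ω : List (ZMod n)} (h : IsCycIncWord n ω)
    (hJ : ∀ j, j ∈ ω ↔ j ∈ J) : elt n (cycInc n J) = genProd ω := by
  rw [cycInc_eq h hJ, elt_wordProd (isReduced_of_nodup h.1)]

theorem cycInc_eq_inv {J : Finset (ZMod n)} (hJ : J ≠ Finset.univ) :
    cycInc n J = (cycDec n J)⁻¹ := by
  obtain ⟨ω, h1, h2⟩ := exists_isCycDecWord hJ
  rw [cycDec_eq h1 h2, ← (cs n).wordProd_reverse, cycInc_eq]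
  · rwa [isCycIncWord_iff_reverse, List.reverse_reverse]
  · simpa using h2

theorem length_cycDec {J : Finset (ZMod n)} (hJ : J ≠ Finset.univ) :
    (cs n).length (cycDec n J) = J.card := by
  obtain ⟨ω, h1, h2⟩ := exists_isCycDecWord hJ
  rw [cycDec_eq h1 h2, (isReduced_of_nodup h1.1).eq, ← List.toFinset_card_of_nodup h1.1]
  congr 1
  ext j
  simp [h2]

theorem length_cycInc {J : Finset (ZMod n)} (hJ : J ≠ Finset.univ) :
    (cs n).length (cycInc n J) = J.card := by
  rw [cycInc_eq_inv hJ, (cs n).length_inv, length_cycDec hJ]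

@[simp] theorem cycDec_empty : cycDec n ∅ = 1 :=
  cycDec_eq (ω := []) ⟨by simp, by simp⟩ (by simp)

@[simp] theorem cycInc_empty : cycInc n ∅ = 1 :=
  cycInc_eq (ω := []) ⟨by simp, by simp⟩ (by simp)

@[simp] theorem cycDec_singleton (i : ZMod n) : cycDec n {i} = (cs n).simple i := by
  rw [cycDec_eq (isCycDecWord_singleton i) (by simp), (cs n).wordProd_singleton]

@[simp] theorem cycInc_singleton (i : ZMod n) : cycInc n {i} = (cs n).simple i := by
  rw [cycInc_eq (ω := [i]) ((isCycIncWord_iff_reverse _).2 (isCycDecWord_singleton i)) (by simp),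
    (cs n).wordProd_singleton]

variable {J₁ J₂ : Finset (ZMod n)}

theorem exists_isCycDecWord_union (hJ₁ : J₁ ≠ Finset.univ) (hJ₂ : J₂ ≠ Finset.univ)
    (hd : Disjoint J₁ J₂) (hn : ∀ j ∈ J₁, j + 1 ∉ J₂) :
    ∃ ω₁ ω₂, IsCycDecWord n ω₁ ∧ IsCycDecWord n ω₂ ∧ IsCycDecWord n (ω₁ ++ ω₂) ∧
      (∀ j, j ∈ ω₁ ↔ j ∈ J₁) ∧ (∀ j, j ∈ ω₂ ↔ j ∈ J₂) ∧
      ∀ j, j ∈ ω₁ ++ ω₂ ↔ j ∈ J₁ ∪ J₂ := by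
  obtain ⟨ω₁, h1, h2⟩ := exists_isCycDecWord hJ₁
  obtain ⟨ω₂, h3, h4⟩ := exists_isCycDecWord hJ₂
  refine ⟨ω₁, ω₂, h1, h3, h1.append h3 (fun j hj hj' => ?_) (fun j hj => ?_), h2, h4, ?_⟩
  · exact Finset.disjoint_left.1 hd ((h2 j).1 hj) ((h4 j).1 hj')
  · rw [h4]; exact hn j ((h2 j).1 hj)
  · simp [h2, h4]

theorem cycDec_union (hJ₁ : J₁ ≠ Finset.univ) (hJ₂ : J₂ ≠ Finset.univ)
    (hd : Disjoint J₁ J₂) (hn : ∀ j ∈ J₁, j + 1 ∉ J₂) :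
    cycDec n (J₁ ∪ J₂) = cycDec n J₁ * cycDec n J₂ := by
  obtain ⟨ω₁, ω₂, h1, h2, h3, h4, h5, h6⟩ := exists_isCycDecWord_union hJ₁ hJ₂ hd hn
  rw [cycDec_eq h1 h4, cycDec_eq h2 h5, cycDec_eq h3 h6, (cs n).wordProd_append]

theorem elt_cycDec_union (hJ₁ : J₁ ≠ Finset.univ) (hJ₂ : J₂ ≠ Finset.univ)
    (hd : Disjoint J₁ J₂) (hn : ∀ j ∈ J₁, j + 1 ∉ J₂) :
    elt n (cycDec n (J₁ ∪ J₂)) = elt n (cycDec n J₁) * elt n (cycDec n J₂) := by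
  obtain ⟨ω₁, ω₂, h1, h2, h3, h4, h5, h6⟩ := exists_isCycDecWord_union hJ₁ hJ₂ hd hn
  rw [elt_cycDec_eq h1 h4, elt_cycDec_eq h2 h5, elt_cycDec_eq h3 h6, genProd_append]

theorem exists_isCycIncWord_union (hJ₁ : J₁ ≠ Finset.univ) (hJ₂ : J₂ ≠ Finset.univ)
    (hd : Disjoint J₁ J₂) (hn : ∀ j ∈ J₂, j + 1 ∉ J₁) :
    ∃ ω₁ ω₂, IsCycIncWord n ω₁ ∧ IsCycIncWord n ω₂ ∧ IsCycIncWord n (ω₁ ++ ω₂) ∧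
      (∀ j, j ∈ ω₁ ↔ j ∈ J₁) ∧ (∀ j, j ∈ ω₂ ↔ j ∈ J₂) ∧
      ∀ j, j ∈ ω₁ ++ ω₂ ↔ j ∈ J₁ ∪ J₂ := by
  obtain ⟨ω₂, ω₁, h1, h2, h3, h4, h5, h6⟩ := exists_isCycDecWord_union hJ₂ hJ₁ hd.symm hn
  refine ⟨ω₁.reverse, ω₂.reverse, ?_, ?_, ?_, ?_, ?_, ?_⟩
  · rwa [isCycIncWord_iff_reverse, List.reverse_reverse]
  · rwa [isCycIncWord_iff_reverse, List.reverse_reverse]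
  · rwa [isCycIncWord_iff_reverse, List.reverse_append, List.reverse_reverse, List.reverse_reverse]
  · simpa using h5
  · simpa using h4
  · simp [h4, h5]

theorem cycInc_union (hJ₁ : J₁ ≠ Finset.univ) (hJ₂ : J₂ ≠ Finset.univ)
    (hd : Disjoint J₁ J₂) (hn : ∀ j ∈ J₂, j + 1 ∉ J₁) :
    cycInc n (J₁ ∪ J₂) = cycInc n J₁ * cycInc n J₂ := by
  obtain ⟨ω₁, ω₂, h1, h2, h3, h4, h5, h6⟩ := exists_isCycIncWord_union hJ₁ hJ₂ hd hn
  rw [cycInc_eq h1 h4, cycInc_eq h2 h5, cycInc_eq h3 h6, (cs n).wordProd_append]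

theorem elt_cycInc_union (hJ₁ : J₁ ≠ Finset.univ) (hJ₂ : J₂ ≠ Finset.univ)
    (hd : Disjoint J₁ J₂) (hn : ∀ j ∈ J₂, j + 1 ∉ J₁) :
    elt n (cycInc n (J₁ ∪ J₂)) = elt n (cycInc n J₁) * elt n (cycInc n J₂) := by
  obtain ⟨ω₁, ω₂, h1, h2, h3, h4, h5, h6⟩ := exists_isCycIncWord_union hJ₁ hJ₂ hd hn
  rw [elt_cycInc_eq h1 h4, elt_cycInc_eq h2 h5, elt_cycInc_eq h3 h6, genProd_append]

theorem singleton_ne_univ (i : ZMod n) : ({i} : Finset (ZMod n)) ≠ Finset.univ := by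
  intro h
  have := Finset.mem_univ (i + 1)
  rw [← h] at this
  simp at this

theorem elt_cycDec_insert_left {J : Finset (ZMod n)} {i : ZMod n} (hJ : J ≠ Finset.univ)
    (hi : i ∉ J) (hi' : i + 1 ∉ J) :
    elt n (cycDec n (insert i J)) = gen n i * elt n (cycDec n J) := by
  rw [Finset.insert_eq, elt_cycDec_union (singleton_ne_univ i) hJ (by simpa using hi)
    (by simpa using hi'), cycDec_singleton, elt_simple]

theorem elt_cycDec_insert_right {J : Finset (ZMod n)} {i : ZMod n} (hJ : J ≠ Finset.univ)
    (hi : i ∉ J) (hi' : i - 1 ∉ J) :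
    elt n (cycDec n (insert i J)) = elt n (cycDec n J) * gen n i := by
  rw [Finset.insert_eq, Finset.union_comm, elt_cycDec_union hJ (singleton_ne_univ i)
    (by simpa using hi), cycDec_singleton, elt_simple]
  rintro j hj h
  rw [Finset.mem_singleton] at h
  exact hi' (by rwa [← h, add_sub_cancel_right])

theorem elt_cycInc_insert_left {J : Finset (ZMod n)} {i : ZMod n} (hJ : J ≠ Finset.univ)
    (hi : i ∉ J) (hi' : i - 1 ∉ J) :
    elt n (cycInc n (insert i J)) = gen n i * elt n (cycInc n J) := by
  rw [Finset.insert_eq, elt_cycInc_union (singleton_ne_univ i) hJ (by simpa using hi),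
    cycInc_singleton, elt_simple]
  rintro j hj h
  rw [Finset.mem_singleton] at h
  exact hi' (by rwa [← h, add_sub_cancel_right])

theorem elt_cycInc_insert_right {J : Finset (ZMod n)} {i : ZMod n} (hJ : J ≠ Finset.univ)
    (hi : i ∉ J) (hi' : i + 1 ∉ J) :
    elt n (cycInc n (insert i J)) = elt n (cycInc n J) * gen n i := by
  rw [Finset.insert_eq, Finset.union_comm, elt_cycInc_union hJ (singleton_ne_univ i)
    (by simpa using hi) (by simpa using hi'), cycInc_singleton, elt_simple]

theorem perm_wordProd_of_ne {ω : List (ZMod n)} {x : ℤ} (h : (x : ZMod n) ∉ ω)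
    (h' : (x : ZMod n) - 1 ∉ ω) : perm ((cs n).wordProd ω) x = x := by
  induction ω with
  | nil => simp
  | cons a ω ih =>
    rw [List.mem_cons, not_or] at h h'
    rw [(cs n).wordProd_cons, map_mul, perm_simple, Equiv.Perm.mul_apply, ih h.2 h'.2,
      affSwap_of_ne h.1]
    intro hx
    exact h'.1 (by rw [hx, add_sub_cancel_right])

/-- Letters act from the right. Neither x nor x - 1 acts before the letter x, and neither x nor x +
1 acts after it, so the integer x makes exactly one step. -/
theorem perm_wordProd_of_isCycIncWord {ω : List (ZMod n)} (hω : IsCycIncWord n ω) {x : ℤ}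
    (hx : (x : ZMod n) ∈ ω) : perm ((cs n).wordProd ω) x = x + 1 := by
  obtain ⟨α, β, rfl⟩ := List.append_of_mem hx
  have hnd := hω.1
  have hnd' := List.nodup_cons.1 (List.perm_middle.nodup_iff.1 hnd)
  rw [(cs n).wordProd_append, (cs n).wordProd_cons, map_mul, map_mul, perm_simple,
    Equiv.Perm.mul_apply, Equiv.Perm.mul_apply, perm_wordProd_of_ne (ω := β), affSwap_self,
    perm_wordProd_of_ne]
  · push_cast
    intro h
    have := hω.2 _ hx (by simp [h])
    rw [pair_sublist_iff hnd] at this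
    exact (List.nodup_append.1 hnd'.2).2.2 _ h _ this rfl
  · push_cast
    rw [add_sub_cancel_right]
    exact fun h => hnd'.1 (by simp [h])
  · exact fun h => hnd'.1 (by simp [h])
  · intro h
    have hm : (x : ZMod n) - 1 ∈ α ++ (x : ZMod n) :: β := by simp [h]
    have := hω.2 _ hm (by simp)
    rw [sub_add_cancel] at this
    obtain ⟨β₁, β₂, rfl⟩ := List.append_of_mem h
    have e : α ++ (x : ZMod n) :: (β₁ ++ ((x : ZMod n) - 1) :: β₂) =
      (α ++ (x : ZMod n) :: β₁) ++ ((x : ZMod n) - 1) :: β₂ := by simp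
    rw [e] at this hnd
    rw [pair_sublist_iff hnd] at this
    exact hnd'.1 (by simp [this])

theorem perm_cycInc {J : Finset (ZMod n)} (hJ : J ≠ Finset.univ) {x : ℤ}
    (hx : (x : ZMod n) ∈ J) : perm (cycInc n J) x = x + 1 := by
  obtain ⟨ω, h1, h2⟩ := exists_isCycIncWord hJ
  rw [cycInc_eq h1 h2]
  exact perm_wordProd_of_isCycIncWord h1 ((h2 _).2 hx)

theorem perm_cycDec {J : Finset (ZMod n)} (hJ : J ≠ Finset.univ) {x : ℤ}
    (hx : (x : ZMod n) ∈ J) : perm (cycDec n J) (x + 1) = x := by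
  have := perm_cycInc hJ hx
  rw [cycInc_eq_inv hJ, map_inv, Equiv.Perm.inv_eq_iff_eq] at this
  exact this.symm

end Elements

end AffNil
end

noncomputable section
namespace AffNil
attribute [-simp] CoxeterMatrix.toCoxeterSystem_simple
set_option linter.unusedSectionVars false
variable {n : ℕ} [Fact (1 < n)]

/-! ### Commutation of `𝐞_a` with `𝐡_b` -/

theorem natCast_ne_of_lt {a b : ℕ} (h : a < b) (h' : b < a + n) : (a : ZMod n) ≠ b := by
  intro e
  rw [ZMod.natCast_eq_natCast_iff, Nat.modEq_iff_dvd' h.le] at e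
  have := Nat.le_of_dvd (by omega) e
  omega

/-- The translation `J + 1` of a set of residues. -/
def shift (J : Finset (ZMod n)) : Finset (ZMod n) := J.map (Equiv.addRight (1 : ZMod n)).toEmbedding

theorem mem_shift {J : Finset (ZMod n)} {j : ZMod n} : j ∈ shift J ↔ j - 1 ∈ J := by
  unfold shift
  rw [Finset.mem_map_equiv]
  simp [sub_eq_add_neg]

theorem card_shift (J : Finset (ZMod n)) : (shift J).card = J.card := Finset.card_map _

theorem IsCycDecWord.map_add_one {ω : List (ZMod n)} (h : IsCycDecWord n ω) :
    IsCycDecWord n (ω.map (· + 1)) := by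
  refine ⟨h.1.map fun a b hab => add_right_cancel hab, fun i hi hi' => ?_⟩
  simp only [List.mem_map] at hi hi'
  obtain ⟨j, hj, rfl⟩ := hi
  obtain ⟨k, hk, hkj⟩ := hi'
  obtain rfl := add_right_cancel hkj
  have := (h.2 j hj hk).map (· + 1)
  simpa using this

theorem affSwap_add_one (i : ZMod n) :
    affSwap (i + 1) = Equiv.addRight (1 : ℤ) * affSwap i * (Equiv.addRight (1 : ℤ))⁻¹ := by
  rw [eq_mul_inv_iff_mul_eq]
  ext x
  simp only [Equiv.Perm.mul_apply, Equiv.coe_addRight, affSwap_apply]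
  push_cast
  simp only [add_left_inj]
  split_ifs <;> ring

theorem perm_wordProd_map_add_one (ω : List (ZMod n)) :
    perm ((cs n).wordProd (ω.map (· + 1))) =
      Equiv.addRight (1 : ℤ) * perm ((cs n).wordProd ω) * (Equiv.addRight (1 : ℤ))⁻¹ := by
  induction ω with
  | nil => rw [List.map_nil, (cs n).wordProd_nil, map_one, mul_one, mul_inv_cancel]
  | cons i ω ih =>
    rw [List.map_cons, (cs n).wordProd_cons, (cs n).wordProd_cons, map_mul, map_mul, ih,
      perm_simple, perm_simple, affSwap_add_one]
    group

/-! ### Pairs of sets that cover all residues -/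

section Full

variable [NeZero n]

theorem shift_ne_univ {J : Finset (ZMod n)} (hJ : J ≠ Finset.univ) : shift J ≠ Finset.univ := by
  intro h
  refine hJ (Finset.eq_univ_of_forall fun j => ?_)
  have := Finset.mem_univ (j + 1)
  rw [← h, mem_shift, add_sub_cancel_right] at this
  exact this

theorem perm_cycDec_shift {J : Finset (ZMod n)} (hJ : J ≠ Finset.univ) :
    perm (cycDec n (shift J)) =
      Equiv.addRight (1 : ℤ) * perm (cycDec n J) * (Equiv.addRight (1 : ℤ))⁻¹ := by
  obtain ⟨ω, h1, h2⟩ := exists_isCycDecWord hJ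
  rw [cycDec_eq h1 h2, ← perm_wordProd_map_add_one, cycDec_eq h1.map_add_one]
  intro j
  rw [mem_shift, ← h2]
  simp only [List.mem_map]
  exact ⟨fun ⟨a, ha, e⟩ => by rwa [← e, add_sub_cancel_right], fun h => ⟨_, h, by ring⟩⟩

/-- Let T be the translation by one. Since d_I takes x + 1 to x for x ∈ I, the permutation d_I T
fixes all x with residue in I, and d_J T those with residue in J. As I and J cover everything, the
two have disjoint supports and commute; solving for d_I⁻¹ d_J gives the conjugates by T on the
right-hand side. -/
theorem cycInc_mul_cycDec_of_union {I J : Finset (ZMod n)} (hI : I ≠ Finset.univ)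
    (hJ : J ≠ Finset.univ) (h : I ∪ J = Finset.univ) :
    cycInc n I * cycDec n J = cycDec n (shift J) * cycInc n (shift I) := by
  apply perm_injective
  rw [cycInc_eq_inv hI, cycInc_eq_inv (shift_ne_univ hI), map_mul, map_mul, map_inv, map_inv,
    perm_cycDec_shift hI, perm_cycDec_shift hJ]
  set T : Equiv.Perm ℤ := Equiv.addRight (1 : ℤ)
  have key : Equiv.Perm.Disjoint (perm (cycDec n I) * T) (perm (cycDec n J) * T) := by
    intro x
    have hx : (x : ZMod n) ∈ I ∪ J := by rw [h]; exact Finset.mem_univ _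
    rw [Finset.mem_union] at hx
    exact hx.imp (fun hx => perm_cycDec hI hx) (fun hx => perm_cycDec hJ hx)
  have hc := key.commute.eq
  rw [mul_assoc, mul_assoc] at hc
  rw [inv_mul_eq_iff_eq_mul]
  have h2 : perm (cycDec n J) = (perm (cycDec n I) * (T * (perm (cycDec n J) * T))) *
      T⁻¹ * (perm (cycDec n I))⁻¹ * T⁻¹ := by rw [hc]; group
  conv_lhs => rw [h2]
  group

/-- The two products have the same underlying element and the same total length of factors, so they
vanish together or agree. -/
theorem elt_cycInc_mul_elt_cycDec_of_union {I J : Finset (ZMod n)} (hI : I ≠ Finset.univ)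
    (hJ : J ≠ Finset.univ) (h : I ∪ J = Finset.univ) :
    elt n (cycInc n I) * elt n (cycDec n J) =
      elt n (cycDec n (shift J)) * elt n (cycInc n (shift I)) := by
  rw [elt_mul_elt, elt_mul_elt, length_cycInc hI, length_cycDec hJ,
    length_cycDec (shift_ne_univ hJ), length_cycInc (shift_ne_univ hI), card_shift, card_shift,
    cycInc_mul_cycDec_of_union hI hJ h, add_comm J.card]

end Full

/-! ### Generating functions over the subsets of a proper set of letters -/

section Finite

variable {B : Type*} [Ring B] (ι : NilAlg n →+* B)

/-- The two inner factors multiply to 1 + (x + y)c on the left and to 1 + (x + y)a on the right.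
After that the expansions differ only in xy(x + y)aca against xy(x + y)cac. -/
theorem yang_baxter {x y a c : B} (hx : ∀ b, b * x = x * b) (hy : ∀ b, b * y = y * b)
    (ha : a * a = 0) (hc : c * c = 0) (h : a * c * a = c * a * c) :
    (1 + x * a) * ((1 + y * c) * (1 + x * c)) * (1 + y * a) =
      (1 + y * c) * ((1 + y * a) * (1 + x * a)) * (1 + x * c) := by
  have l1 : ∀ b, a * (x * b) = x * (a * b) := fun b => by rw [← mul_assoc, hx, mul_assoc]
  have l2 : ∀ b, c * (x * b) = x * (c * b) := fun b => by rw [← mul_assoc, hx, mul_assoc]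
  have l3 : ∀ b, a * (y * b) = y * (a * b) := fun b => by rw [← mul_assoc, hy, mul_assoc]
  have l4 : ∀ b, c * (y * b) = y * (c * b) := fun b => by rw [← mul_assoc, hy, mul_assoc]
  have l5 : ∀ b, y * (x * b) = x * (y * b) := fun b => by rw [← mul_assoc, hx, mul_assoc]
  have l8 : c * (a * c) = a * (c * a) := by rw [← mul_assoc, ← h, mul_assoc]
  simp only [mul_add, add_mul, mul_one, one_mul, mul_assoc, l1, l2, l3, l4, l5, l8,
    ha, hc, mul_zero, add_zero]
  abel

/-- The letters `p + a`, for `a` in a list of natural numbers. -/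
def letters (p : ZMod n) (l : List ℕ) : Finset (ZMod n) := (l.map fun a : ℕ => p + a).toFinset

/-- The product of the factors `1 + x A_{p + a}`, from left to right. -/
def incProd (p : ZMod n) (x : B) (l : List ℕ) : B :=
  (l.map fun a : ℕ => 1 + x * ι (gen n (p + a))).prod

/-- The product of the factors `1 + x A_{p + a}`, from right to left. -/
def decProd (p : ZMod n) (x : B) (l : List ℕ) : B :=
  (l.reverse.map fun a : ℕ => 1 + x * ι (gen n (p + a))).prod

theorem incProd_cons (p : ZMod n) (x : B) (a : ℕ) (l : List ℕ) :
    incProd ι p x (a :: l) = (1 + x * ι (gen n (p + a))) * incProd ι p x l := by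
  simp [incProd]

theorem decProd_cons (p : ZMod n) (x : B) (a : ℕ) (l : List ℕ) :
    decProd ι p x (a :: l) = decProd ι p x l * (1 + x * ι (gen n (p + a))) := by
  simp [decProd]

/-- The product telescopes from the middle, as (1 - xA_i)(1 + xA_i) = 1. This is the generating form
of the relation between the 𝐞_i and the 𝐡_i. -/
theorem incProd_neg_mul_decProd (p : ZMod n) {x : B} (hx : ∀ b, b * x = x * b) (l : List ℕ) :
    incProd ι p (-x) l * decProd ι p x l = 1 := by
  have hsq : ∀ i, (1 + -x * ι (gen n i)) * (1 + x * ι (gen n i)) = 1 := by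
    intro i
    have h2 : x * ι (gen n i) * (x * ι (gen n i)) = 0 := by
      rw [mul_assoc, ← mul_assoc (ι _), hx, mul_assoc x, ← map_mul, gen_sq, map_zero, mul_zero,
        mul_zero]
    rw [add_mul, one_mul, neg_mul, neg_mul, mul_add, mul_one, h2]
    abel
  induction l with
  | nil => simp [incProd, decProd]
  | cons a l ih =>
    rw [incProd_cons, decProd_cons, mul_assoc, ← mul_assoc (incProd _ _ _ _), ih, one_mul, hsq]

theorem commute_incProd (p : ZMod n) {x b : B} (l : List ℕ) (hx : ∀ b, b * x = x * b)
    (h : ∀ a ∈ l, b * ι (gen n (p + a)) = ι (gen n (p + a)) * b) :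
    b * incProd ι p x l = incProd ι p x l * b := by
  induction l with
  | nil => simp [incProd]
  | cons a l ih =>
    have h1 : b * (1 + x * ι (gen n (p + a))) = (1 + x * ι (gen n (p + a))) * b := by
      rw [mul_add, add_mul, mul_one, one_mul, ← mul_assoc, hx, mul_assoc, h a (by simp), mul_assoc]
    rw [incProd_cons, ← mul_assoc, h1, mul_assoc, ih fun a ha => h a (by simp [ha]), mul_assoc]

theorem commute_decProd (p : ZMod n) {x b : B} (l : List ℕ) (hx : ∀ b, b * x = x * b)
    (h : ∀ a ∈ l, b * ι (gen n (p + a)) = ι (gen n (p + a)) * b) :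
    b * decProd ι p x l = decProd ι p x l * b := by
  have := commute_incProd ι p (x := x) (b := b) l.reverse hx (by simpa using h)
  exact this

theorem gen_add_comm {p : ZMod n} {a b : ℕ} (ha : 1 ≤ a) (hab : a + 1 < b) (hb : b < n) :
    gen n (p + a) * gen n (p + b) = gen n (p + b) * gen n (p + a) := by
  refine gen_comm ?_ ?_
  · rw [add_assoc]
    intro h
    have := natCast_ne_of_lt (n := n) (a := a) (b := b + 1) (by omega) (by omega)
    exact this (by push_cast; exact add_left_cancel h)
  · rw [add_assoc]
    intro h
    have := natCast_ne_of_lt (n := n) (a := a + 1) (b := b) (by omega) (by omega)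
    exact this (by push_cast; exact (add_left_cancel h).symm)

/-- Induction on the list through its two smallest entries a < c. Once the part without a is
interchanged, the factors of a commute with everything beyond c, and what remains is to move them
past those of c: by `yang_baxter` if c = a + 1, by plain commutation otherwise. The letter p is
absent, so nothing wraps around the circle. -/
theorem incProd_mul_decProd_comm (p : ZMod n) {x y : B} (hx : ∀ b, b * x = x * b)
    (hy : ∀ b, b * y = y * b) (l : List ℕ) (hl : l.Pairwise (· < ·))
    (hl' : ∀ a ∈ l, 1 ≤ a ∧ a < n) :
    incProd ι p x l * decProd ι p y l = decProd ι p y l * incProd ι p x l := by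
  have hsq : ∀ i, ι (gen n i) * ι (gen n i) = 0 := fun i => by rw [← map_mul, gen_sq, map_zero]
  have h1 : ∀ i, (1 + x * ι (gen n i)) * (1 + y * ι (gen n i)) =
      (1 + y * ι (gen n i)) * (1 + x * ι (gen n i)) := by
    intro i
    have e1 : x * ι (gen n i) * (y * ι (gen n i)) = 0 := by
      rw [mul_assoc, ← mul_assoc (ι _), hy, mul_assoc y, hsq, mul_zero, mul_zero]
    have e2 : y * ι (gen n i) * (x * ι (gen n i)) = 0 := by
      rw [mul_assoc, ← mul_assoc (ι _), hx, mul_assoc x, hsq, mul_zero, mul_zero]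
    rw [add_mul, mul_add, mul_add, one_mul, mul_one, one_mul, add_mul, mul_add, mul_add, e1, e2,
      one_mul, mul_one, one_mul]
    abel
  induction l with
  | nil => simp [incProd, decProd]
  | cons a l ih =>
    have ih' := ih hl.of_cons fun b hb => hl' b (by simp [hb])
    rw [incProd_cons, decProd_cons]
    rw [mul_assoc, ← mul_assoc (incProd _ _ _ _), ih']
    match l, hl, hl' with
    | [], _, _ => simp [incProd, decProd, h1]
    | c :: l, hl, hl' =>
      rw [incProd_cons, decProd_cons]
      rw [List.pairwise_cons] at hl
      have hac : a < c := hl.1 c (by simp)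
      have ha := hl' a (by simp)
      have hc := hl' c (by simp)
      have hcomm : ∀ b ∈ l, ι (gen n (p + a)) * ι (gen n (p + b)) =
          ι (gen n (p + b)) * ι (gen n (p + a)) := by
        intro b hb
        have := (List.pairwise_cons.1 hl.2).1 b hb
        rw [← map_mul, ← map_mul, gen_add_comm ha.1 (by omega) (hl' b (by simp [hb])).2]
      have hcomm' : ∀ z : B, (∀ b, b * z = z * b) → ∀ b ∈ l,
          (1 + z * ι (gen n (p + a))) * ι (gen n (p + b)) =
          ι (gen n (p + b)) * (1 + z * ι (gen n (p + a))) := by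
        intro z hz b hb
        rw [add_mul, mul_add, mul_one, one_mul, mul_assoc, hcomm b hb, ← mul_assoc (ι _) z, hz,
          mul_assoc]
      have c1 := commute_decProd ι p (x := y) l hy (hcomm' x hx)
      have c2 := commute_incProd ι p (x := x) l hx (hcomm' y hy)
      have yb : (1 + x * ι (gen n (p + a))) * ((1 + y * ι (gen n (p + c))) *
          (1 + x * ι (gen n (p + c)))) * (1 + y * ι (gen n (p + a))) =
          (1 + y * ι (gen n (p + c))) * ((1 + y * ι (gen n (p + a))) *
          (1 + x * ι (gen n (p + a)))) * (1 + x * ι (gen n (p + c))) := by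
        by_cases h : a + 1 = c
        · refine yang_baxter hx hy (hsq _) (hsq _) ?_
          have hn : n ≠ 2 := by omega
          have := gen_braid hn (p + a)
          rw [← h]
          push_cast
          rw [← add_assoc, ← map_mul, ← map_mul, this, map_mul, map_mul]
        · have hg : ι (gen n (p + a)) * ι (gen n (p + c)) =
              ι (gen n (p + c)) * ι (gen n (p + a)) := by
            rw [← map_mul, ← map_mul, gen_add_comm ha.1 (by omega) hc.2]
          have hzz : ∀ z t : B, (∀ b, b * z = z * b) → (∀ b, b * t = t * b) →
              (1 + z * ι (gen n (p + a))) * (1 + t * ι (gen n (p + c))) =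
              (1 + t * ι (gen n (p + c))) * (1 + z * ι (gen n (p + a))) := by
            intro z t hz ht
            have : z * ι (gen n (p + a)) * (t * ι (gen n (p + c))) =
                t * ι (gen n (p + c)) * (z * ι (gen n (p + a))) := by
              rw [mul_assoc, ← mul_assoc (ι _), ht, mul_assoc t, hg, mul_assoc t,
                ← mul_assoc (ι (gen n (p + c))), hz, ← mul_assoc, ht, mul_assoc, mul_assoc]
            rw [add_mul, mul_add, mul_add, add_mul, mul_add, mul_add, this]
            simp only [one_mul, mul_one]
            abel
          rw [← mul_assoc, hzz x y hx hy, mul_assoc, mul_assoc, ← hzz y x hy hx,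
            ← mul_assoc (1 + x * ι (gen n (p + a))), h1]
          simp only [mul_assoc]
      have c1' : ∀ z, (1 + x * ι (gen n (p + a))) * (decProd ι p y l * z) =
          decProd ι p y l * ((1 + x * ι (gen n (p + a))) * z) := fun z => by
        rw [← mul_assoc, c1, mul_assoc]
      simp only [mul_assoc]
      rw [c1', ← c2]
      simp only [← mul_assoc] at yb ⊢
      simp only [mul_assoc] at yb ⊢
      have yb' : ∀ z, (1 + x * ι (gen n (p + a))) * ((1 + y * ι (gen n (p + c))) *
          ((1 + x * ι (gen n (p + c))) * ((1 + y * ι (gen n (p + a))) * z))) =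
          (1 + y * ι (gen n (p + c))) * ((1 + y * ι (gen n (p + a))) *
          ((1 + x * ι (gen n (p + a))) * ((1 + x * ι (gen n (p + c))) * z))) := by
        intro z
        have := congrArg (· * z) yb
        simpa only [mul_assoc] using this
      rw [yb']

theorem mem_letters {p j : ZMod n} {l : List ℕ} : j ∈ letters p l ↔ ∃ a ∈ l, p + (a : ZMod n) = j := by
  simp [letters]

section

variable [NeZero n]

theorem letters_ne {p : ZMod n} {l : List ℕ} (hl' : ∀ a ∈ l, 1 ≤ a ∧ a < n) :
    p ∉ letters p l := by
  rw [mem_letters]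
  rintro ⟨a, ha, h⟩
  have := natCast_ne_of_lt (n := n) (a := 0) (b := a) (by have := hl' a ha; omega)
    (by have := hl' a ha; omega)
  refine this ?_
  rw [Nat.cast_zero]
  exact (left_eq_add.1 h.symm).symm

theorem letters_cons (p : ZMod n) (a : ℕ) (l : List ℕ) :
    letters p (a :: l) = insert (p + (a : ZMod n)) (letters p l) := by
  simp [letters]

theorem letters_cons_notMem {p : ZMod n} {a : ℕ} {l : List ℕ}
    (hl : (a :: l).Pairwise (· < ·)) (hl' : ∀ b ∈ a :: l, 1 ≤ b ∧ b < n) :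
    p + (a : ZMod n) ∉ letters p l ∧ p + (a : ZMod n) - 1 ∉ letters p l := by
  rw [List.pairwise_cons] at hl
  have ha := hl' a (by simp)
  constructor
  · rw [mem_letters]
    rintro ⟨b, hb, h⟩
    have h1 := hl.1 b hb
    have h2 := hl' b (by simp [hb])
    exact natCast_ne_of_lt (n := n) h1 (by omega) (add_left_cancel h).symm
  · rw [mem_letters]
    rintro ⟨b, hb, h⟩
    have h1 := hl.1 b hb
    have h2 := hl' b (by simp [hb])
    refine natCast_ne_of_lt (n := n) (a := a) (b := b + 1) (by omega) (by omega) ?_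
    push_cast
    rw [eq_sub_iff_add_eq, add_assoc] at h
    exact (add_left_cancel h).symm

theorem ne_univ_of_subset_letters {p : ZMod n} {l : List ℕ} (hl' : ∀ a ∈ l, 1 ≤ a ∧ a < n)
    {J : Finset (ZMod n)} (hJ : J ⊆ letters p l) : J ≠ Finset.univ := by
  rintro rfl
  exact letters_ne hl' (hJ (Finset.mem_univ p))

/-- The smallest letter has no predecessor among the others, so it may stand leftmost in an
increasing word; each factor of the product decides whether its letter belongs to I. -/
theorem sum_elt_cycInc (p : ZMod n) {x : B} (hx : ∀ b, b * x = x * b) (l : List ℕ)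
    (hl : l.Pairwise (· < ·)) (hl' : ∀ a ∈ l, 1 ≤ a ∧ a < n) :
    ∑ I ∈ (letters p l).powerset, x ^ I.card * ι (elt n (cycInc n I)) = incProd ι p x l := by
  induction l with
  | nil => simp [letters, incProd]
  | cons a l ih =>
    have hl'' : ∀ b ∈ l, 1 ≤ b ∧ b < n := fun b hb => hl' b (by simp [hb])
    obtain ⟨n1, n2⟩ := letters_cons_notMem (p := p) hl hl'
    rw [letters_cons, Finset.sum_powerset_insert n1, incProd_cons, ← ih hl.of_cons hl'', add_mul,
      one_mul, Finset.mul_sum]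
    congr 1
    refine Finset.sum_congr rfl fun I hI => ?_
    rw [Finset.mem_powerset] at hI
    rw [Finset.card_insert_of_notMem (fun h => n1 (hI h)), elt_cycInc_insert_left
      (ne_univ_of_subset_letters hl'' hI) (fun h => n1 (hI h)) (fun h => n2 (hI h)), map_mul,
      pow_succ', mul_assoc, mul_assoc]
    congr 1
    rw [← mul_assoc, ← mul_assoc]
    congr 1
    exact (Commute.pow_right (hx _ : Commute (ι (gen n (p + a))) x) _).eq.symm

theorem sum_elt_cycDec (p : ZMod n) {x : B} (hx : ∀ b, b * x = x * b) (l : List ℕ)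
    (hl : l.Pairwise (· < ·)) (hl' : ∀ a ∈ l, 1 ≤ a ∧ a < n) :
    ∑ J ∈ (letters p l).powerset, x ^ J.card * ι (elt n (cycDec n J)) = decProd ι p x l := by
  induction l with
  | nil => simp [letters, decProd]
  | cons a l ih =>
    have hl'' : ∀ b ∈ l, 1 ≤ b ∧ b < n := fun b hb => hl' b (by simp [hb])
    obtain ⟨n1, n2⟩ := letters_cons_notMem (p := p) hl hl'
    rw [letters_cons, Finset.sum_powerset_insert n1, decProd_cons, ← ih hl.of_cons hl'', mul_add,
      mul_one, Finset.sum_mul]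
    congr 1
    refine Finset.sum_congr rfl fun I hI => ?_
    rw [Finset.mem_powerset] at hI
    rw [Finset.card_insert_of_notMem (fun h => n1 (hI h)), elt_cycDec_insert_right
      (ne_univ_of_subset_letters hl'' hI) (fun h => n1 (hI h)) (fun h => n2 (hI h)), map_mul,
      pow_succ, mul_assoc, mul_assoc]
    congr 1
    rw [← mul_assoc, ← hx, mul_assoc]

/-- A missing letter p cuts the circle open and orders the remaining letters linearly. -/
theorem exists_letters {K : Finset (ZMod n)} (hK : K ≠ Finset.univ) :
    ∃ (p : ZMod n) (l : List ℕ), l.Pairwise (· < ·) ∧ (∀ a ∈ l, 1 ≤ a ∧ a < n) ∧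
      letters p l = K := by
  obtain ⟨p, hp⟩ : ∃ p, p ∉ K := by
    by_contra h
    push Not at h
    exact hK (Finset.eq_univ_of_forall h)
  classical
  refine ⟨p, (List.range n).filter fun a => p + (a : ZMod n) ∈ K,
    List.pairwise_lt_range.filter _, fun a ha => ?_, ?_⟩
  · simp only [List.mem_filter, List.mem_range, decide_eq_true_eq] at ha
    refine ⟨Nat.one_le_iff_ne_zero.2 ?_, ha.1⟩
    rintro rfl
    exact hp (by simpa using ha.2)
  · ext j
    rw [mem_letters]
    simp only [List.mem_filter, List.mem_range, decide_eq_true_eq]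
    refine ⟨fun ⟨a, ha, h⟩ => h ▸ ha.2, fun hj => ⟨(j - p).val, ⟨ZMod.val_lt _, ?_⟩, ?_⟩⟩
    · rwa [ZMod.natCast_zmod_val, add_sub_cancel]
    · rw [ZMod.natCast_zmod_val, add_sub_cancel]

end

end Finite

end AffNil
end

/-! ### From proper subsets to all pairs, and relations between 𝐞 and 𝐡 -/

noncomputable section
namespace AffNil
attribute [-simp] CoxeterMatrix.toCoxeterSystem_simple
set_option linter.unusedSectionVars false
variable {n : ℕ} [Fact (1 < n)] [NeZero n]

/-- Inclusion-exclusion over the union of a pair of sets. -/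
theorem sum_powerset_pairs_eq_zero {G : Type*} [AddCommGroup G]
    (f : Finset (ZMod n) → Finset (ZMod n) → G)
    (h : ∀ K : Finset (ZMod n), K ≠ Finset.univ →
      ∑ I ∈ K.powerset, ∑ J ∈ K.powerset, f I J = 0)
    (huniv : ∑ p : Finset (ZMod n) × Finset (ZMod n) with p.1 ∪ p.2 = Finset.univ, f p.1 p.2 = 0) :
    ∑ I, ∑ J, f I J = 0 := by
  classical
  have split : ∀ K : Finset (ZMod n), ∑ I ∈ K.powerset, ∑ J ∈ K.powerset, f I J =
      ∑ L ∈ K.powerset, ∑ p : Finset (ZMod n) × Finset (ZMod n) with p.1 ∪ p.2 = L,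
        f p.1 p.2 := by
    intro K
    rw [← Finset.sum_product', ← Finset.sum_fiberwise_of_maps_to (t := K.powerset)
      (g := fun p => p.1 ∪ p.2)]
    · refine Finset.sum_congr rfl fun L hL => Finset.sum_congr ?_ fun _ _ => rfl
      ext p
      simp only [Finset.mem_filter, Finset.mem_product, Finset.mem_powerset, Finset.mem_univ,
        true_and, and_iff_right_iff_imp] at hL ⊢
      rintro rfl
      exact ⟨Finset.subset_union_left.trans hL, Finset.subset_union_right.trans hL⟩
    · intro p hp
      simp only [Finset.mem_product, Finset.mem_powerset] at hp ⊢
      exact Finset.union_subset hp.1 hp.2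
  -- Strong induction on K: the sum over pairs inside K splits according to their union, and the
  -- smaller unions contribute zero.
  have hK : ∀ K : Finset (ZMod n), ∑ p : Finset (ZMod n) × Finset (ZMod n) with p.1 ∪ p.2 = K,
      f p.1 p.2 = 0 := by
    intro K
    induction K using Finset.strongInduction with
    | H K ih =>
    by_cases hu : K = Finset.univ
    · rw [hu, huniv]
    have := split K
    rw [h K hu, ← Finset.insert_erase (Finset.mem_powerset_self K),
      Finset.sum_insert (Finset.notMem_erase _ _), Finset.sum_eq_zero (s := Finset.erase _ _),
      add_zero] at this
    · exact this.symm
    · intro L hL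
      rw [Finset.mem_erase, Finset.mem_powerset] at hL
      exact ih L (hL.2.ssubset_of_ne hL.1)
  have := split Finset.univ
  rw [Finset.sum_eq_zero fun L _ => hK L] at this
  simpa using this

theorem sum_powersetCard_eq {G : Type*} [AddCommMonoid G] (a : ℕ) (K : Finset (ZMod n))
    (f : Finset (ZMod n) → G) :
    ∑ I ∈ K.powersetCard a, f I = ∑ I ∈ K.powerset, if I.card = a then f I else 0 := by
  rw [← Finset.sum_filter]
  congr 1
  ext I
  simp [Finset.mem_powersetCard]

theorem sum_powersetCard_univ_eq {G : Type*} [AddCommMonoid G] (a : ℕ)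
    (f : Finset (ZMod n) → G) :
    ∑ I ∈ (Finset.univ : Finset (ZMod n)).powersetCard a, f I =
      ∑ I, if I.card = a then f I else 0 := by
  rw [sum_powersetCard_eq, Finset.powerset_univ]

theorem ne_univ_of_card_lt {J : Finset (ZMod n)} (h : J.card < n) : J ≠ Finset.univ := by
  rintro rfl
  rw [Finset.card_univ, ZMod.card] at h
  exact lt_irrefl _ h

theorem sum_ite_sum_ite {G : Type*} [AddCommMonoid G] (a b : ℕ) (K : Finset (ZMod n))
    (f : Finset (ZMod n) → Finset (ZMod n) → G) :
    ∑ I ∈ K.powersetCard a, ∑ J ∈ K.powersetCard b, f I J =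
      ∑ I ∈ K.powerset, ∑ J ∈ K.powerset,
        if I.card = a then if J.card = b then f I J else 0 else 0 := by
  simp only [sum_powersetCard_eq]
  refine Finset.sum_congr rfl fun I _ => ?_
  split_ifs <;> simp

/-- A copy of the nilCoxeter algebra that carries only its ring structure. -/
def NilRing (n : ℕ) : Type := NilAlg n

instance : Ring (NilRing n) := inferInstanceAs (Ring (NilAlg n))

/-- The identity map from the nilCoxeter algebra to its copy. -/
def toRing : NilAlg n ≃+* NilRing n where
  toFun a := a
  invFun a := a
  left_inv _ := rfl
  right_inv _ := rfl
  map_mul' _ _ := rfl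
  map_add' _ _ := rfl

theorem toRing_zsmul (z : ℤ) (a : NilAlg n) : toRing (z • a) = z • toRing a := rfl

section Polynomials

open Polynomial

theorem mul_C_X (b : (NilRing n)[X][X]) : b * C X = C X * b := by
  induction b using Polynomial.induction_on' with
  | add p q hp hq => rw [add_mul, mul_add, hp, hq]
  | monomial k r => rw [← C_mul_X_pow_eq_monomial, mul_assoc, X_pow_mul, ← mul_assoc, ← C_mul,
      ← mul_assoc, ← C_mul, X_mul]

theorem sum_comm_of_ne_univ (a b : ℕ) {K : Finset (ZMod n)} (hK : K ≠ Finset.univ) :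
    ∑ I ∈ K.powersetCard a, ∑ J ∈ K.powersetCard b, elt n (cycInc n I) * elt n (cycDec n J) =
    ∑ I ∈ K.powersetCard a, ∑ J ∈ K.powersetCard b, elt n (cycDec n J) * elt n (cycInc n I) := by
  obtain ⟨p, l, hl, hl', rfl⟩ := exists_letters hK
  -- Two central variables allow both sizes to be read off: the inner one records |I| and the outer
  -- one |J|.
  let ι : NilAlg n →+* (NilRing n)[X][X] :=
    ((C : (NilRing n)[X] →+* (NilRing n)[X][X]).comp C).comp (toRing (n := n)).toRingHom
  have hy : ∀ b : (NilRing n)[X][X], b * X = X * b := fun b => X_mul.symm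
  have h := incProd_mul_decProd_comm (B := (NilRing n)[X][X]) ι p mul_C_X hy l hl hl'
  rw [← sum_elt_cycInc ι p mul_C_X l hl hl', ← sum_elt_cycDec ι p hy l hl hl',
    Finset.sum_mul_sum, Finset.sum_mul_sum] at h
  have h2 : ∀ u d, ι u * ι d = C (C (toRing (u * d))) := by simp [ι]
  have key : ∀ (i j : ℕ) (u d : NilAlg n),
      (((C X ^ i * ι u) * (X ^ j * ι d) : (NilRing n)[X][X]).coeff b).coeff a =
      if i = a then if j = b then toRing (u * d) else 0 else 0 := by
    intro i j u d
    have : ((C X ^ i * ι u) * (X ^ j * ι d) : (NilRing n)[X][X]) =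
        C (C (toRing (u * d)) * X ^ i) * X ^ j := by
      have h1 : ι u * X ^ j = X ^ j * ι u := (X_pow_mul).symm
      rw [mul_assoc, ← mul_assoc (ι u), h1, mul_assoc, h2, X_pow_mul, ← mul_assoc, ← C_pow,
        ← C_mul, X_pow_mul]
    rw [this, coeff_C_mul_X_pow, apply_ite (fun q : (NilRing n)[X] => q.coeff a), coeff_C_mul_X_pow,
      coeff_zero]
    split_ifs <;> first | rfl | omega
  have key' : ∀ (i j : ℕ) (u d : NilAlg n),
      (((X ^ j * ι d) * (C X ^ i * ι u) : (NilRing n)[X][X]).coeff b).coeff a =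
      if i = a then if j = b then toRing (d * u) else 0 else 0 := by
    intro i j u d
    have : ((X ^ j * ι d) * (C X ^ i * ι u) : (NilRing n)[X][X]) =
        C (C (toRing (d * u)) * X ^ i) * X ^ j := by
      have h1 : ι d * C X ^ i = C X ^ i * ι d :=
        (Commute.pow_right (mul_C_X _ : Commute (ι d) (C X)) _).eq
      rw [mul_assoc, ← mul_assoc (ι d), h1, mul_assoc, h2, ← C_pow, X_pow_mul, ← C_mul, X_pow_mul]
    rw [this, coeff_C_mul_X_pow, apply_ite (fun q : (NilRing n)[X] => q.coeff a), coeff_C_mul_X_pow,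
      coeff_zero]
    split_ifs <;> first | rfl | omega
  have h3 := congrArg (fun q : (NilRing n)[X][X] => (q.coeff b).coeff a) h
  simp only [finsetSum_coeff, key, key'] at h3
  apply toRing.injective
  simp only [map_sum]
  rw [sum_ite_sum_ite, sum_ite_sum_ite, h3, Finset.sum_comm]

/-- The relation `∑ (-1)^i e_i h_{j-i} = 0` inside a proper parabolic subalgebra. -/
theorem sum_alternating_of_ne_univ {j : ℕ} (hj : j ≠ 0) {K : Finset (ZMod n)}
    (hK : K ≠ Finset.univ) :
    ∑ I ∈ K.powerset, ∑ J ∈ K.powerset, (if I.card + J.card = j then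
      (-1) ^ I.card * toRing (elt n (cycInc n I) * elt n (cycDec n J)) else 0) = 0 := by
  obtain ⟨p, l, hl, hl', rfl⟩ := exists_letters hK
  have hy : ∀ b : (NilRing n)[X], b * X = X * b := fun b => X_mul.symm
  have hy' : ∀ b : (NilRing n)[X], b * -X = -X * b := fun b =>
    (Commute.neg_right (hy b : Commute b X)).eq
  let ι : NilAlg n →+* (NilRing n)[X] := C.comp (toRing (n := n)).toRingHom
  have h := incProd_neg_mul_decProd (B := (NilRing n)[X]) ι p hy l
  rw [← sum_elt_cycInc ι p hy' l hl hl', ← sum_elt_cycDec ι p hy l hl hl',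
    Finset.sum_mul_sum] at h
  have key : ∀ (i k : ℕ) (u d : NilAlg n),
      ((((-X) ^ i * ι u) * (X ^ k * ι d) : (NilRing n)[X]).coeff j) =
      if i + k = j then (-1) ^ i * toRing (u * d) else 0 := by
    intro i k u d
    have : (((-X) ^ i * ι u) * (X ^ k * ι d) : (NilRing n)[X]) =
        C ((-1) ^ i * toRing (u * d)) * X ^ (i + k) := by
      have h1 : ι u * X ^ k = X ^ k * ι u := (X_pow_mul).symm
      have h2 : ι u * ι d = C (toRing (u * d)) := by simp [ι]
      have h4 : (-1 : (NilRing n)[X]) ^ i = C ((-1) ^ i) := by simp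
      rw [mul_assoc, ← mul_assoc (ι u), h1, mul_assoc, h2, neg_pow, mul_assoc,
        ← mul_assoc (X ^ i), ← pow_add, X_pow_mul, ← mul_assoc, h4, ← C_mul]
    rw [this, coeff_C_mul_X_pow]
    simp only [eq_comm]
  have h3 := congrArg (fun q : (NilRing n)[X] => q.coeff j) h
  simp only [finsetSum_coeff, key] at h3
  rw [h3, coeff_one, if_neg hj]

end Polynomials

/-- The elements `𝐞_a` and `𝐡_b` commute. -/
theorem ncE_mul_ncH {a b : ℕ} (ha : a < n) (hb : b < n) :
    ncE n a * ncH n b = ncH n b * ncE n a := by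
  classical
  set f : Finset (ZMod n) → Finset (ZMod n) → NilAlg n := fun I J =>
    if I.card = a then if J.card = b then
      elt n (cycInc n I) * elt n (cycDec n J) - elt n (cycDec n J) * elt n (cycInc n I)
      else 0 else 0 with hf
  have h1 : ∑ I, ∑ J, f I J = 0 := by
    -- Pairs inside a proper set cancel by `sum_comm_of_ne_univ`. For covering pairs the shift by
    -- one is a bijection that turns increasing times decreasing into decreasing times increasing.
    refine sum_powerset_pairs_eq_zero f (fun K hK => ?_) ?_
    · rw [hf, ← sum_ite_sum_ite]
      simp only [Finset.sum_sub_distrib]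
      rw [sum_comm_of_ne_univ a b hK, sub_self]
    · have split : ∀ p : Finset (ZMod n) × Finset (ZMod n), f p.1 p.2 =
          (if p.1.card = a ∧ p.2.card = b then elt n (cycInc n p.1) * elt n (cycDec n p.2) else 0) -
          (if p.1.card = a ∧ p.2.card = b then
            elt n (cycDec n p.2) * elt n (cycInc n p.1) else 0) := by
        intro p
        simp only [hf]
        by_cases h : p.1.card = a <;> by_cases h' : p.2.card = b <;> simp [h, h']
      simp only [split, Finset.sum_sub_distrib, sub_eq_zero]
      let e : Finset (ZMod n) ≃ Finset (ZMod n) := (Equiv.addRight (1 : ZMod n)).finsetCongr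
      have he : ∀ J, e J = shift J := fun J => rfl
      refine Finset.sum_equiv (e.prodCongr e) (fun p => ?_) (fun p hp => ?_)
      · simp only [Finset.mem_filter, Finset.mem_univ, true_and, Equiv.prodCongr_apply,
          Prod.map_fst, Prod.map_snd, he]
        rw [shift, shift, ← Finset.map_union]
        conv_rhs => rw [← Finset.map_univ_equiv (Equiv.addRight (1 : ZMod n)), Finset.map_inj]
      · simp only [Finset.mem_filter, Finset.mem_univ, true_and, Equiv.prodCongr_apply,
          Prod.map_fst, Prod.map_snd, he, card_shift] at hp ⊢
        split_ifs with h
        · exact elt_cycInc_mul_elt_cycDec_of_union (ne_univ_of_card_lt (by omega))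
            (ne_univ_of_card_lt (by omega)) hp
        · rfl
  rw [← sub_eq_zero, ← h1, hf, ncE, ncH, Finset.sum_mul_sum, Finset.sum_mul_sum,
    Finset.sum_comm (s := Finset.powersetCard b _), ← Finset.powerset_univ, ← sum_ite_sum_ite,
    ← Finset.sum_sub_distrib]
  simp only [← Finset.sum_sub_distrib]

@[simp] theorem ncH_zero : ncH n 0 = 1 := by simp [ncH]

@[simp] theorem ncE_zero : ncE n 0 = 1 := by simp [ncE]

/-- The copy of `𝐡_i`. -/
abbrev ringH (n : ℕ) [NeZero n] [Fact (1 < n)] (i : ℕ) : NilRing n := toRing (ncH n i)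

/-- The copy of `𝐞_i`. -/
abbrev ringE (n : ℕ) [NeZero n] [Fact (1 < n)] (i : ℕ) : NilRing n := toRing (ncE n i)

/-- Because j < n, sets with |I| + |J| = j never cover all residues, so the relations over proper
sets of letters suffice. -/
theorem sum_ringE_mul_ringH {j : ℕ} (hj : j ≠ 0) (hjn : j < n) :
    ∑ i ∈ Finset.range (j + 1), (-1) ^ i * (ringE n i * ringH n (j - i)) = 0 := by
  classical
  have h1 := sum_powerset_pairs_eq_zero (n := n) (fun I J => if I.card + J.card = j then
      (-1) ^ I.card * toRing (elt n (cycInc n I) * elt n (cycDec n J)) else 0)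
    (fun K hK => sum_alternating_of_ne_univ hj hK) (by
      refine Finset.sum_eq_zero fun p hp => ?_
      simp only [Finset.mem_filter, Finset.mem_univ, true_and] at hp
      have := Finset.card_union_le p.1 p.2
      rw [hp, Finset.card_univ, ZMod.card] at this
      rw [if_neg (by omega)])
  rw [← h1]
  have h2 : ∀ i ∈ Finset.range (j + 1), (-1) ^ i * (ringE n i * ringH n (j - i)) =
      ∑ I, ∑ J, if I.card = i then (if J.card = j - i then
        (-1) ^ i * toRing (elt n (cycInc n I) * elt n (cycDec n J)) else 0) else 0 := by
    intro i _
    rw [ringE, ringH, ← map_mul, ncE, ncH, Finset.sum_mul_sum, ← Finset.powerset_univ,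
      ← sum_ite_sum_ite]
    simp only [map_sum, Finset.mul_sum]
  rw [Finset.sum_congr rfl h2, Finset.sum_comm]
  refine Finset.sum_congr rfl fun I _ => ?_
  rw [Finset.sum_comm]
  refine Finset.sum_congr rfl fun J _ => ?_
  rw [Finset.sum_ite_eq]
  by_cases h : I.card + J.card = j
  · rw [if_pos (by rw [Finset.mem_range]; omega), if_pos (by omega), if_pos h]
  · rw [if_neg h]
    split_ifs with h3 h4
    · rw [Finset.mem_range] at h3; omega
    · rfl
    · rfl

theorem ringH_eq {j : ℕ} (hj : j ≠ 0) (hjn : j < n) :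
    ringH n j = -∑ i ∈ Finset.range j, (-1) ^ (i + 1) * (ringE n (i + 1) * ringH n (j - (i + 1))) := by
  have h := sum_ringE_mul_ringH hj hjn
  rw [Finset.sum_range_succ', pow_zero, one_mul, ringE, ncE_zero, map_one, one_mul, Nat.sub_zero,
    add_comm, ← eq_neg_iff_add_eq_zero] at h
  exact h

theorem ringE_eq {j : ℕ} (hj : j ≠ 0) (hjn : j < n) :
    ringE n j = -((-1) ^ j * ∑ i ∈ Finset.range j, (-1) ^ i * (ringE n i * ringH n (j - i))) := by
  have h := sum_ringE_mul_ringH hj hjn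
  rw [Finset.sum_range_succ, Nat.sub_self, ringH, ncH_zero, map_one, mul_one,
    ← neg_eq_iff_add_eq_zero] at h
  rw [← mul_neg, h, ← mul_assoc, ← pow_add, Even.neg_one_pow ⟨j, rfl⟩, one_mul]

/-- The elements `𝐡_a` and `𝐡_b` commute. -/
theorem ringH_comm {a b : ℕ} (ha : a < n) (hb : b < n) :
    ringH n a * ringH n b = ringH n b * ringH n a := by
  induction a using Nat.strong_induction_on with
  | _ a ih =>
  by_cases h0 : a = 0
  · simp [h0, ringH]
  -- The element 𝐡_a is a polynomial in the 𝐞_i with i ≤ a and the 𝐡_i with i < a; the former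
  -- commute with 𝐡_b by `ncE_mul_ncH`, the latter by induction.
  have : Commute (ringH n a) (ringH n b) := by
    rw [ringH_eq h0 ha]
    refine Commute.neg_left (Commute.sum_left _ _ _ fun i hi => ?_)
    rw [Finset.mem_range] at hi
    refine Commute.mul_left ((Commute.neg_one_left _).pow_left _) (Commute.mul_left ?_ ?_)
    · show _ * _ = _ * _
      rw [← map_mul, ncE_mul_ncH (by omega) hb, map_mul]
    · exact ih _ (by omega) (by omega)
  exact this

/-! ### Evaluation of symmetric functions -/

/-- The subring generated by the `𝐡_i`. -/
abbrev fominStanley (n : ℕ) [NeZero n] [Fact (1 < n)] : Subalgebra ℤ (NilRing n) :=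
  Algebra.adjoin ℤ (Set.range fun i : Fin (n - 1) => ringH n (i + 1))

instance : IsMulCommutative (fominStanley n) :=
  Algebra.isMulCommutative_adjoin ℤ (by
    rintro _ ⟨i, rfl⟩ _ ⟨j, rfl⟩
    exact ringH_comm (by omega) (by omega))

open scoped IsMulCommutative in
/-- The algebra homomorphism sending `h_i` to `𝐡_i`. -/
def evalHom (n : ℕ) [NeZero n] [Fact (1 < n)] : SymH n →ₐ[ℤ] NilRing n :=
  (fominStanley n).val.comp
    (MvPolynomial.aeval fun i : Fin (n - 1) =>
      (⟨ringH n (i + 1), Algebra.subset_adjoin ⟨i, rfl⟩⟩ : fominStanley n))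

theorem evalHom_X (i : Fin (n - 1)) : evalHom n (MvPolynomial.X i) = ringH n (i + 1) := by
  simp [evalHom]

theorem exists_evalHom_eq_ringH {j : ℕ} (hj : j < n) : ∃ f : SymH n, evalHom n f = ringH n j := by
  rcases j with - | j
  · exact ⟨1, by simp [ringH]⟩
  · exact ⟨MvPolynomial.X ⟨j, by omega⟩, evalHom_X _⟩

/-- By `ringE_eq` each 𝐞_j is a polynomial in the 𝐡_i. This is what places 𝐞_m 𝐡_{n-m} in the image
of ℤ[h_1, …, h_{n-1}]. -/
theorem exists_evalHom_eq_ringE {j : ℕ} (hj : j < n) : ∃ f : SymH n, evalHom n f = ringE n j := by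
  have : ringE n j ∈ (evalHom n).range := by
    induction j using Nat.strong_induction_on with
    | _ j ih =>
    by_cases h0 : j = 0
    · simp [h0, ringE, one_mem]
    rw [ringE_eq h0 hj]
    refine neg_mem (mul_mem (pow_mem (neg_mem (one_mem _)) _) (sum_mem fun i hi => ?_))
    rw [Finset.mem_range] at hi
    refine mul_mem (pow_mem (neg_mem (one_mem _)) _) (mul_mem (ih i hi (by omega)) ?_)
    exact exists_evalHom_eq_ringH (by omega)
  exact this

theorem prod_toList_map {G : Type*} [Monoid G] (f : ℕ → G)
    (hf : ∀ a b, a < n → b < n → f a * f b = f b * f a) (l l' : List ℕ) (h : l.Perm l')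
    (hl : ∀ a ∈ l, a < n) : (l.map f).prod = (l'.map f).prod := by
  refine List.Perm.prod_eq' (h.map f) ?_
  rw [List.pairwise_map]
  refine List.Pairwise.imp_of_mem (R := fun _ _ => True) (fun ha hb _ => hf _ _ (hl _ ha) (hl _ hb)) ?_
  exact List.pairwise_of_forall fun _ _ => trivial

/-- The definition unfolds to a bind of singletons of the coerced indices, followed by the addition
of one; a single map is easier to use. -/
theorem monomialParts_eq (a : Fin (n - 1) →₀ ℕ) : monomialParts n a =
    ((Finsupp.toMultiset a).map fun i : Fin (n - 1) => (i : ℕ) + 1).sort (· ≥ ·) := by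
  have : (Finsupp.toMultiset a).map (fun i : Fin (n - 1) => (i : ℕ) + 1) =
      ((Finsupp.toMultiset a).map (fun i : Fin (n - 1) => (i : ℕ))).map (· + 1) := by
    rw [Multiset.map_map]; rfl
  rw [this, ← Multiset.bind_singleton (Finsupp.toMultiset a)]
  rfl

theorem mem_monomialParts {a : Fin (n - 1) →₀ ℕ} {k : ℕ} (h : k ∈ monomialParts n a) :
    1 ≤ k ∧ k < n := by
  simp only [monomialParts_eq, Multiset.mem_sort, Multiset.mem_map] at h
  obtain ⟨i, -, rfl⟩ := h
  omega

theorem evalHom_monomial (a : Fin (n - 1) →₀ ℕ) (z : ℤ) :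
    evalHom n (MvPolynomial.monomial a z) = z • ((monomialParts n a).map (ringH n)).prod := by
  rw [← mul_one z, ← smul_eq_mul, ← MvPolynomial.smul_monomial, map_zsmul]
  simp only [smul_eq_mul, mul_one]
  congr 1
  induction a using Finsupp.induction_linear with
  | zero => simp [monomialParts]
  | add a b ha hb =>
    rw [← mul_one (1 : ℤ), ← MvPolynomial.monomial_mul, map_mul, ha, hb, ← List.prod_append,
      ← List.map_append]
    refine prod_toList_map _ (fun _ _ => ringH_comm) _ _ ?_ ?_
    · rw [← Multiset.coe_eq_coe, ← Multiset.coe_add]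
      simp [monomialParts_eq]
    · intro k hk
      rw [List.mem_append] at hk
      exact hk.elim (fun h => (mem_monomialParts h).2) fun h => (mem_monomialParts h).2
  | single i k =>
    have h1 : monomialParts n (Finsupp.single i k) = List.replicate k ((i : ℕ) + 1) := by
      rw [monomialParts_eq, Finsupp.toMultiset_single, Multiset.map_nsmul, Multiset.map_singleton,
        Multiset.nsmul_singleton]
      exact List.eq_replicate_of_mem (fun b hb => by
        rw [Multiset.mem_sort] at hb; exact Multiset.eq_of_mem_replicate hb) |>.trans (by simp)
    rw [h1, ← MvPolynomial.X_pow_eq_monomial, map_pow, evalHom_X]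
    simp

theorem toRing_ncEval (f : SymH n) : toRing (ncEval n f) = evalHom n f := by
  conv_rhs => rw [f.as_sum, map_sum]
  rw [ncEval, map_sum]
  refine Finset.sum_congr rfl fun a _ => ?_
  rw [evalHom_monomial, toRing_zsmul, map_list_prod, List.map_map]
  rfl

end AffNil
end

noncomputable section
namespace AffNil
attribute [-simp] CoxeterMatrix.toCoxeterSystem_simple
set_option linter.unusedSectionVars false
variable {n : ℕ} [Fact (1 < n)] [NeZero n]

/-! ### Coefficients and the Hall pairing -/

/-- Left multiplication by A_i takes A_w to A_{s_i w} or to 0, so the span of the A_w is a left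
ideal, and it contains 1. -/
theorem closure_range_elt :
    AddSubgroup.closure (Set.range fun w : AffSym n => toRing (elt n w)) = ⊤ := by
  set S := AddSubgroup.closure (Set.range fun w : AffSym n => toRing (elt n w)) with hS
  let φ : FreeAlgebra ℤ (ZMod n) →+* NilRing n :=
    (toRing (n := n)).toRingHom.comp (RingQuot.mkAlgHom ℤ (NilRel n)).toRingHom
  have hφ : ∀ i, φ (FreeAlgebra.ι ℤ i) = toRing (gen n i) := fun i => rfl
  have key : ∀ x : FreeAlgebra ℤ (ZMod n), ∀ y ∈ S, φ x * y ∈ S := by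
    intro x
    induction x using FreeAlgebra.induction with
    | grade0 r =>
      intro y hy
      rw [eq_intCast, map_intCast, ← zsmul_eq_mul]
      exact S.zsmul_mem hy r
    | grade1 i =>
      intro y hy
      rw [hφ]
      induction hy using AddSubgroup.closure_induction with
      | mem y hy =>
        obtain ⟨w, rfl⟩ := hy
        show toRing (gen n i) * toRing (elt n w) ∈ S
        rw [← map_mul, ← elt_simple, elt_mul_elt]
        split_ifs
        · exact AddSubgroup.subset_closure ⟨_, rfl⟩
        · rw [map_zero]; exact S.zero_mem
      | zero => rw [mul_zero]; exact S.zero_mem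
      | add a b _ _ ha hb => rw [mul_add]; exact S.add_mem ha hb
      | neg a _ ha => rw [mul_neg]; exact S.neg_mem ha
    | mul a b ha hb => intro y hy; rw [map_mul, mul_assoc]; exact ha _ (hb _ hy)
    | add a b ha hb => intro y hy; rw [map_add, add_mul]; exact S.add_mem (ha _ hy) (hb _ hy)
  rw [eq_top_iff]
  intro z _
  obtain ⟨x, hx⟩ := RingQuot.mkAlgHom_surjective ℤ (NilRel n) (toRing.symm z)
  have h1 : φ x = z := by
    show toRing (RingQuot.mkAlgHom ℤ (NilRel n) x) = z
    rw [hx, RingEquiv.apply_symm_apply]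
  have := key x 1 (AddSubgroup.subset_closure ⟨1, by simp⟩)
  rwa [mul_one, h1] at this

theorem addHom_ext {G : Type*} [AddCommGroup G] {φ ψ : NilAlg n →+ G}
    (h : ∀ w, φ (elt n w) = ψ (elt n w)) : φ = ψ := by
  have h1 : Set.EqOn (φ.comp (toRing (n := n)).symm.toAddEquiv.toAddMonoidHom)
      (ψ.comp (toRing (n := n)).symm.toAddEquiv.toAddMonoidHom)
      (Set.range fun w : AffSym n => toRing (elt n w)) := by
    rintro _ ⟨w, rfl⟩
    exact h w
  have h2 := AddMonoidHom.eq_of_eqOn_dense closure_range_elt h1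
  ext a
  exact DFunLike.congr_fun h2 (toRing a)

-- By additivity a may be taken to be some A_w, and A_d A_w involves A_u only if w = d⁻¹u and the
-- lengths add up.
open scoped Classical in
theorem coef_elt_mul (d u : AffSym n) (a : NilAlg n) : coef u (elt n d * a) =
    if (cs n).length (d⁻¹ * u) + (cs n).length d = (cs n).length u then coef (d⁻¹ * u) a
    else 0 := by
  have : (coef u).comp (AddMonoidHom.mulLeft (elt n d)) =
      if (cs n).length (d⁻¹ * u) + (cs n).length d = (cs n).length u then coef (d⁻¹ * u)
      else 0 := by
    refine addHom_ext fun w => ?_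
    show coef u (elt n d * elt n w) = _
    rw [elt_mul_elt]
    by_cases h : d * w = u
    · subst h
      rw [inv_mul_cancel_left]
      by_cases h' : (cs n).length (d * w) = (cs n).length d + (cs n).length w
      · rw [if_pos h', if_pos (by omega), coef_elt, if_pos rfl, coef_elt, if_pos rfl]
      · rw [if_neg h', if_neg (by omega), map_zero, AddMonoidHom.zero_apply]
    · have h3 : w ≠ d⁻¹ * u := fun h' => h (by rw [h', mul_inv_cancel_left])
      split_ifs <;> simp [coef_elt, h, h3]
  have h := DFunLike.congr_fun this a
  rw [AddMonoidHom.comp_apply] at h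
  refine h.trans ?_
  split_ifs <;> rfl

open scoped Classical in
theorem coef_mul_elt (d u : AffSym n) (a : NilAlg n) : coef u (a * elt n d) =
    if (cs n).length (u * d⁻¹) + (cs n).length d = (cs n).length u then coef (u * d⁻¹) a
    else 0 := by
  have : (coef u).comp (AddMonoidHom.mulRight (elt n d)) =
      if (cs n).length (u * d⁻¹) + (cs n).length d = (cs n).length u then coef (u * d⁻¹)
      else 0 := by
    refine addHom_ext fun w => ?_
    show coef u (elt n w * elt n d) = _
    rw [elt_mul_elt]
    by_cases h : w * d = u
    · subst h
      rw [mul_inv_cancel_right]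
      by_cases h' : (cs n).length (w * d) = (cs n).length w + (cs n).length d
      · rw [if_pos h', if_pos (by omega), coef_elt, if_pos rfl, coef_elt, if_pos rfl]
      · rw [if_neg h', if_neg (by omega), map_zero, AddMonoidHom.zero_apply]
    · have h3 : w ≠ u * d⁻¹ := fun h' => h (by rw [h', inv_mul_cancel_right])
      split_ifs <;> simp [coef_elt, h, h3]
  have h := DFunLike.congr_fun this a
  rw [AddMonoidHom.comp_apply] at h
  refine h.trans ?_
  split_ifs <;> rfl

/-- For x in J but not in I, the element d_J carries x + 1 to x, across a cut that d_I preserves. -/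
theorem cycDec_injective {I J : Finset (ZMod n)} (hI : I ≠ Finset.univ) (hJ : J ≠ Finset.univ)
    (h : cycDec n I = cycDec n J) : I = J := by
  have key : ∀ I J : Finset (ZMod n), I ≠ Finset.univ → J ≠ Finset.univ →
      cycDec n I = cycDec n J → I.card ≤ J.card → J ⊆ I := by
    intro I J hI hJ h _ j hj
    by_contra hjI
    obtain ⟨x, rfl⟩ := ZMod.intCast_surjective j
    have h1 := perm_cycDec hJ hj
    obtain ⟨ω, h2, h3⟩ := exists_isCycDecWord hI
    rw [← h, cycDec_eq h2 h3] at h1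
    have := (perm_wordProd_of_notMem (ω := ω) (x := x) (by rwa [h3])).2 (x + 1) le_rfl
    omega
  have hc : I.card = J.card := by rw [← length_cycDec hI, ← length_cycDec hJ, h]
  exact (key J I hJ hI h.symm hc.ge).antisymm (key I J hI hJ h hc.le)

/-! ### Counting cyclically decreasing decompositions -/

/-- The decompositions counted by a coefficient of the affine Stanley function. -/
def Decompositions (l : List ℕ) (u : AffSym n) : Set (ℕ → AffSym n) :=
  {v | (∀ i, IsCycDec n (v i)) ∧ (∀ i, (cs n).length (v i) = l.getD i 0) ∧
    ((List.range l.length).map v).prod = u ∧ (cs n).length u = l.sum}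

theorem prod_range_eq {M : Type*} [Monoid M] {v : ℕ → M} {N : ℕ} (h : ∀ i, N ≤ i → v i = 1)
    (k : ℕ) : ((List.range (N + k)).map v).prod = ((List.range N).map v).prod := by
  induction k with
  | zero => rfl
  | succ k ih =>
    rw [← add_assoc, List.range_succ, List.map_append, List.prod_append, ih]
    simp [h (N + k) (by omega)]

theorem sum_range_getD (l : List ℕ) (k : ℕ) :
    ∑ i ∈ Finset.range (l.length + k), l.getD i 0 = l.sum := by
  rw [Finset.sum_range_add]
  have h1 : ∑ i ∈ Finset.range k, l.getD (l.length + i) 0 = 0 :=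
    Finset.sum_eq_zero fun i _ => List.getD_eq_default _ _ (by omega)
  rw [h1, add_zero]
  induction l with
  | nil => simp
  | cons a l ih =>
    rw [List.length_cons, Finset.sum_range_succ', List.sum_cons, add_comm]
    simp only [List.getD_cons_zero, List.getD_cons_succ]
    rw [ih]
    exact Finset.sum_eq_zero fun i _ => List.getD_eq_default _ _ (by omega)

/-- The cutoff N of `IsCycDecDecomposition` is arbitrary; both ranges are padded with trivial
factors to the common length `N + l.length`. -/
theorem mem_decompositions_iff (l : List ℕ) (u : AffSym n) (v : ℕ → AffSym n) :
    v ∈ Decompositions l u ↔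
      IsCycDecDecomposition n u v ∧ ∀ i, (cs n).length (v i) = l.toFinsupp i := by
  have hf : ∀ i, l.toFinsupp i = l.getD i 0 := fun i => List.toFinsupp_apply l i
  simp only [hf]
  constructor
  · rintro ⟨h1, h2, h3, h4⟩
    refine ⟨⟨h1, l.length, fun i hi => ?_, h3, ?_⟩, h2⟩
    · rw [← (cs n).length_eq_zero_iff, h2, List.getD_eq_default _ _ hi]
    · rw [h4, ← sum_range_getD l 0]
      exact Finset.sum_congr rfl fun i _ => h2 i
  · rintro ⟨⟨h1, N, h2, h3, h4⟩, h5⟩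
    have h6 : ∀ i, l.length ≤ i → v i = 1 := fun i hi => by
      rw [← (cs n).length_eq_zero_iff, h5, List.getD_eq_default _ _ hi]
    refine ⟨h1, h5, ?_, ?_⟩
    · rw [← h3, ← prod_range_eq h2 l.length, ← prod_range_eq h6 N, add_comm]
    · rw [← h4, ← sum_range_getD l N, add_comm, Finset.sum_range_add]
      have : ∑ i ∈ Finset.range l.length, l.getD (N + i) 0 = 0 :=
        Finset.sum_eq_zero fun i _ => by rw [← h5, h2 _ (by omega), (cs n).length_one]
      rw [this, add_zero]
      exact Finset.sum_congr rfl fun i _ => h5 i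

theorem length_prod_range_le (v : ℕ → AffSym n) (N : ℕ) :
    (cs n).length ((List.range N).map v).prod ≤ ∑ i ∈ Finset.range N, (cs n).length (v i) := by
  induction N with
  | zero => simp
  | succ N ih =>
    rw [List.range_succ, List.map_append, List.prod_append, Finset.sum_range_succ]
    refine ((cs n).length_mul_le _ _).trans ?_
    simpa using ih

/-- Subadditivity of the length forces a length-additive product to remain additive after its first
factor is removed. -/
theorem mem_decompositions_cons {a : ℕ} (l : List ℕ) (u : AffSym n)
    (v : ℕ → AffSym n) : v ∈ Decompositions (a :: l) u ↔
      ∃ J : Finset (ZMod n), J ≠ Finset.univ ∧ J.card = a ∧ v 0 = cycDec n J ∧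
        (cs n).length ((cycDec n J)⁻¹ * u) + (cs n).length (cycDec n J) = (cs n).length u ∧
        (fun i => v (i + 1)) ∈ Decompositions l ((cycDec n J)⁻¹ * u) := by
  have hr : ((List.range (a :: l).length).map v).prod =
      v 0 * ((List.range l.length).map fun i => v (i + 1)).prod := by
    rw [List.length_cons, List.range_succ_eq_map, List.map_cons, List.prod_cons, List.map_map]
    rfl
  constructor
  · rintro ⟨h1, h2, h3, h4⟩
    obtain ⟨J, hJ, hv⟩ := h1 0
    have h20 := h2 0
    rw [List.getD_cons_zero, hv, length_cycDec hJ] at h20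
    rw [hr, hv] at h3
    have h5 : (cycDec n J)⁻¹ * u = ((List.range l.length).map fun i => v (i + 1)).prod := by
      rw [← h3, inv_mul_cancel_left]
    have h2' : ∀ i, (cs n).length (v (i + 1)) = l.getD i 0 := fun i => by
      rw [h2, List.getD_cons_succ]
    have h6 := length_prod_range_le (fun i => v (i + 1)) l.length
    have h6' := sum_range_getD l 0
    simp only [h2', add_zero] at h6 h6'
    rw [h6', ← h5] at h6
    have h7 := (cs n).length_mul_le (cycDec n J) ((cycDec n J)⁻¹ * u)
    rw [mul_inv_cancel_left, h4, List.sum_cons, length_cycDec hJ] at h7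
    rw [List.sum_cons] at h4
    refine ⟨J, hJ, h20, hv, ?_, fun i => h1 _, h2', h5.symm, ?_⟩
    · rw [length_cycDec hJ]; omega
    · omega
  · rintro ⟨J, hJ, hc, hv, hl, h1, h2, h3, h4⟩
    refine ⟨fun i => ?_, fun i => ?_, ?_, ?_⟩
    · rcases i with - | i
      · exact ⟨J, hJ, hv⟩
      · exact h1 i
    · rcases i with - | i
      · rw [hv, length_cycDec hJ, List.getD_cons_zero, hc]
      · rw [List.getD_cons_succ]; exact h2 i
    · rw [hr, h3, hv, mul_inv_cancel_left]
    · rw [← hl, h4, length_cycDec hJ, List.sum_cons, hc, add_comm]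

open scoped Classical in
theorem decompositions_nil (u : AffSym n) :
    Decompositions [] u = if u = 1 then {fun _ => 1} else (∅ : Set (ℕ → AffSym n)) := by
  ext v
  split_ifs with h
  · simp only [Decompositions, Set.mem_ofPred_eq, Set.mem_singleton_iff]
    constructor
    · rintro ⟨-, h2, -⟩
      funext i
      rw [← (cs n).length_eq_zero_iff, h2]
      simp
    · rintro rfl
      exact ⟨fun _ => ⟨∅, (Finset.univ_nonempty).ne_empty.symm, by simp⟩, by simp, by simp [h],
        by simp [h]⟩
  · simp only [Decompositions, Set.mem_ofPred_eq, Set.mem_empty_iff_false, iff_false]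
    rintro ⟨-, -, h3, -⟩
    exact h (by simpa using h3.symm)

/-- The coefficients of a product of elements `𝐡_i` count cyclically decreasing decompositions. -/
theorem card_decompositions (l : List ℕ) (hl : ∀ a ∈ l, a < n) (u : AffSym n) :
    Finite (Decompositions l u) ∧
      (Nat.card (Decompositions l u) : ℤ) = coef u (l.map (ncH n)).prod := by
  classical
  induction l generalizing u with
  | nil =>
    rw [decompositions_nil]
    have h1 : coef u (1 : NilAlg n) = if u = 1 then 1 else 0 := by
      rw [← elt_one, coef_elt]
      simp only [eq_comm]
    rw [List.map_nil, List.prod_nil, h1]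
    split_ifs
    · exact ⟨inferInstance, by simp⟩
    · exact ⟨inferInstance, by simp⟩
  | cons a l ih =>
    have ih' := fun u => ih (fun b hb => hl b (by simp [hb])) u
    have ha := hl a (by simp)
    let T := {J : Finset (ZMod n) // J.card = a ∧
      (cs n).length ((cycDec n J)⁻¹ * u) + (cs n).length (cycDec n J) = (cs n).length u}
    have hT : ∀ J : T, J.1 ≠ Finset.univ := fun J => ne_univ_of_card_lt (by rw [J.2.1]; exact ha)
    -- A decomposition of u is a first factor d_J and a decomposition of d_J⁻¹u, and J is recovered
    -- from d_J. The length condition in T is the one that appears in `coef_elt_mul`.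
    let e : (Σ J : T, Decompositions l ((cycDec n J.1)⁻¹ * u)) → Decompositions (a :: l) u :=
      fun p => ⟨fun i => Nat.casesOn i (cycDec n p.1.1) p.2.1,
        (mem_decompositions_cons l u _).2 ⟨p.1.1, hT p.1, p.1.2.1, rfl, p.1.2.2, p.2.2⟩⟩
    have he : Function.Bijective e := by
      constructor
      · rintro ⟨J, v⟩ ⟨J', v'⟩ h
        have h1 := congrArg Subtype.val h
        have h2 : J = J' := Subtype.ext (cycDec_injective (hT J) (hT J') (congrFun h1 0))
        subst h2
        have h3 : v = v' := by
          apply Subtype.ext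
          funext i
          exact congrFun h1 (i + 1)
        rw [h3]
      · rintro ⟨v, hv⟩
        obtain ⟨J, hJ, hc, h0, hlen, hv'⟩ := (mem_decompositions_cons l u v).1 hv
        refine ⟨⟨⟨J, hc, hlen⟩, ⟨_, hv'⟩⟩, ?_⟩
        apply Subtype.ext
        funext i
        rcases i with - | i
        · exact h0.symm
        · rfl
    have : ∀ J : T, Finite (Decompositions l ((cycDec n J.1)⁻¹ * u)) := fun J => (ih' _).1
    refine ⟨Finite.of_surjective e he.2, ?_⟩
    rw [← Nat.card_eq_of_bijective e he, Nat.card_sigma, List.map_cons, List.prod_cons, ncH,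
      Finset.sum_mul, map_sum, sum_powersetCard_univ_eq]
    push_cast
    rw [Finset.sum_congr rfl fun J _ => (ih' ((cycDec n J.1)⁻¹ * u)).2]
    refine (Finset.sum_subtype (Finset.univ.filter fun J : Finset (ZMod n) => J.card = a ∧
      (cs n).length ((cycDec n J)⁻¹ * u) + (cs n).length (cycDec n J) = (cs n).length u)
      (by simp) fun J => coef ((cycDec n J)⁻¹ * u) (l.map (ncH n)).prod).symm.trans ?_
    rw [Finset.sum_filter]
    refine Finset.sum_congr rfl fun J _ => ?_
    rw [coef_elt_mul, ite_and]

theorem coef_ncEval (f : SymH n) (u : AffSym n) : coef u (ncEval n f) =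
    ∑ a ∈ f.support, f.coeff a * coef u ((monomialParts n a).map (ncH n)).prod := by
  rw [ncEval, map_sum]
  refine Finset.sum_congr rfl fun a _ => ?_
  have := map_zsmul ((coef u).comp (toRing (n := n)).symm.toAddEquiv.toAddMonoidHom)
    (f.coeff a) (toRing ((monomialParts n a).map (ncH n)).prod)
  rw [smul_eq_mul] at this
  exact this

/-- The Hall pairing with an affine Stanley function is a coefficient in the nilCoxeter algebra. -/
theorem hallPairing_affineStanley (f : SymH n) (u : AffSym n) :
    hallPairing n f (affineStanley n u) = coef u (ncEval n f) := by
  rw [coef_ncEval, hallPairing]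
  refine Finset.sum_congr rfl fun a _ => ?_
  rw [← (card_decompositions _ (fun b hb => (mem_monomialParts hb).2) u).2]
  congr 1
  show (Nat.card _ : ℤ) = _
  congr 1
  refine Nat.card_congr (Equiv.subtypeEquivRight fun v => ?_)
  exact (mem_decompositions_iff _ u v).symm

end AffNil
end

noncomputable section

namespace AffNil

attribute [-simp] CoxeterMatrix.toCoxeterSystem_simple
set_option linter.unusedSectionVars false

variable {n : ℕ} [Fact (1 < n)] [NeZero n]

/-! ### Grassmannian elements -/

/-- `r` is the only possible right descent of `w`. -/
def GrassAt (r : ZMod n) (w : AffSym n) : Prop :=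
  ∀ y : ℤ, (y : ZMod n) ≠ r → perm w y < perm w (y + 1)

theorem grassAt_iff {r : ZMod n} {w : AffSym n} :
    GrassAt r w ↔ ∀ i, (cs n).IsRightDescent w i → i = r := by
  have hne : ∀ y : ℤ, perm w y ≠ perm w (y + 1) := fun y h => by
    simpa using (perm w).injective h
  constructor
  · intro h i hi
    obtain ⟨y, rfl⟩ := ZMod.intCast_surjective i
    by_contra hy
    rw [isRightDescent_iff_perm] at hi
    exact lt_asymm hi (h y hy)
  · intro h y hy
    by_contra hlt
    refine hy (h y ((isRightDescent_iff_perm w y).2 ?_))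
    have := hne y
    omega

/-- The right descents of w are exactly the last letters of its reduced words. -/
theorem isZeroGrassmannian_iff {w : AffSym n} : IsZeroGrassmannian n w ↔ GrassAt 0 w := by
  rw [grassAt_iff]
  constructor
  · intro h i hi
    obtain ⟨ω, hω, hw⟩ := (cs n).exists_isReduced (w * (cs n).simple i)
    have hnot : ¬ (cs n).IsRightDescent ((cs n).wordProd ω) i := by
      rw [← hw]
      exact ((cs n).isRightDescent_iff_not_isRightDescent_mul).1 hi
    exact h (ω ++ [i]) (isReduced_concat hω hnot) (by
      rw [(cs n).wordProd_append, ← hw, (cs n).wordProd_singleton,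
        (cs n).simple_mul_simple_cancel_right]) i (by simp)
  · rintro h ω hω rfl i hi
    rcases List.eq_nil_or_concat ω with rfl | ⟨ω', j, rfl⟩
    · simp at hi
    · rw [List.concat_eq_append] at *
      obtain rfl : j = i := by simpa using hi
      exact h _ (IsReduced.of_concat hω).2

/-- Only j - 1 would have to follow j in a cyclically decreasing word, so d_J has a reduced word
that ends in j. -/
theorem isRightDescent_of_cycDec {J : Finset (ZMod n)} (hJ : J ≠ Finset.univ) {u : AffSym n}
    (h : (cs n).length (u * (cycDec n J)⁻¹) + (cs n).length (cycDec n J) = (cs n).length u)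
    {j : ZMod n} (hj : j ∈ J) (hj' : j - 1 ∉ J) : (cs n).IsRightDescent u j := by
  have hE : J.erase j ≠ Finset.univ := fun h => by
    have := Finset.mem_univ j
    rw [← h] at this
    simp at this
  have h1 : cycDec n J = cycDec n (J.erase j) * (cs n).simple j := by
    rw [← cycDec_singleton, ← cycDec_union hE (singleton_ne_univ j) (by simp)]
    · congr 1
      ext i
      by_cases hi : i = j <;> simp [hi, hj]
    · intro i hi hij
      rw [Finset.mem_singleton] at hij
      exact hj' (by rw [← hij, add_sub_cancel_right]; exact Finset.mem_of_mem_erase hi)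
  have h2 : u * (cs n).simple j = u * (cycDec n J)⁻¹ * cycDec n (J.erase j) := by
    rw [h1, mul_inv_rev, (cs n).inv_simple]
    group
  have h3 := (cs n).length_mul_le (u * (cycDec n J)⁻¹) (cycDec n (J.erase j))
  rw [← h2, length_cycDec hE, Finset.card_erase_of_mem hj] at h3
  rw [length_cycDec hJ] at h
  have := Finset.card_pos.2 ⟨j, hj⟩
  unfold CoxeterSystem.IsRightDescent
  omega

/-! ### Cyclic intervals -/

/-- The residues `r, r + 1, …, r + L - 1`. -/
def arc (r : ZMod n) (L : ℕ) : Finset (ZMod n) := (Finset.range L).image fun t : ℕ => r + t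

theorem mem_arc {r j : ZMod n} {L : ℕ} : j ∈ arc r L ↔ ∃ t < L, r + (t : ZMod n) = j := by
  simp [arc]

theorem add_mem_arc {r : ZMod n} {L t : ℕ} (ht : t < L) : r + (t : ZMod n) ∈ arc r L :=
  mem_arc.2 ⟨t, ht, rfl⟩

theorem add_notMem_arc {r : ZMod n} {L t : ℕ} (ht : L ≤ t) (hn : t < n) :
    r + (t : ZMod n) ∉ arc r L := by
  rw [mem_arc]
  rintro ⟨s, hs, h⟩
  exact natCast_ne_of_lt (n := n) (a := s) (b := t) (by omega) (by omega) (add_left_cancel h)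

theorem card_arc {r : ZMod n} {L : ℕ} (hL : L ≤ n) : (arc r L).card = L := by
  rw [arc, Finset.card_image_of_injOn, Finset.card_range]
  intro a ha b hb h
  have ha : a < L := by simpa using ha
  have hb : b < L := by simpa using hb
  have h' := add_left_cancel h
  rcases lt_trichotomy a b with hab | hab | hab
  · exact absurd h' (natCast_ne_of_lt hab (by omega))
  · exact hab
  · exact absurd h'.symm (natCast_ne_of_lt hab (by omega))

theorem arc_ne_univ {r : ZMod n} {L : ℕ} (hL : L < n) : arc r L ≠ Finset.univ :=
  ne_univ_of_card_lt (by rwa [card_arc hL.le])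

theorem arc_zero (r : ZMod n) : arc r 0 = ∅ := rfl

theorem arc_succ (r : ZMod n) (L : ℕ) : arc r (L + 1) = arc (r + 1) L ∪ {r} := by
  ext j
  simp only [mem_arc, Finset.mem_union, Finset.mem_singleton]
  constructor
  · rintro ⟨t, ht, rfl⟩
    rcases t with _ | t
    · right; simp
    · left; exact ⟨t, by omega, by push_cast; ring⟩
  · rintro (⟨t, ht, rfl⟩ | rfl)
    · exact ⟨t + 1, by omega, by push_cast; ring⟩
    · exact ⟨0, by omega, by simp⟩

theorem arc_add (r : ZMod n) (L K : ℕ) : arc r (L + K) = arc (r + (L : ZMod n)) K ∪ arc r L := by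
  ext j
  simp only [mem_arc, Finset.mem_union]
  constructor
  · rintro ⟨t, ht, rfl⟩
    rcases lt_or_ge t L with h | h
    · exact Or.inr ⟨t, h, rfl⟩
    · refine Or.inl ⟨t - L, by omega, ?_⟩
      rw [Nat.cast_sub h]; ring
  · rintro (⟨t, ht, rfl⟩ | ⟨t, ht, rfl⟩)
    · exact ⟨L + t, by omega, by push_cast; ring⟩
    · exact ⟨t, by omega, rfl⟩

theorem cycDec_arc_add {r : ZMod n} {L K : ℕ} (h : L + K < n) :
    cycDec n (arc r (L + K)) = cycDec n (arc (r + (L : ZMod n)) K) * cycDec n (arc r L) := by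
  rw [arc_add, cycDec_union (arc_ne_univ (by omega)) (arc_ne_univ (by omega))]
  · rw [Finset.disjoint_left]
    intro j hj
    obtain ⟨t, ht, rfl⟩ := mem_arc.1 hj
    rw [add_assoc, ← Nat.cast_add]
    exact add_notMem_arc (by omega) (by omega)
  · intro j hj
    obtain ⟨t, ht, rfl⟩ := mem_arc.1 hj
    have e : r + (L : ZMod n) + t + 1 = r + ((L + t + 1 : ℕ) : ZMod n) := by push_cast; ring
    rw [e]
    exact add_notMem_arc (by omega) (by omega)

theorem arc_one (r : ZMod n) : arc r 1 = {r} := by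
  rw [arc_succ, arc_zero, Finset.empty_union]

theorem cycDec_arc_succ {r : ZMod n} {L : ℕ} (h : L + 1 < n) :
    cycDec n (arc r (L + 1)) = cycDec n (arc (r + 1) L) * (cs n).simple r := by
  rw [add_comm, cycDec_arc_add (by omega), arc_one, cycDec_singleton, Nat.cast_one]

theorem cycDec_arc_succ' {r : ZMod n} {L : ℕ} (h : L + 1 < n) :
    cycDec n (arc r (L + 1)) = (cs n).simple (r + (L : ZMod n)) * cycDec n (arc r L) := by
  rw [cycDec_arc_add (by omega), arc_one, cycDec_singleton]

/-- Let L be least with r + L missing. Going on from there, the first return to J would be an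
element whose predecessor is missing, hence r itself, which is met only after a full turn. -/
theorem eq_arc {J : Finset (ZMod n)} {r : ZMod n} (hJ : J ≠ Finset.univ)
    (h : ∀ j ∈ J, j - 1 ∉ J → j = r) : J = arc r J.card := by
  classical
  have hex : ∃ t : ℕ, r + (t : ZMod n) ∉ J := by
    by_contra hc
    push Not at hc
    refine hJ (Finset.eq_univ_iff_forall.2 fun j => ?_)
    have := hc (j - r).val
    rwa [ZMod.natCast_zmod_val, add_sub_cancel] at this
  obtain ⟨L, hL, hmin⟩ : ∃ L : ℕ, r + (L : ZMod n) ∉ J ∧ ∀ t < L, r + (t : ZMod n) ∈ J :=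
    ⟨Nat.find hex, Nat.find_spec hex, fun t ht => not_not.1 (Nat.find_min hex ht)⟩
  have key : ∀ s : ℕ, s < n → L ≤ s → r + (s : ZMod n) ∉ J := by
    intro s hs hLs
    induction s, hLs using Nat.le_induction with
    | base => exact hL
    | succ s hLs ih =>
      intro hm
      have e := h _ hm (by
        rw [Nat.cast_succ, ← add_assoc, add_sub_cancel_right]
        exact ih (by omega))
      have : ((0 : ℕ) : ZMod n) ≠ ((s + 1 : ℕ) : ZMod n) := natCast_ne_of_lt (by omega) (by omega)
      apply this
      rw [Nat.cast_zero]
      exact (by simpa using e : ((s + 1 : ℕ) : ZMod n) = 0).symm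
  have hLn : L ≤ n := by
    by_contra hc
    refine hJ (Finset.eq_univ_iff_forall.2 fun j => ?_)
    have := hmin (j - r).val (by have := ZMod.val_lt (j - r); omega)
    rwa [ZMod.natCast_zmod_val, add_sub_cancel] at this
  have hJL : J = arc r L := by
    ext j
    constructor
    · intro hj
      by_contra hc
      have h1 := ZMod.val_lt (j - r)
      have h2 : r + ((j - r).val : ZMod n) = j := by
        rw [ZMod.natCast_zmod_val, add_sub_cancel]
      refine key (j - r).val h1 ?_ (by rwa [h2])
      by_contra hlt
      exact hc (mem_arc.2 ⟨_, by omega, h2⟩)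
    · intro hj
      obtain ⟨t, ht, rfl⟩ := mem_arc.1 hj
      exact hmin t ht
  rw [hJL, card_arc hLn]

/-- In consequence a Grassmannian element has at most one right factor d_J of each size, so
multiplication by 𝐡_p contributes a single term to its coefficient (`GrassAt.coef_mul_ncH`). -/
theorem GrassAt.eq_arc {r : ZMod n} {u : AffSym n} (hu : GrassAt r u) {J : Finset (ZMod n)}
    (hJ : J ≠ Finset.univ)
    (h : (cs n).length (u * (cycDec n J)⁻¹) + (cs n).length (cycDec n J) = (cs n).length u) :
    J = arc r J.card :=
  AffNil.eq_arc hJ fun _ hj hj' => grassAt_iff.1 hu _ (isRightDescent_of_cycDec hJ h hj hj')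

/-! ### The action of a cyclically decreasing interval -/

theorem perm_cycDec_arc_add_one {r : ℤ} {L t : ℕ} (hL : L < n) (ht : t < L) :
    perm (cycDec n (arc (r : ZMod n) L)) (r + t + 1) = r + t :=
  perm_cycDec (arc_ne_univ hL) (by push_cast; exact add_mem_arc ht)

theorem perm_cycDec_arc_of_lt {r : ℤ} {L t : ℕ} (ht : L < t) (hn : t < n) :
    perm (cycDec n (arc (r : ZMod n) L)) (r + t) = r + t := by
  obtain ⟨ω, h1, h2⟩ := exists_isCycDecWord (arc_ne_univ (r := (r : ZMod n)) (ht.trans hn))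
  rw [cycDec_eq h1 h2]
  apply perm_wordProd_of_ne
  · rw [h2]
    push_cast
    exact add_notMem_arc ht.le hn
  · rw [h2]
    obtain ⟨t, rfl⟩ : ∃ s, t = s + 1 := ⟨t - 1, by omega⟩
    push_cast
    rw [← add_assoc, add_sub_cancel_right]
    exact add_notMem_arc (by omega) (by omega)

theorem perm_cycDec_arc_self {r : ℤ} {L : ℕ} (hL : L < n) :
    perm (cycDec n (arc (r : ZMod n) L)) r = r + L := by
  induction L with
  | zero => simp [arc_zero]
  | succ L ih =>
    rw [cycDec_arc_succ' hL, map_mul, Equiv.Perm.mul_apply, ih (by omega), perm_simple,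
      affSwap_of_eq (by push_cast; rfl)]
    push_cast
    ring

theorem lt_of_forall_lt_add_one {f : ℤ → ℤ} {a b : ℤ} (h : ∀ y, a ≤ y → y < b → f y < f (y + 1))
    {y z : ℤ} (hy : a ≤ y) (hyz : y < z) (hz : z ≤ b) : f y < f z := by
  induction z, (Int.add_one_le_iff.2 hyz) using Int.leInduction with
  | base => exact h y hy (by omega)
  | succ z hz' ih => exact (ih (by omega) (by omega)).trans (h z (by omega) (by omega))

/-- The letters are appended with s_r last. Just before it, position r holds x(r) and position r + 1
holds x(r + L), for the full length L, so there is no descent. -/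
theorem length_mul_cycDec_arc {x : AffSym n} {L : ℕ} (hL : L < n) {r : ℤ}
    (h : ∀ y, r ≤ y → y < r + L → perm x y < perm x (y + 1)) :
    (cs n).length (x * cycDec n (arc (r : ZMod n) L)) = (cs n).length x + L := by
  induction L generalizing r with
  | zero => simp [arc_zero]
  | succ L ih =>
    have ih' := ih (by omega) (r := r + 1) fun y h1 h2 => h y (by omega) (by push_cast; omega)
    have e : ((r + 1 : ℤ) : ZMod n) = (r : ZMod n) + 1 := by push_cast; rfl
    rw [cycDec_arc_succ hL, ← mul_assoc, length_mul_simple_of_not, ← e, ih', add_assoc]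
    rw [isRightDescent_iff_perm, not_lt, map_mul, Equiv.Perm.mul_apply, Equiv.Perm.mul_apply, ← e,
      perm_cycDec_arc_self (by omega)]
    -- Position r is reached through its translate r + n = (r + 1) + (n - 1), where t = n - 1 is in
    -- the admissible range.
    have h3 := perm_cycDec_arc_of_lt (n := n) (r := r + 1) (L := L) (t := n - 1) (by omega) (by omega)
    have h4 : (r + 1 : ℤ) + ((n - 1 : ℕ) : ℤ) = r + n := by
      rw [Nat.cast_sub (by omega)]; push_cast; ring
    rw [h4, perm_add, add_left_inj] at h3
    rw [h3]
    refine (lt_of_forall_lt_add_one h le_rfl ?_ ?_).le <;> push_cast <;> omega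

end AffNil
end

noncomputable section

namespace AffNil

attribute [-simp] CoxeterMatrix.toCoxeterSystem_simple
set_option linter.unusedSectionVars false

variable {n : ℕ} [Fact (1 < n)] [NeZero n]

/-! ### A Grassmannian element for every bounded partition -/

/-- The product of cyclically decreasing intervals whose lengths are the parts of a partition,
starting at `r` for the first part (the rightmost factor), at `r - 1` for the second, and so on. -/
def rowElt (n : ℕ) : ℤ → List ℕ → AffSym n
  | _, [] => 1
  | r, L :: l => rowElt n (r - 1) l * cycDec n (arc (r : ZMod n) L)

/-- Passing from x to x d, where d is the interval of length L at r, takes x(r + L) out of the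
increasing sequence x(r), …, x(r + n - 1) and appends x(r + L) + n at its end. For the sequence to
remain increasing, x(r + n - 1) < x(r + L) + n is needed when L < n - 1; this is the second claim
for x with K = L, which applies because L bounds the later parts. -/
theorem perm_rowElt {l : List ℕ} (hl : l.Pairwise (· ≥ ·)) (hln : ∀ k ∈ l, k < n) (r : ℤ) :
    (∀ y, r + 1 ≤ y → y < r + n → perm (rowElt n r l) y < perm (rowElt n r l) (y + 1)) ∧
    ∀ K : ℕ, (∀ k ∈ l, k ≤ K) → K < n →
      perm (rowElt n r l) (r + n) < perm (rowElt n r l) (r + K + 1) + n := by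
  induction l generalizing r with
  | nil =>
    refine ⟨fun y _ _ => by simp [rowElt], fun K _ _ => ?_⟩
    simp only [rowElt, map_one, Equiv.Perm.one_apply]
    omega
  | cons L l ih =>
    rw [List.pairwise_cons] at hl
    obtain ⟨ih1, ih2⟩ := ih hl.2 (fun k hk => hln k (by simp [hk])) (r - 1)
    have hL : L < n := hln L (by simp)
    have ih2' := ih2 L hl.1 hL
    rw [rowElt]
    set x := rowElt n (r - 1) l
    set d := cycDec n (arc (r : ZMod n) L)
    rw [sub_add_cancel] at ih1
    have hmono : ∀ y z, r ≤ y → y < z → z < r + n → perm x y < perm x z := fun y z h1 h2 h3 =>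
      lt_of_forall_lt_add_one (b := r - 1 + n) ih1 h1 h2 (by omega)
    have e1 : ∀ t : ℕ, t < L → perm (x * d) (r + t + 1) = perm x (r + t) := fun t ht => by
      rw [map_mul, Equiv.Perm.mul_apply, perm_cycDec_arc_add_one hL ht]
    have e2 : ∀ t : ℕ, L < t → t < n → perm (x * d) (r + t) = perm x (r + t) := fun t ht hn => by
      rw [map_mul, Equiv.Perm.mul_apply, perm_cycDec_arc_of_lt ht hn]
    have e3 : perm (x * d) (r + n) = perm x (r + L) + n := by
      rw [perm_add, map_mul, Equiv.Perm.mul_apply, perm_cycDec_arc_self hL]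
    have e4 : r - 1 + (n : ℤ) = r + ((n - 1 : ℕ) : ℤ) := by
      rw [Nat.cast_sub (by omega)]; push_cast; ring
    constructor
    · intro y hy hyn
      obtain ⟨t, rfl⟩ : ∃ t : ℕ, y = r + t + 1 := ⟨(y - r - 1).toNat, by omega⟩
      have e5 : r + (t : ℤ) + 1 = r + ((t + 1 : ℕ) : ℤ) := by push_cast; ring
      rcases lt_or_ge t L with ht | ht
      · rw [e1 t ht]
        rcases lt_or_ge (t + 1) L with ht' | ht'
        · rw [e5, e1 _ ht']
          exact hmono _ _ (by omega) (by omega) (by omega)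
        · rcases lt_or_ge (t + 2) n with h | h
          · have e6 : r + (t : ℤ) + 1 + 1 = r + ((t + 2 : ℕ) : ℤ) := by push_cast; ring
            rw [e6, e2 _ (by omega) h]
            exact hmono _ _ (by omega) (by omega) (by omega)
          · have e6 : r + (t : ℤ) + 1 + 1 = r + n := by omega
            rw [e6, e3]
            have := hmono (r + t) (r + L) (by omega) (by omega) (by omega)
            omega
      · rw [e5, e2 (t + 1) (by omega) (by omega)]
        rcases lt_or_ge (t + 2) n with h | h
        · have e6 : r + ((t + 1 : ℕ) : ℤ) + 1 = r + ((t + 2 : ℕ) : ℤ) := by push_cast; ring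
          rw [e6, e2 _ (by omega) h]
          exact hmono _ _ (by omega) (by omega) (by omega)
        · have e6 : r + ((t + 1 : ℕ) : ℤ) + 1 = r + n := by omega
          rw [e6, e3]
          have e7 : r - 1 + (n : ℤ) = r + ((t + 1 : ℕ) : ℤ) := by omega
          have e8 : r - 1 + (L : ℤ) + 1 = r + L := by ring
          rwa [e7, e8] at ih2'
    · intro K hK hKn
      have hLK := hK L (by simp)
      rw [e3, add_lt_add_iff_right]
      have e5 : r + (K : ℤ) + 1 = r + ((K + 1 : ℕ) : ℤ) := by push_cast; ring
      rcases lt_or_ge (K + 1) n with h | h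
      · rw [e5, e2 _ (by omega) h]
        exact hmono _ _ (by omega) (by omega) (by omega)
      · have e6 : r + (K : ℤ) + 1 = r + n := by omega
        rw [e6, e3]
        omega

/-- Periodicity moves y into the window r < y < r + n, where `perm_rowElt` applies. -/
theorem grassAt_rowElt {l : List ℕ} (hl : l.Pairwise (· ≥ ·)) (hln : ∀ k ∈ l, k < n) (r : ℤ) :
    GrassAt (r : ZMod n) (rowElt n r l) := by
  intro y hy
  obtain ⟨ih1, -⟩ := perm_rowElt hl hln r
  have key : ∀ (w : AffSym n) (z q : ℤ), perm w (z + q * n) = perm w z + q * n := by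
    intro w z q
    induction q using Int.induction_on with
    | zero => simp
    | succ q ih => rw [add_mul, ← add_assoc, one_mul, perm_add, ih]; ring
    | pred q ih =>
      have := perm_add w (z + (-(q : ℤ) - 1) * n)
      rw [show z + (-(q : ℤ) - 1) * n + n = z + -(q : ℤ) * n by ring, ih] at this
      linarith
  have hn : (0 : ℤ) < n := by have := NeZero.pos n; exact_mod_cast this
  have h0 := Int.emod_nonneg (y - r) hn.ne'
  have h1 := Int.emod_lt_of_pos (y - r) hn
  have h2 := Int.mul_ediv_add_emod (y - r) n
  have h3 : (y - r) % n ≠ 0 := by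
    intro h
    apply hy
    rw [ZMod.intCast_eq_intCast_iff_dvd_sub]
    rw [← dvd_neg, neg_sub]
    exact Int.dvd_of_emod_eq_zero h
  have e : y = (r + (y - r) % n) + ((y - r) / n) * n := by linarith
  generalize hq : (y - r) / n = q at e
  generalize hs : (y - r) % n = s at e h0 h1 h3
  rw [e, add_right_comm _ _ 1, key, key, add_lt_add_iff_right]
  exact ih1 _ (by omega) (by omega)

theorem length_rowElt_cons {L : ℕ} {l : List ℕ} (hl : (L :: l).Pairwise (· ≥ ·))
    (hln : ∀ k ∈ L :: l, k < n) (r : ℤ) :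
    (cs n).length (rowElt n r (L :: l)) = (cs n).length (rowElt n (r - 1) l) + L := by
  have hL := hln L (by simp)
  refine length_mul_cycDec_arc hL fun y h1 h2 => ?_
  have := (perm_rowElt (List.pairwise_cons.1 hl).2 (fun k hk => hln k (by simp [hk])) (r - 1)).1
  exact this y (by omega) (by omega)

theorem length_rowElt {l : List ℕ} (hl : l.Pairwise (· ≥ ·)) (hln : ∀ k ∈ l, k < n) (r : ℤ) :
    (cs n).length (rowElt n r l) = l.sum := by
  induction l generalizing r with
  | nil => simp [rowElt]
  | cons L l ih =>
    rw [length_rowElt_cons hl hln, ih (List.pairwise_cons.1 hl).2 fun k hk => hln k (by simp [hk]),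
      List.sum_cons, add_comm]

open scoped Classical in
theorem GrassAt.coef_mul_ncH {r : ZMod n} {u : AffSym n} (hu : GrassAt r u) {p : ℕ} (hp : p < n)
    (a : NilAlg n) : coef u (a * ncH n p) =
      if (cs n).length (u * (cycDec n (arc r p))⁻¹) + p = (cs n).length u then
        coef (u * (cycDec n (arc r p))⁻¹) a else 0 := by
  have hmem : arc r p ∈ Finset.powersetCard p (Finset.univ : Finset (ZMod n)) := by
    simp [Finset.mem_powersetCard, card_arc hp.le]
  rw [ncH, Finset.mul_sum, map_sum, Finset.sum_eq_single_of_mem _ hmem, coef_mul_elt,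
    length_cycDec (arc_ne_univ hp), card_arc hp.le]
  intro J hJ hne
  rw [Finset.mem_powersetCard] at hJ
  rw [coef_mul_elt, if_neg]
  intro h
  have := hu.eq_arc (ne_univ_of_card_lt (by omega)) h
  rw [hJ.2] at this
  exact hne this

/-- Triangularity of the coefficients of the products of the `𝐡_i` at the elements `rowElt`. -/
theorem coef_rowElt {l μ : List ℕ} (hl : l.Pairwise (· ≥ ·)) (hln : ∀ k ∈ l, 1 ≤ k ∧ k < n)
    (hμ : ∀ k ∈ μ, 1 ≤ k ∧ k < n) (h : ¬ List.Lex (· < ·) μ l) (r : ℤ) :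
    coef (rowElt n r l) (μ.reverse.map (ncH n)).prod = if μ = l then 1 else 0 := by
  classical
  induction μ generalizing l r with
  | nil =>
    obtain rfl : l = [] := by
      rcases l with _ | ⟨L, l⟩
      · rfl
      · exact absurd List.Lex.nil h
    have := coef_elt (1 : AffSym n) 1
    have h1 : elt n (1 : AffSym n) = 1 := by
      rw [← cycDec_empty, ← ncH_zero]; simp [ncH]
    rw [h1] at this
    simpa [rowElt] using this
  | cons p μ ih =>
    have hp := hμ p (by simp)
    have hG := grassAt_rowElt hl (fun k hk => (hln k hk).2) r
    rw [List.reverse_cons, List.map_append, List.prod_append, List.map_singleton,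
      List.prod_singleton, hG.coef_mul_ncH hp.2]
    rcases l with _ | ⟨L, l⟩
    · rw [if_neg, if_neg (by simp)]
      simp only [rowElt, (cs n).length_one]
      omega
    have hL := hln L (by simp)
    have hlen := length_rowElt_cons hl (fun k hk => (hln k hk).2) r
    have hcons : rowElt n r (L :: l) = rowElt n (r - 1) l * cycDec n (arc (r : ZMod n) L) := rfl
    rw [List.cons_lex_cons_iff, not_or, not_and] at h
    -- If p > L, a nonzero coefficient would make the interval from r + L to r + p - 1 split off on
    -- the right of the row element of l, with r + L as a descent. The only possible descent there
    -- is r - 1, and L + 1 ≤ p < n separates the two residues.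
    rcases (not_lt.1 h.1).lt_or_eq with hlt | rfl
    · rw [if_neg, if_neg (fun e => hlt.ne' (List.cons.inj e).1)]
      intro hc
      obtain ⟨K, rfl⟩ : ∃ K, p = L + (K + 1) := ⟨p - L - 1, by omega⟩
      have hG' := grassAt_rowElt (List.pairwise_cons.1 hl).2
        (fun k hk => (hln k (by simp [hk])).2) (r - 1)
      have e : rowElt n (r - 1) l * (cycDec n (arc ((r : ZMod n) + (L : ZMod n)) (K + 1)))⁻¹ =
          rowElt n r (L :: l) * (cycDec n (arc (r : ZMod n) (L + (K + 1))))⁻¹ := by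
        rw [cycDec_arc_add hp.2, hcons, mul_inv_rev]
        group
      have := isRightDescent_of_cycDec (J := arc ((r : ZMod n) + (L : ZMod n)) (K + 1))
        (arc_ne_univ (by omega)) (u := rowElt n (r - 1) l)
        (by
          rw [e, length_cycDec (arc_ne_univ (by omega)), card_arc (by omega)]
          omega)
        (j := (r : ZMod n) + (L : ZMod n)) (by simpa using add_mem_arc (t := 0) (by omega)) (by
          have := add_notMem_arc (n := n) (r := (r : ZMod n) + (L : ZMod n)) (L := K + 1)
            (t := n - 1) (by omega) (by omega)
          rwa [Nat.cast_sub (by omega), ZMod.natCast_self, zero_sub, Nat.cast_one,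
            ← sub_eq_add_neg] at this)
      have := grassAt_iff.1 hG' _ this
      push_cast at this
      rw [sub_eq_add_neg, add_left_cancel_iff] at this
      have h2 : ((0 : ℕ) : ZMod n) ≠ ((L + 1 : ℕ) : ZMod n) := natCast_ne_of_lt (by omega) (by omega)
      exact h2 (by push_cast; rw [this]; simp)
    · rw [if_pos (by rw [hlen, hcons, mul_inv_cancel_right]), hcons, mul_inv_cancel_right,
        ih (List.pairwise_cons.1 hl).2 (fun k hk => hln k (by simp [hk]))
          (fun k hk => hμ k (by simp [hk])) (h.2 rfl)]
      simp

end AffNil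
end

noncomputable section

namespace AffNil

attribute [-simp] CoxeterMatrix.toCoxeterSystem_simple
set_option linter.unusedSectionVars false

variable {n : ℕ} [Fact (1 < n)] [NeZero n]

/-! ### Uniqueness of the `k`-Schur functions -/

theorem monomialParts_injective : Function.Injective (monomialParts n) := by
  intro a b h
  rw [monomialParts_eq, monomialParts_eq] at h
  have h1 := congrArg (fun l : List ℕ => (l : Multiset ℕ)) h
  simp only [Multiset.sort_eq] at h1
  have h2 := Multiset.map_injective (f := fun i : Fin (n - 1) => (i : ℕ) + 1)
    (fun i j hij => Fin.ext (by simpa using hij)) h1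
  rw [← Finsupp.toMultiset_toFinsupp a, h2, Finsupp.toMultiset_toFinsupp]

theorem ncH_comm {a b : ℕ} (ha : a < n) (hb : b < n) : ncH n a * ncH n b = ncH n b * ncH n a :=
  toRing.injective (by rw [map_mul, map_mul]; exact ringH_comm ha hb)

/-- Let λ be the lexicographically least partition in the support of f. At the row element of λ the
other partitions contribute 0 and λ contributes 1, so the coefficient of f at λ vanishes, a
contradiction. -/
theorem eq_zero_of_coef_eq_zero {f : SymH n}
    (h : ∀ u : AffSym n, GrassAt 0 u → coef u (ncEval n f) = 0) : f = 0 := by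
  by_contra hf
  obtain ⟨a, ha, hmin⟩ := Finset.exists_min_image f.support (monomialParts n)
    (Finset.nonempty_iff_ne_empty.2 fun h => hf (MvPolynomial.support_eq_empty.1 h))
  have hs : (monomialParts n a).Pairwise (· ≥ ·) := by
    rw [monomialParts_eq]; exact Multiset.pairwise_sort _ _
  have hG := grassAt_rowElt hs (fun k hk => (mem_monomialParts hk).2) 0
  rw [Int.cast_zero] at hG
  have h1 := h _ hG
  rw [coef_ncEval, Finset.sum_eq_single_of_mem a ha] at h1
  · rw [prod_toList_map (n := n) _ (fun _ _ => ncH_comm) _ _ (List.reverse_perm _).symm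
      (fun k hk => (mem_monomialParts hk).2), coef_rowElt hs (fun k hk => mem_monomialParts hk)
      (fun k hk => mem_monomialParts hk) (lt_irrefl (monomialParts n a)), if_pos rfl, mul_one] at h1
    exact MvPolynomial.mem_support_iff.1 ha h1
  · intro b hb hne
    rw [prod_toList_map (n := n) _ (fun _ _ => ncH_comm) _ _ (List.reverse_perm _).symm
      (fun k hk => (mem_monomialParts hk).2), coef_rowElt hs (fun k hk => mem_monomialParts hk)
      (fun k hk => mem_monomialParts hk) (not_lt.2 (hmin b hb)),
      if_neg fun e => hne (monomialParts_injective e), mul_zero]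

theorem IsKSchur.unique {w : AffSym n} {f g : SymH n} (hf : IsKSchur n w f) (hg : IsKSchur n w g) :
    f = g := by
  rw [← sub_eq_zero]
  refine eq_zero_of_coef_eq_zero fun u hu => ?_
  have e : coef u (ncEval n (f - g)) = coef u (ncEval n f) - coef u (ncEval n g) := by
    let φ : NilRing n →+ ℤ := (coef u).comp (toRing (n := n)).symm.toAddEquiv.toAddMonoidHom
    have h1 : ∀ f, coef u (ncEval n f) = φ (evalHom n f) := fun f => by
      rw [← toRing_ncEval]; rfl
    rw [h1, h1, h1, map_sub, map_sub]
  rw [e, ← hallPairing_affineStanley, ← hallPairing_affineStanley]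
  have hz := isZeroGrassmannian_iff.2 hu
  by_cases h : u = w
  · rw [(hf u hz).1 h, (hg u hz).1 h, sub_self]
  · rw [(hf u hz).2 h, (hg u hz).2 h, sub_self]

/-! ### The `k`-Schur function of the ribbon -/

theorem rowElt_replicate_one {m : ℕ} (hm : m < n) :
    rowElt n (-1) (List.replicate m 1) = cycInc n (arc (-(m : ZMod n)) m) := by
  have key : ∀ (m : ℕ) (r : ℤ), m < n →
      rowElt n r (List.replicate m 1) = cycInc n (arc ((r : ZMod n) + 1 - (m : ZMod n)) m) := by
    intro m
    induction m with
    | zero => intro r _; simp [rowElt, arc_zero]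
    | succ m ih =>
      intro r hm
      rw [List.replicate_succ, rowElt, ih _ (by omega), arc_one, cycDec_singleton,
        arc_add _ m 1, arc_one, Finset.union_comm, cycInc_union (arc_ne_univ (by omega))
        (singleton_ne_univ _), cycInc_singleton]
      · push_cast
        congr 3 <;> ring
      · rw [Finset.disjoint_singleton_right]
        exact add_notMem_arc le_rfl (by omega)
      · intro j hj
        rw [Finset.mem_singleton] at hj
        subst hj
        have := add_notMem_arc (n := n) (r := (r : ZMod n) + 1 - ((m + 1 : ℕ) : ZMod n))
          (L := m) (t := m + 1) (by omega) (by omega)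
        rwa [Nat.cast_succ, ← add_assoc, ← Nat.cast_succ] at this
  rw [key m _ hm]
  congr 2
  push_cast
  ring

theorem cycInterval_eq_arc (a : ℤ) (L : ℕ) : cycInterval n a (a + L - 1) = arc (a : ZMod n) L := by
  ext j
  simp only [cycInterval, Finset.mem_image, Finset.mem_Icc, mem_arc]
  constructor
  · rintro ⟨z, hz, rfl⟩
    refine ⟨(z - a).toNat, by omega, ?_⟩
    have : ((z - a).toNat : ℤ) = z - a := by omega
    rw [← Int.cast_natCast (R := ZMod n) (z - a).toNat, this]
    push_cast; ring
  · rintro ⟨t, ht, rfl⟩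
    exact ⟨a + t, by omega, by push_cast; rfl⟩

theorem ribbonR_eq {m : ℕ} (hmn : m < n) : ribbonR m n =
    cycInc n (arc (-(m : ZMod n)) m) * cycDec n (arc 0 (n - m)) := by
  have h1 := cycInterval_eq_arc (n := n) (-(m : ℤ)) m
  have h2 := cycInterval_eq_arc (n := n) 0 (n - m)
  rw [neg_add_cancel, zero_sub] at h1
  rw [Nat.cast_sub hmn.le, zero_add, Int.cast_zero] at h2
  rw [ribbonR, h1, h2]
  push_cast
  rfl

/-- The element r_m belongs to the hook (n - m, 1, …, 1), so its length and its being 0-Grassmannian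
are instances of the general facts on row elements. -/
theorem ribbonR_eq_rowElt {m : ℕ} (hmn : m < n) :
    ribbonR m n = rowElt n 0 ((n - m) :: List.replicate m 1) := by
  rw [ribbonR_eq hmn, rowElt, ← rowElt_replicate_one hmn]
  simp

theorem ribbonParts_pairwise {m : ℕ} (hmn : m < n) :
    ((n - m) :: List.replicate m 1).Pairwise (· ≥ ·) := by
  rw [List.pairwise_cons]
  refine ⟨fun k hk => ?_, List.pairwise_replicate.2 (Or.inr le_rfl)⟩
  rw [List.eq_of_mem_replicate hk]
  omega

theorem ribbonParts_lt {m : ℕ} (hm : 0 < m) :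
    ∀ k ∈ (n - m) :: List.replicate m 1, k < n := by
  have := Fact.out (p := 1 < n)
  intro k hk
  rcases List.mem_cons.1 hk with rfl | hk
  · omega
  · rw [List.eq_of_mem_replicate hk]; exact this

theorem grassAt_ribbonR {m : ℕ} (hm : 0 < m) (hmn : m < n) : GrassAt 0 (ribbonR m n) := by
  have := grassAt_rowElt (ribbonParts_pairwise hmn) (ribbonParts_lt hm) 0
  rwa [Int.cast_zero, ← ribbonR_eq_rowElt hmn] at this

theorem length_ribbonR {m : ℕ} (hm : 0 < m) (hmn : m < n) : (cs n).length (ribbonR m n) = n := by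
  rw [ribbonR_eq_rowElt hmn, length_rowElt (ribbonParts_pairwise hmn) (ribbonParts_lt hm)]
  simp
  omega

end AffNil
end

/-! ### Coefficients of 𝐞_m 𝐡_{n-m} at Grassmannian elements -/

noncomputable section

namespace AffNil

attribute [-simp] CoxeterMatrix.toCoxeterSystem_simple
set_option linter.unusedSectionVars false

variable {n : ℕ} [Fact (1 < n)] [NeZero n]

theorem compl_arc {r : ZMod n} {L : ℕ} (hL : L ≤ n) :
    (arc r L)ᶜ = arc (r + (L : ZMod n)) (n - L) := by
  refine (Finset.eq_of_subset_of_card_le ?_ ?_).symm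
  · intro j hj
    obtain ⟨t, ht, rfl⟩ := mem_arc.1 hj
    rw [Finset.mem_compl, add_assoc, ← Nat.cast_add]
    exact add_notMem_arc (by omega) (by omega)
  · rw [Finset.card_compl, card_arc hL, card_arc (by omega), ZMod.card]

theorem ribbonR_eq_compl {m : ℕ} (hmn : m < n) : ribbonR m n =
    cycInc n (arc (0 : ZMod n) (n - m))ᶜ * cycDec n (arc 0 (n - m)) := by
  rw [ribbonR_eq hmn, compl_arc (by omega), Nat.sub_sub_self hmn.le, Nat.cast_sub hmn.le,
    ZMod.natCast_self, zero_sub, zero_add]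

/-- The cut after y + 1 bounds the value by y + 1, and that value is already taken at y. -/
theorem perm_cycInc_add_one_le {I : Finset (ZMod n)} (hI : I ≠ Finset.univ) {y : ℤ}
    (hy : (y : ZMod n) ∈ I) (hy' : (y : ZMod n) + 1 ∉ I) : perm (cycInc n I) (y + 1) ≤ y := by
  have h1 := perm_cycInc hI hy
  have h2 : perm (cycInc n I) (y + 1) ≤ y + 1 := by
    obtain ⟨ω, h3, h4⟩ := exists_isCycIncWord hI
    rw [cycInc_eq h3 h4]
    exact (perm_wordProd_of_notMem (ω := ω) (x := y + 1) (by
      rw [h4]; push_cast; exact hy')).1 _ le_rfl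
  have h3 : perm (cycInc n I) (y + 1) ≠ y + 1 := fun h => by
    simpa using (perm (cycInc n I)).injective (h.trans h1.symm)
  omega

/-- The point is that I, seen in {0, …, n - 1}, is closed upwards; its complement is then an
interval starting at 0, of the right size. If t ∈ I and t + 1 ∉ I, then u_I takes the value t + 1 at
t and at most t at t + 1. Such a drop contradicts the increase of the product on 1, …, n, its length
n, or the size of I. -/
theorem eq_compl_arc_of_grassAt {m : ℕ} (hm : 0 < m) (hmn : m < n) {I : Finset (ZMod n)}
    (hI : I.card = m) (hG : GrassAt 0 (cycInc n I * cycDec n (arc 0 (n - m))))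
    (hlen : (cs n).length (cycInc n I * cycDec n (arc 0 (n - m))) = n) :
    I = (arc 0 (n - m))ᶜ := by
  have hIu : I ≠ Finset.univ := ne_univ_of_card_lt (by omega)
  obtain ⟨L, hL0, hLn, hmL⟩ : ∃ L, 0 < L ∧ L < n ∧ m = n - L := ⟨n - m, by omega, by omega, by omega⟩
  have hL : n - m = L := by omega
  rw [hL] at hG hlen ⊢
  set x := cycInc n I
  set d := cycDec n (arc (0 : ZMod n) L)
  have e1 : ∀ t : ℕ, t < L → perm (x * d) (t + 1) = perm x t := fun t ht => by
    have := perm_cycDec_arc_add_one (r := 0) hLn ht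
    rw [zero_add, Int.cast_zero] at this
    rw [map_mul, Equiv.Perm.mul_apply, this]
  have e2 : ∀ t : ℕ, L < t → t < n → perm (x * d) t = perm x t := fun t ht hn => by
    have := perm_cycDec_arc_of_lt (r := 0) ht hn
    rw [zero_add, Int.cast_zero] at this
    rw [map_mul, Equiv.Perm.mul_apply, this]
  have hw : ∀ t : ℕ, 0 < t → t < n → perm (x * d) t < perm (x * d) (t + 1) := fun t h0 h1 => by
    refine hG t ?_
    push_cast
    have := natCast_ne_of_lt (n := n) (a := 0) (b := t) h0 (by omega)
    rw [Nat.cast_zero] at this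
    exact this.symm
  have hx : ∀ t : ℕ, (t : ZMod n) ∈ I → ((t + 1 : ℕ) : ZMod n) ∉ I →
      perm x (t + 1) ≤ t ∧ perm x t = t + 1 := fun t h h' =>
    ⟨perm_cycInc_add_one_le hIu (by push_cast; exact h) (by push_cast at h' ⊢; exact h'),
      perm_cycInc hIu (by push_cast; exact h)⟩
  have hA : ∀ t : ℕ, t < L → (t : ZMod n) ∈ I → ((t + 1 : ℕ) : ZMod n) ∈ I := by
    intro t ht h
    by_contra h'
    obtain ⟨h1, h2⟩ := hx t h h'
    rcases lt_or_ge (t + 1) L with ht' | ht'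
    · have h3 := hw (t + 1) (by omega) (by omega)
      have h4 := e1 (t + 1) ht'
      push_cast at h3 h4
      rw [e1 t ht, h4] at h3
      omega
    -- Here the values of x at L - 1 and L are no longer adjacent in the window. Instead s_t cancels
    -- between u_I and d, so the product is shorter than n.
    · obtain rfl : L = t + 1 := by omega
      have hdesc : (cs n).IsRightDescent x (t : ZMod n) := by
        have := isRightDescent_iff_perm x t
        rw [Int.cast_natCast] at this
        rw [this]
        omega
      unfold CoxeterSystem.IsRightDescent at hdesc
      have h5 : x * d = x * (cs n).simple (t : ZMod n) * cycDec n (arc 0 t) := by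
        rw [mul_assoc, ← zero_add (t : ZMod n), ← cycDec_arc_succ' hLn]
      have h6 := (cs n).length_mul_le (x * (cs n).simple (t : ZMod n)) (cycDec n (arc 0 t))
      rw [← h5, length_cycDec (arc_ne_univ (by omega)), card_arc (by omega)] at h6
      rw [length_cycInc hIu] at hdesc
      omega
  have hA' : ∀ t : ℕ, t ≤ L → ∀ s : ℕ, s ≤ t → (s : ZMod n) ∈ I → (t : ZMod n) ∈ I := by
    intro t ht s hs hsI
    induction t, hs using Nat.le_induction with
    | base => exact hsI
    | succ t _ ih => exact hA t (by omega) (ih (by omega))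
  have hB : ∀ t : ℕ, t + 1 < n → (t : ZMod n) ∈ I → ((t + 1 : ℕ) : ZMod n) ∈ I := by
    intro t ht h
    rcases lt_trichotomy t L with htL | rfl | htL
    · exact hA t htL h
    -- For t = L the value x(L) has left the window and x(L - 1) is followed by x(L + 1) ≤ L. If L -
    -- 1 ∈ I, then x(L - 1) = L, a contradiction. Otherwise I misses 0, …, L - 1 and L + 1, which
    -- leaves fewer than n - L elements.
    · by_contra h'
      obtain ⟨h1, h2⟩ := hx t h h'
      by_cases hL1 : ((t - 1 : ℕ) : ZMod n) ∈ I
      · have h3 : perm x ((t - 1 : ℕ) : ℤ) = ((t - 1 : ℕ) : ℤ) + 1 :=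
          perm_cycInc hIu (by push_cast; exact hL1)
        have h4 := e1 (t - 1) (by omega)
        have h5 := hw t (by omega) (by omega)
        have h6 := e2 (t + 1) (by omega) (by omega)
        have h7 : ((t - 1 : ℕ) : ℤ) + 1 = t := by omega
        push_cast at h6
        rw [h7] at h4 h3
        rw [h4, h6] at h5
        have h8 : perm x (t + 1) ≠ t := by
          intro he
          have := (perm x).injective (he.trans h3.symm)
          omega
        omega
      · have hsub : I ⊆ insert (t : ZMod n) (arc ((t + 2 : ℕ) : ZMod n) (n - (t + 2))) := by
          intro j hj
          have hj1 := ZMod.val_lt j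
          have hj2 := ZMod.natCast_zmod_val j
          rw [Finset.mem_insert, mem_arc]
          by_contra hc
          rw [not_or] at hc
          rcases lt_trichotomy j.val t with hlt | heq | hlt
          · exact hL1 (hA' (t - 1) (by omega) j.val (by omega) (by rwa [hj2]))
          · exact hc.1 (by rw [← heq, hj2])
          · rcases Nat.lt_or_ge j.val (t + 2) with h9 | h9
            · apply h'
              rw [show t + 1 = j.val by omega, hj2]
              exact hj
            · refine hc.2 ⟨j.val - (t + 2), by omega, ?_⟩
              rw [← Nat.cast_add, Nat.add_sub_cancel' h9, hj2]
        have := (Finset.card_le_card hsub).trans (Finset.card_insert_le _ _)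
        rw [card_arc (by omega)] at this
        omega
    · by_contra h'
      obtain ⟨h1, h2⟩ := hx t h h'
      have h3 := hw t (by omega) (by omega)
      have h4 := e2 (t + 1) (by omega) ht
      push_cast at h4
      rw [e2 t htL (by omega), h4] at h3
      omega
  have hc : Iᶜ = arc 0 Iᶜ.card := by
    refine eq_arc ?_ ?_
    · rw [Ne, Finset.compl_eq_univ_iff, ← Finset.card_eq_zero]
      omega
    · intro j hj hj'
      rw [Finset.mem_compl] at hj
      rw [Finset.mem_compl, not_not] at hj'
      by_contra h0
      have h1 := ZMod.val_lt (j - 1)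
      have h2 := ZMod.natCast_zmod_val (j - 1)
      rcases Nat.lt_or_ge ((j - 1).val + 1) n with h3 | h3
      · have := hB _ h3 (by rwa [h2])
        rw [Nat.cast_succ, h2, sub_add_cancel] at this
        exact hj this
      · apply h0
        rw [← sub_add_cancel j 1, ← h2, ← Nat.cast_succ, Nat.succ_eq_add_one,
          show (j - 1).val + 1 = n by omega, ZMod.natCast_self]
  rw [Finset.card_compl, ZMod.card, show n - I.card = L by omega] at hc
  rw [← hc, compl_compl]

theorem cycInc_injective {I J : Finset (ZMod n)} (hI : I ≠ Finset.univ) (hJ : J ≠ Finset.univ)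
    (h : cycInc n I = cycInc n J) : I = J := by
  rw [cycInc_eq_inv hI, cycInc_eq_inv hJ] at h
  exact cycDec_injective hI hJ (inv_injective h)

/-- The Grassmannian condition first fixes the factor d_J as an interval, and then
`eq_compl_arc_of_grassAt` leaves one choice for u_I. -/
theorem coef_ncE_mul_ncH {m : ℕ} (hm : 0 < m) (hmn : m < n) {u : AffSym n} (hu : GrassAt 0 u) :
    (u = ribbonR m n → coef u (ncE n m * ncH n (n - m)) = 1) ∧
    (u ≠ ribbonR m n → coef u (ncE n m * ncH n (n - m)) = 0) := by
  classical
  set d := cycDec n (arc (0 : ZMod n) (n - m)) with hd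
  have hcard : ((arc (0 : ZMod n) (n - m))ᶜ).card = m := by
    rw [Finset.card_compl, ZMod.card, card_arc (by omega)]; omega
  rw [hu.coef_mul_ncH (by omega), ← hd, ncE, map_sum]
  constructor
  · rintro rfl
    have h1 : ribbonR m n * d⁻¹ = cycInc n (arc (0 : ZMod n) (n - m))ᶜ := by
      rw [ribbonR_eq_compl hmn, mul_inv_cancel_right]
    have h2 : (arc (0 : ZMod n) (n - m))ᶜ ≠ Finset.univ := ne_univ_of_card_lt (by omega)
    rw [h1, if_pos (by rw [length_cycInc h2, hcard, length_ribbonR hm hmn]; omega),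
      Finset.sum_eq_single_of_mem (arc (0 : ZMod n) (n - m))ᶜ (by simp [hcard]), coef_elt,
      if_pos rfl]
    intro I hI hne
    rw [Finset.mem_powersetCard] at hI
    rw [coef_elt, if_neg]
    exact fun h => hne (cycInc_injective (ne_univ_of_card_lt (by omega)) h2 h)
  · intro hne
    split_ifs with hlen
    · refine Finset.sum_eq_zero fun I hI => ?_
      rw [Finset.mem_powersetCard] at hI
      rw [coef_elt, if_neg]
      intro h
      have h3 : u = cycInc n I * d := by rw [h, inv_mul_cancel_right]
      have hIu : I ≠ Finset.univ := ne_univ_of_card_lt (by omega)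
      rw [← h, length_cycInc hIu] at hlen
      have := eq_compl_arc_of_grassAt hm hmn hI.2 (by rwa [← hd, ← h3]) (by
        rw [← hd, ← h3]; omega)
      rw [ribbonR_eq_compl hmn, ← this] at hne
      exact hne h3
    · rfl

/-- The preimage of 𝐞_m 𝐡_{n-m} in ℤ[h_1, …, h_{n-1}] satisfies the defining duality, and by
uniqueness it is the chosen k-Schur function. -/
theorem ncKSchur_ribbonR {m : ℕ} (hm : 0 < m) (hmn : m < n) :
    ncKSchur n (ribbonR m n) = ncE n m * ncH n (n - m) := by
  obtain ⟨f, hf⟩ := exists_evalHom_eq_ringE (n := n) hmn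
  obtain ⟨g, hg⟩ := exists_evalHom_eq_ringH (n := n) (j := n - m) (by omega)
  have h : ncEval n (f * g) = ncE n m * ncH n (n - m) := by
    apply toRing.injective
    rw [toRing_ncEval, map_mul, hf, hg, map_mul]
  have hK : IsKSchur n (ribbonR m n) (f * g) := by
    intro u hu
    rw [hallPairing_affineStanley, h]
    exact coef_ncE_mul_ncH hm hmn (isZeroGrassmannian_iff.1 hu)
  rw [ncKSchur, ← h]
  congr 1
  exact (Classical.epsilon_spec (p := IsKSchur n (ribbonR m n)) ⟨_, hK⟩).unique hK

end AffNil
end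

noncomputable section

namespace AffNil

attribute [-simp] CoxeterMatrix.toCoxeterSystem_simple
set_option linter.unusedSectionVars false

variable {n : ℕ} [Fact (1 < n)] [NeZero n]

/-! ### Products in the quotient algebra -/

theorem proj_eq_zero {m : ℕ} {a : NilAlg n} (h : QuotRel m n a 0) : proj m n a = 0 := by
  rw [proj, RingQuot.mkRingHom_rel h, map_zero]

theorem erase_ne_univ (J : Finset (ZMod n)) (j : ZMod n) : J.erase j ≠ Finset.univ := fun h => by
  have := Finset.mem_univ j
  rw [← h] at this
  simp at this

theorem elt_cycDec_of_add_one_notMem {J : Finset (ZMod n)} {j : ZMod n}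
    (hj : j ∈ J) (hj' : j + 1 ∉ J) :
    elt n (cycDec n J) = gen n j * elt n (cycDec n (J.erase j)) := by
  rw [← elt_cycDec_insert_left (erase_ne_univ J j) (by simp)
    (fun h => hj' (Finset.mem_of_mem_erase h)), Finset.insert_erase hj]

theorem elt_cycInc_of_add_one_notMem {J : Finset (ZMod n)} {j : ZMod n}
    (hj : j ∈ J) (hj' : j + 1 ∉ J) :
    elt n (cycInc n J) = elt n (cycInc n (J.erase j)) * gen n j := by
  rw [← elt_cycInc_insert_right (erase_ne_univ J j) (by simp)
    (fun h => hj' (Finset.mem_of_mem_erase h)), Finset.insert_erase hj]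

/-- Letters j of J with j + 1 ∉ J are peeled off on the left. They commute with A_i until j = i + 1,
and then i can come next, so that the product begins with A_i A_{i+1} A_i = 0. -/
theorem proj_gen_mul_cycDec (m : ℕ) {J : Finset (ZMod n)} (hJ : J ≠ Finset.univ) {i : ZMod n}
    (hi : i ∈ J) (hi' : i + 1 ∈ J) : proj m n (gen n i * elt n (cycDec n J)) = 0 := by
  induction hc : J.card generalizing J with
  | zero => simp [Finset.card_eq_zero.1 hc] at hi
  | succ c ih =>
    obtain ⟨j, hj, hj'⟩ := exists_add_one_notMem ⟨i, hi⟩ hJ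
    have hne : i ≠ j := by rintro rfl; exact hj' hi'
    rw [elt_cycDec_of_add_one_notMem hj hj']
    by_cases h : j = i + 1
    · subst h
      rw [elt_cycDec_of_add_one_notMem (J := J.erase (i + 1)) (j := i) (by simp [hi]) (by simp),
        ← mul_assoc, ← mul_assoc, map_mul, proj_eq_zero (QuotRel.up i), zero_mul]
    · rw [← mul_assoc, gen_comm (fun e => hj' (by rwa [← e])) h, mul_assoc, map_mul,
        ih (erase_ne_univ J j) (by simp [hi, hne]) (by simp [hi', Ne.symm h])
        (by rw [Finset.card_erase_of_mem hj, hc]; rfl), mul_zero]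

theorem proj_cycInc_mul_gen (m : ℕ) {J : Finset (ZMod n)} (hJ : J ≠ Finset.univ) {i : ZMod n}
    (hi : i ∈ J) (hi' : i + 1 ∈ J) : proj m n (elt n (cycInc n J) * gen n i) = 0 := by
  induction hc : J.card generalizing J with
  | zero => simp [Finset.card_eq_zero.1 hc] at hi
  | succ c ih =>
    obtain ⟨j, hj, hj'⟩ := exists_add_one_notMem ⟨i, hi⟩ hJ
    have hne : i ≠ j := by rintro rfl; exact hj' hi'
    rw [elt_cycInc_of_add_one_notMem hj hj']
    by_cases h : j = i + 1
    · subst h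
      rw [elt_cycInc_of_add_one_notMem (J := J.erase (i + 1)) (j := i) (by simp [hi]) (by simp),
        mul_assoc, mul_assoc, map_mul, ← mul_assoc, proj_eq_zero (QuotRel.up i), mul_zero]
    · rw [mul_assoc, ← gen_comm (fun e => hj' (by rwa [← e])) h, ← mul_assoc, map_mul,
        ih (erase_ne_univ J j) (by simp [hi, hne]) (by simp [hi', Ne.symm h])
        (by rw [Finset.card_erase_of_mem hj, hc]; rfl), zero_mul]

/-- Take i ∈ I ∩ J with i + 1 ∉ I ∩ J. If i + 1 ∉ J, a letter i can be brought to the left end of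
d_J; if i + 1 ∉ I, one can be brought to the right end of u_I. The two factors i meet in A_i² or in
a vanishing braid word. -/
theorem proj_cycInc_mul_cycDec_of_inter (m : ℕ) {I J : Finset (ZMod n)} (hI : I ≠ Finset.univ)
    (hJ : J ≠ Finset.univ) (h : (I ∩ J).Nonempty) :
    proj m n (elt n (cycInc n I) * elt n (cycDec n J)) = 0 := by
  obtain ⟨i, hi, hi'⟩ := exists_add_one_notMem h fun e => hI
    (Finset.univ_subset_iff.1 (e ▸ Finset.inter_subset_left))
  rw [Finset.mem_inter] at hi hi'
  by_cases h1 : i + 1 ∈ I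
  · rw [elt_cycDec_of_add_one_notMem hi.2 (fun h2 => hi' ⟨h1, h2⟩), ← mul_assoc, map_mul,
      proj_cycInc_mul_gen m hI hi.1 h1, zero_mul]
  · rw [elt_cycInc_of_add_one_notMem hi.1 h1, mul_assoc, map_mul]
    by_cases h2 : i + 1 ∈ J
    · rw [proj_gen_mul_cycDec m hJ hi.2 h2, mul_zero]
    · rw [elt_cycDec_of_add_one_notMem hi.2 h2, ← mul_assoc (gen n i), gen_sq, zero_mul, map_zero,
        mul_zero]

/-- The letters of the two factors are complementary, so the concatenated word has no repetition and
is reduced. -/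
theorem length_ribbon {J : Finset (ZMod n)} (hJ : J.Nonempty) (hJ' : J ≠ Finset.univ) :
    (cs n).length (cycInc n Jᶜ * cycDec n J) = Jᶜ.card + J.card := by
  have hc : Jᶜ ≠ Finset.univ := by
    rw [Ne, Finset.compl_eq_univ_iff]; exact hJ.ne_empty
  obtain ⟨ω, h1, h2⟩ := exists_isCycIncWord hc
  obtain ⟨ω', h3, h4⟩ := exists_isCycDecWord hJ'
  have hd : (ω ++ ω').Nodup := by
    rw [List.nodup_append]
    refine ⟨h1.1, h3.1, fun a ha b hb => ?_⟩
    rintro rfl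
    exact Finset.mem_compl.1 ((h2 a).1 ha) ((h4 a).1 hb)
  have hr := isReduced_of_nodup hd
  rw [cycInc_eq h1 h2, cycDec_eq h3 h4, ← (cs n).wordProd_append, hr.eq, List.length_append,
    ← (isReduced_of_nodup h1.1).eq, ← (isReduced_of_nodup h3.1).eq, ← cycInc_eq h1 h2,
    ← cycDec_eq h3 h4, length_cycInc hc, length_cycDec hJ']

theorem elt_ribbon {J : Finset (ZMod n)} (hJ : J.Nonempty) (hJ' : J ≠ Finset.univ) :
    elt n (cycInc n Jᶜ * cycDec n J) = elt n (cycInc n Jᶜ) * elt n (cycDec n J) := by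
  refine (elt_mul_elt_of_length ?_).symm
  rw [length_ribbon hJ hJ', length_cycDec hJ', length_cycInc]
  rw [Ne, Finset.compl_eq_univ_iff]; exact hJ.ne_empty

/-- Only pairs of disjoint sets survive, and since |I| + |J| = n these are the pairs (Jᶜ, J). -/
theorem sum_proj_ribbon {m : ℕ} (hm : 0 < m) (hmn : m < n) :
    ∑ J ∈ Finset.powersetCard (n - m) (Finset.univ : Finset (ZMod n)),
      proj m n (elt n (cycInc n Jᶜ * cycDec n J)) = proj m n (ncE n m) * proj m n (ncH n (n - m)) := by
  rw [← map_mul, ncH, Finset.mul_sum, map_sum]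
  refine Finset.sum_congr rfl fun J hJ => ?_
  rw [Finset.mem_powersetCard] at hJ
  have hJu : J ≠ Finset.univ := ne_univ_of_card_lt (by omega)
  have hcard : Jᶜ.card = m := by rw [Finset.card_compl, ZMod.card]; omega
  rw [elt_ribbon (Finset.card_pos.1 (by omega)) hJu, ncE, Finset.sum_mul, map_sum,
    Finset.sum_eq_single_of_mem Jᶜ (by simp [hcard])]
  intro I hI hne
  rw [Finset.mem_powersetCard] at hI
  refine proj_cycInc_mul_cycDec_of_inter m (ne_univ_of_card_lt (by omega)) hJu ?_
  by_contra hc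
  rw [Finset.not_nonempty_iff_eq_empty, ← Finset.disjoint_iff_inter_eq_empty] at hc
  refine hne (Finset.eq_of_subset_of_card_le ?_ (by omega))
  exact fun i hi => Finset.mem_compl.2 (Finset.disjoint_left.1 hc hi)

/-- The Grassmannian condition makes J an interval starting at 0. The relations on long decreasing
and increasing elements bound |J| by n - m and |Jᶜ| by m, hence |J| = n - m. -/
theorem eq_ribbonR_of_isRibbon {m : ℕ} (hmn : m < n) {w : AffSym n} (hw : IsRibbon n w)
    (hG : GrassAt 0 w) (h0 : proj m n (elt n w) ≠ 0) : w = ribbonR m n := by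
  obtain ⟨J, hJ, hJ', rfl⟩ := hw
  have hc : Jᶜ ≠ Finset.univ := by
    rw [Ne, Finset.compl_eq_univ_iff]; exact hJ.ne_empty
  have harc := hG.eq_arc hJ' (by
    rw [mul_inv_cancel_right, length_ribbon hJ hJ', length_cycInc hc, length_cycDec hJ'])
  rw [elt_ribbon hJ hJ', map_mul] at h0
  have hle : J.card ≤ n - m := by
    by_contra hlt
    apply h0
    rw [proj_eq_zero (QuotRel.dec (cycDec n J) ⟨J, hJ', rfl⟩ (by rw [length_cycDec hJ']; omega)),
      mul_zero]
  have hle' : Jᶜ.card ≤ m := by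
    by_contra hlt
    apply h0
    rw [proj_eq_zero (QuotRel.inc (cycInc n Jᶜ) ⟨Jᶜ, hc, rfl⟩ (by rw [length_cycInc hc]; omega)),
      zero_mul]
  rw [Finset.card_compl, ZMod.card] at hle'
  have : J.card = n - m := by omega
  rw [this] at harc
  rw [ribbonR_eq_compl hmn, ← harc]

theorem isRibbon_ribbonR {m : ℕ} (hm : 0 < m) (hmn : m < n) : IsRibbon n (ribbonR m n) :=
  ⟨arc 0 (n - m), Finset.card_pos.1 (by rw [card_arc (by omega)]; omega), arc_ne_univ (by omega),
    ribbonR_eq_compl hmn⟩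

end AffNil
end

noncomputable section

namespace AffNil

attribute [-simp] CoxeterMatrix.toCoxeterSystem_simple
set_option linter.unusedSectionVars false

variable {n : ℕ} [Fact (1 < n)] [NeZero n]

/-! ### A representation of the quotient algebra on particle configurations -/

theorem IsCycIncWord.tail {a : ZMod n} {ω : List (ZMod n)} (h : IsCycIncWord n (a :: ω)) :
    IsCycIncWord n ω := by
  obtain ⟨h1, h2⟩ := h
  rw [List.nodup_cons] at h1
  refine ⟨h1.2, fun i hi hi' => ?_⟩
  have := h2 i (by simp [hi]) (by simp [hi'])
  rw [List.sublist_cons_iff] at this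
  rcases this with h | ⟨r, hr, -⟩
  · exact h
  · rw [List.cons.injEq] at hr
    exact absurd (hr.1 ▸ hi) h1.1

theorem IsCycIncWord.sub_one_head_notMem {a : ZMod n} {ω : List (ZMod n)}
    (h : IsCycIncWord n (a :: ω)) : a - 1 ∉ a :: ω := by
  intro ha
  have h1 := h.1
  have := h.2 (a - 1) ha (by simp)
  rw [sub_add_cancel, List.sublist_cons_iff] at this
  rw [List.nodup_cons] at h1
  rcases this with h | ⟨r, hr, -⟩
  · exact h1.1 (h.subset (by simp))
  · rw [List.cons.injEq] at hr
    simp at hr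

/-- A configuration: the set of occupied sites and the number of steps made so far. -/
abbrev Config (n : ℕ) : Type := Finset (ZMod n) × ℕ

/-- The particle at `i` moves to the vacant site `i + 1`. The configurations with exactly `m`
particles are considered only, and at most `n` steps are allowed. -/
def hop (m : ℕ) (i : ZMod n) (s : Config n) : Option (Config n) :=
  if i ∈ s.1 ∧ i + 1 ∉ s.1 ∧ s.1.card = m ∧ s.2 < n then
    some (insert (i + 1) (s.1.erase i), s.2 + 1) else none

theorem hop_eq_some_iff {m : ℕ} {i : ZMod n} {s t : Config n} : hop m i s = some t ↔
    (i ∈ s.1 ∧ i + 1 ∉ s.1 ∧ s.1.card = m ∧ s.2 < n) ∧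
      (insert (i + 1) (s.1.erase i), s.2 + 1) = t := by
  unfold hop
  split_ifs with h <;> simp [h]

theorem card_hop {m : ℕ} {i : ZMod n} {s t : Config n} (h : hop m i s = some t) :
    t.1.card = m := by
  obtain ⟨⟨h1, h2, h3, -⟩, rfl⟩ := hop_eq_some_iff.1 h
  rw [Finset.card_insert_of_notMem (fun h => h2 (Finset.mem_of_mem_erase h)),
    Finset.card_erase_add_one h1, h3]

theorem hop_hop_self (m : ℕ) (i : ZMod n) (s : Config n) : (hop m i s).bind (hop m i) = none := by
  rw [Option.eq_none_iff_forall_ne_some]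
  intro t ht
  obtain ⟨u, h1, h2⟩ := Option.bind_eq_some_iff.1 ht
  obtain ⟨-, rfl⟩ := hop_eq_some_iff.1 h1
  have := (hop_eq_some_iff.1 h2).1.1
  simp at this

theorem hop_hop_comm (m : ℕ) {i j : ZMod n} (h₁ : i ≠ j + 1) (h₂ : j ≠ i + 1) (s : Config n) :
    (hop m i s).bind (hop m j) = (hop m j s).bind (hop m i) := by
  rcases eq_or_ne i j with rfl | hij
  · rfl
  have key : ∀ {i j : ZMod n}, i ≠ j → i ≠ j + 1 → j ≠ i + 1 → ∀ t,
      (hop m i s).bind (hop m j) = some t → (hop m j s).bind (hop m i) = some t := by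
    intro i j hij h₁ h₂ t ht
    obtain ⟨u, h3, h4⟩ := Option.bind_eq_some_iff.1 ht
    have hc := card_hop h3
    obtain ⟨⟨h5, h6, h7, h8⟩, rfl⟩ := hop_eq_some_iff.1 h3
    obtain ⟨⟨h9, h10, -, h11⟩, rfl⟩ := hop_eq_some_iff.1 h4
    have hij' : i + 1 ≠ j + 1 := fun h => hij (add_right_cancel h)
    simp only [Finset.mem_insert, Finset.mem_erase, h₂, hij.symm, hij'.symm, h₁.symm, ne_eq,
      not_false_eq_true, true_and, false_or] at h9 h10
    have h12 : hop m j s = some (insert (j + 1) (s.1.erase j), s.2 + 1) :=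
      hop_eq_some_iff.2 ⟨⟨h9, h10, h7, h8⟩, rfl⟩
    have hc' := card_hop h12
    rw [h12, Option.bind_some, hop_eq_some_iff]
    refine ⟨⟨?_, ?_, hc', h11⟩, ?_⟩
    · simp [h5, hij]
    · simp [h6, hij', h₂.symm]
    · refine Prod.ext ?_ rfl
      ext x
      simp only [Finset.mem_insert, Finset.mem_erase]
      by_cases e1 : x = i + 1 <;> by_cases e2 : x = j + 1 <;> by_cases e3 : x = i <;>
        by_cases e4 : x = j <;> simp_all
  refine Option.ext fun t => ⟨key hij h₁ h₂ t, key hij.symm h₂ h₁ t⟩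

/-- For n > 2 the particle has moved on to i + 2 ≠ i and the site i is empty. For n = 2 it is back
at i, and only the bound on the number of steps forbids the third hop. -/
theorem hop_hop_hop_up (m : ℕ) (i : ZMod n) (s : Config n) :
    ((hop m i s).bind (hop m (i + 1))).bind (hop m i) = none := by
  rw [Option.eq_none_iff_forall_ne_some]
  intro t ht
  obtain ⟨v, h1, h2⟩ := Option.bind_eq_some_iff.1 ht
  obtain ⟨u, h3, h4⟩ := Option.bind_eq_some_iff.1 h1
  obtain ⟨⟨-, -, -, -⟩, rfl⟩ := hop_eq_some_iff.1 h3
  obtain ⟨⟨-, -, -, -⟩, rfl⟩ := hop_eq_some_iff.1 h4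
  obtain ⟨⟨h5, -, -, h6⟩, -⟩ := hop_eq_some_iff.1 h2
  rcases eq_or_ne n 2 with hn | hn
  · simp only at h6
    omega
  · have : i ≠ i + 1 + 1 := by
      rw [add_assoc]
      simpa using two_ne_zero_of_ne_two hn
    simp [this] at h5

/-- For n > 2 the first particle still sits at i + 2 and blocks the second. For n = 2 the bound on
the number of steps is needed again. -/
theorem hop_hop_hop_down (m : ℕ) (i : ZMod n) (s : Config n) :
    ((hop m (i + 1) s).bind (hop m i)).bind (hop m (i + 1)) = none := by
  rw [Option.eq_none_iff_forall_ne_some]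
  intro t ht
  obtain ⟨v, h1, h2⟩ := Option.bind_eq_some_iff.1 ht
  obtain ⟨u, h3, h4⟩ := Option.bind_eq_some_iff.1 h1
  obtain ⟨⟨-, -, -, -⟩, rfl⟩ := hop_eq_some_iff.1 h3
  obtain ⟨⟨-, -, -, -⟩, rfl⟩ := hop_eq_some_iff.1 h4
  obtain ⟨⟨-, h5, -, h6⟩, -⟩ := hop_eq_some_iff.1 h2
  rcases eq_or_ne n 2 with hn | hn
  · simp only at h6
    omega
  · have : i + 1 + 1 ≠ i := by
      rw [add_assoc]
      simpa using two_ne_zero_of_ne_two hn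
    simp [this] at h5

/-- The steps at the letters of a word, from the right to the left. -/
def run (m : ℕ) : List (ZMod n) → Config n → Option (Config n)
  | [], s => some s
  | i :: ω, s => (run m ω s).bind (hop m i)

theorem mem_iff_of_run {m : ℕ} {ω : List (ZMod n)} {s t : Config n} (h : run m ω s = some t)
    {x : ZMod n} (hx : x ∉ ω) (hx' : x - 1 ∉ ω) : x ∈ t.1 ↔ x ∈ s.1 := by
  induction ω generalizing t with
  | nil => rw [run, Option.some_inj] at h; rw [h]
  | cons a ω ih =>
    rw [run, Option.bind_eq_some_iff] at h
    obtain ⟨u, h1, h2⟩ := h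
    rw [List.mem_cons, not_or] at hx hx'
    obtain ⟨-, rfl⟩ := hop_eq_some_iff.1 h2
    rw [← ih h1 hx.2 hx'.2]
    have : x ≠ a + 1 := fun e => hx'.1 (by rw [e, add_sub_cancel_right])
    simp [hx.1, this]

theorem card_of_run {m : ℕ} {ω : List (ZMod n)} {s t : Config n} (h : run m ω s = some t)
    (hω : ω ≠ []) : s.1.card = m := by
  induction ω generalizing t with
  | nil => exact absurd rfl hω
  | cons a ω ih =>
    rw [run, Option.bind_eq_some_iff] at h
    obtain ⟨u, h1, h2⟩ := h
    rcases eq_or_ne ω [] with rfl | hne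
    · rw [run, Option.some_inj] at h1
      rw [h1]
      exact (hop_eq_some_iff.1 h2).1.2.2.1
    · exact ih h1 hne

/-- When the letter j acts, neither j nor j + 1 has acted before, so the vacancy of j + 1 goes back
to the initial configuration. -/
theorem add_one_notMem_of_run {m : ℕ} {ω : List (ZMod n)} (hω : IsCycDecWord n ω) {s t : Config n}
    (h : run m ω s = some t) : ∀ j ∈ ω, j + 1 ∉ s.1 := by
  induction ω generalizing t with
  | nil => simp
  | cons a ω ih =>
    rw [run, Option.bind_eq_some_iff] at h
    obtain ⟨u, h1, h2⟩ := h
    intro j hj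
    rcases List.mem_cons.1 hj with rfl | hj
    · have h3 := hω.head_add_one_notMem
      rw [List.mem_cons, not_or] at h3
      rw [← mem_iff_of_run h1 h3.2 (by
        rw [add_sub_cancel_right]; exact (List.nodup_cons.1 hω.1).1)]
      exact (hop_eq_some_iff.1 h2).1.2.1
    · exact ih hω.tail h1 j hj

theorem mem_of_run {m : ℕ} {ω : List (ZMod n)} (hω : IsCycIncWord n ω) {s t : Config n}
    (h : run m ω s = some t) : ∀ j ∈ ω, j ∈ s.1 := by
  induction ω generalizing t with
  | nil => simp
  | cons a ω ih =>
    rw [run, Option.bind_eq_some_iff] at h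
    obtain ⟨u, h1, h2⟩ := h
    intro j hj
    rcases List.mem_cons.1 hj with rfl | hj
    · have h3 := hω.sub_one_head_notMem
      rw [List.mem_cons, not_or] at h3
      rw [← mem_iff_of_run h1 (List.nodup_cons.1 hω.1).1 h3.2]
      exact (hop_eq_some_iff.1 h2).1.1
    · exact ih hω.tail h1 j hj

/-- Letters act from the right, so along a run i, i + 1, … of consecutive letters one particle is
carried from the start of the run to beyond its end; only the start has to be occupied. -/
theorem exists_run_of_isCycDecWord {m : ℕ} {ω : List (ZMod n)} (hω : IsCycDecWord n ω)
    {s : Config n} (hs : s.1.card = m) (hn : s.2 + ω.length ≤ n) (h1 : ∀ j ∈ ω, j + 1 ∉ s.1)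
    (h2 : ∀ j ∈ ω, j - 1 ∉ ω → j ∈ s.1) :
    ∃ t, run m ω s = some t ∧ t.1.card = m ∧ t.2 = s.2 + ω.length ∧
      ∀ x, x ∈ t.1 ↔ x ∉ ω ∧ (x - 1 ∈ ω ∨ x ∈ s.1) := by
  induction ω with
  | nil => exact ⟨s, rfl, hs, rfl, by simp⟩
  | cons a ω ih =>
    have h3 := hω.head_add_one_notMem
    have h4 := (List.nodup_cons.1 hω.1).1
    rw [List.length_cons] at hn
    obtain ⟨t, ht, hc, hl, hm⟩ := ih hω.tail (by omega) (fun j hj => h1 j (by simp [hj]))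
      (fun j hj hj' => h2 j (by simp [hj]) (by
        rw [List.mem_cons, not_or]
        refine ⟨?_, hj'⟩
        rintro rfl
        exact h3 (by simp [hj])))
    rw [List.mem_cons, not_or] at h3
    have ha : a ∈ t.1 := by
      rw [hm]
      refine ⟨h4, ?_⟩
      by_contra hne
      rw [not_or] at hne
      exact hne.2 (h2 a (by simp) (by simp [hne.1]))
    have ha' : a + 1 ∉ t.1 := by
      rw [hm, add_sub_cancel_right]
      simp [h4, h1 a]
    have hh : hop m a t = some (insert (a + 1) (t.1.erase a), t.2 + 1) :=
      hop_eq_some_iff.2 ⟨⟨ha, ha', hc, by omega⟩, rfl⟩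
    refine ⟨_, by rw [run, ht, Option.bind_some, hh], card_hop hh, ?_, fun x => ?_⟩
    · rw [List.length_cons, hl, add_assoc]
    · simp only [Finset.mem_insert, Finset.mem_erase, List.mem_cons, hm]
      by_cases e1 : x = a
      · subst e1
        simp
      · by_cases e2 : x = a + 1
        · subst e2
          simp [h3.2]
        · have e3 : x - 1 ≠ a := fun e => e2 (by rw [← e, sub_add_cancel])
          simp [e1, e2, e3]

/-- Along a run of consecutive letters the last one acts first, so a full block of particles
advances by one site each; only the site after the block has to be vacant. -/
theorem exists_run_of_isCycIncWord {m : ℕ} {ω : List (ZMod n)} (hω : IsCycIncWord n ω)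
    {s : Config n} (hs : s.1.card = m) (hn : s.2 + ω.length ≤ n) (h1 : ∀ j ∈ ω, j ∈ s.1)
    (h2 : ∀ j ∈ ω, j + 1 ∉ ω → j + 1 ∉ s.1) :
    ∃ t, run m ω s = some t ∧ t.1.card = m ∧ t.2 = s.2 + ω.length ∧
      ∀ x, x ∈ t.1 ↔ x - 1 ∈ ω ∨ x ∉ ω ∧ x ∈ s.1 := by
  induction ω with
  | nil => exact ⟨s, rfl, hs, rfl, by simp⟩
  | cons a ω ih =>
    have h3 := hω.sub_one_head_notMem
    have h4 := (List.nodup_cons.1 hω.1).1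
    rw [List.length_cons] at hn
    obtain ⟨t, ht, hc, hl, hm⟩ := ih hω.tail (by omega) (fun j hj => h1 j (by simp [hj]))
      (fun j hj hj' => h2 j (by simp [hj]) (by
        rw [List.mem_cons, not_or]
        refine ⟨?_, hj'⟩
        rintro rfl
        exact h3 (by simp [hj])))
    rw [List.mem_cons, not_or] at h3
    have ha : a ∈ t.1 := by
      rw [hm]
      exact Or.inr ⟨h4, h1 a (by simp)⟩
    have ha' : a + 1 ∉ t.1 := by
      rw [hm, add_sub_cancel_right, not_or, not_and]
      exact ⟨h4, fun h5 => h2 a (by simp) (by simp [h5])⟩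
    have hh : hop m a t = some (insert (a + 1) (t.1.erase a), t.2 + 1) :=
      hop_eq_some_iff.2 ⟨⟨ha, ha', hc, by omega⟩, rfl⟩
    refine ⟨_, by rw [run, ht, Option.bind_some, hh], card_hop hh, ?_, fun x => ?_⟩
    · rw [List.length_cons, hl, add_assoc]
    · simp only [Finset.mem_insert, Finset.mem_erase, List.mem_cons, hm]
      by_cases e1 : x = a
      · subst e1
        simp [h3.2]
      · by_cases e2 : x = a + 1
        · subst e2
          simp
        · have e3 : x - 1 ≠ a := fun e => e2 (by rw [← e, sub_add_cancel])
          simp [e1, e2, e3]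

/-! ### Linearization -/

/-- The basis vector of a configuration, or zero. -/
def configVec (o : Option (Config n)) : Config n →₀ ℤ := o.elim 0 fun s => Finsupp.single s 1

/-- The linear extension of `hop`. -/
def hopEnd (m : ℕ) (i : ZMod n) : Module.End ℤ (Config n →₀ ℤ) :=
  Finsupp.linearCombination ℤ fun s => configVec (hop m i s)

theorem hopEnd_configVec (m : ℕ) (i : ZMod n) (o : Option (Config n)) :
    hopEnd m i (configVec o) = configVec (o.bind (hop m i)) := by
  cases o <;> simp [configVec, hopEnd]

theorem prod_hopEnd (m : ℕ) (ω : List (ZMod n)) (s : Config n) :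
    (ω.map (hopEnd m)).prod (configVec (some s)) = configVec (run m ω s) := by
  induction ω with
  | nil => rfl
  | cons i ω ih =>
    rw [List.map_cons, List.prod_cons, Module.End.mul_apply, ih, hopEnd_configVec, run]

theorem end_ext {φ ψ : Module.End ℤ (Config n →₀ ℤ)}
    (h : ∀ s, φ (configVec (some s)) = ψ (configVec (some s))) : φ = ψ :=
  Finsupp.lhom_ext' fun s => LinearMap.ext_ring (h s)

theorem hopEnd_up (m : ℕ) (i : ZMod n) :
    hopEnd m i * hopEnd m (i + 1) * hopEnd m i = 0 :=
  end_ext fun s => by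
    simp only [Module.End.mul_apply, hopEnd_configVec, Option.bind_some, hop_hop_hop_up]
    rfl

theorem hopEnd_down (m : ℕ) (i : ZMod n) :
    hopEnd m (i + 1) * hopEnd m i * hopEnd m (i + 1) = 0 :=
  end_ext fun s => by
    simp only [Module.End.mul_apply, hopEnd_configVec, Option.bind_some, hop_hop_hop_down]
    rfl

/-- The action of the nilCoxeter algebra on configurations. -/
def hopRep (m : ℕ) : NilAlg n →ₐ[ℤ] Module.End ℤ (Config n →₀ ℤ) :=
  RingQuot.liftAlgHom ℤ ⟨FreeAlgebra.lift ℤ (hopEnd m), by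
    intro x y h
    cases h with
    | sq i =>
      simp only [map_mul, FreeAlgebra.lift_ι_apply, map_zero]
      refine end_ext fun s => ?_
      simp only [Module.End.mul_apply, hopEnd_configVec, Option.bind_some, hop_hop_self]
      rfl
    | braid hn i =>
      simp only [map_mul, FreeAlgebra.lift_ι_apply, hopEnd_up, hopEnd_down]
    | comm i j h₁ h₂ =>
      simp only [map_mul, FreeAlgebra.lift_ι_apply]
      refine end_ext fun s => ?_
      simp only [Module.End.mul_apply, hopEnd_configVec, Option.bind_some]
      rw [hop_hop_comm m (fun h => h₂ (by rw [h]; ring)) (fun h => h₁ (by rw [h]; ring))]⟩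

theorem hopRep_gen (m : ℕ) (i : ZMod n) : hopRep m (gen n i) = hopEnd m i := by
  rw [gen, hopRep, RingQuot.liftAlgHom_mkAlgHom_apply, FreeAlgebra.lift_ι_apply]

theorem hopRep_genProd (m : ℕ) (ω : List (ZMod n)) (s : Config n) :
    hopRep m (genProd ω) (configVec (some s)) = configVec (run m ω s) := by
  have h : hopRep m (genProd ω) = (ω.map (hopEnd m)).prod := by
    rw [genProd, map_list_prod, List.map_map]
    congr 2
    funext i
    exact hopRep_gen m i
  rw [h, prod_hopEnd]

/-- Each letter j needs the site j + 1 to be vacant initially, and only n - m sites are. -/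
theorem hopRep_cycDec {m : ℕ} {J : Finset (ZMod n)} (hJ : J ≠ Finset.univ)
    (hc : n - m < J.card) : hopRep m (elt n (cycDec n J)) = 0 := by
  obtain ⟨ω, h1, h2⟩ := exists_isCycDecWord hJ
  refine end_ext fun s => ?_
  rw [elt_cycDec_eq h1 h2, hopRep_genProd]
  rcases h : run m ω s with _ | t
  · rfl
  exfalso
  have h3 : s.1.card = m := card_of_run h (by
    rintro rfl
    obtain ⟨j, hj⟩ := Finset.card_pos.1 (by omega : 0 < J.card)
    simpa using (h2 j).2 hj)
  have h4 : shift J ⊆ s.1ᶜ := fun j hj => by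
    rw [mem_shift, ← h2] at hj
    have := add_one_notMem_of_run h1 h _ hj
    rwa [sub_add_cancel, ← Finset.mem_compl] at this
  have h5 := Finset.card_le_card h4
  rw [card_shift, Finset.card_compl, ZMod.card] at h5
  omega

/-- Each letter needs its own site to be occupied initially, and there are only m particles. -/
theorem hopRep_cycInc {m : ℕ} {J : Finset (ZMod n)} (hJ : J ≠ Finset.univ)
    (hc : m < J.card) : hopRep m (elt n (cycInc n J)) = 0 := by
  obtain ⟨ω, h1, h2⟩ := exists_isCycIncWord hJ
  refine end_ext fun s => ?_
  rw [elt_cycInc_eq h1 h2, hopRep_genProd]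
  rcases h : run m ω s with _ | t
  · rfl
  exfalso
  have h3 : s.1.card = m := card_of_run h (by
    rintro rfl
    obtain ⟨j, hj⟩ := Finset.card_pos.1 (by omega : 0 < J.card)
    simpa using (h2 j).2 hj)
  have h4 : J ⊆ s.1 := fun j hj => mem_of_run h1 h _ ((h2 j).2 hj)
  have h5 := Finset.card_le_card h4
  omega

theorem hopRep_eq_of_quotRel {m : ℕ} {a b : NilAlg n} (h : QuotRel m n a b) :
    hopRep m a = hopRep m b := by
  cases h with
  | up i => simp only [map_mul, map_zero, hopRep_gen, hopEnd_up]
  | down i => simp only [map_mul, map_zero, hopRep_gen, hopEnd_down]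
  | dec w hw hl =>
    obtain ⟨J, hJ, rfl⟩ := hw
    rw [length_cycDec hJ] at hl
    rw [hopRep_cycDec hJ hl, map_zero]
  | inc w hw hl =>
    obtain ⟨J, hJ, rfl⟩ := hw
    rw [length_cycInc hJ] at hl
    rw [hopRep_cycInc hJ hl, map_zero]

theorem hopRep_eq_zero_of_proj {m : ℕ} {a : NilAlg n} (h : proj m n a = 0) : hopRep m a = 0 := by
  have h1 : ∀ a, RingQuot.lift ⟨(hopRep (n := n) m).toRingHom, fun _ _ h => hopRep_eq_of_quotRel h⟩
      (proj m n a) = hopRep m a := fun a => RingQuot.lift_mkRingHom_apply _ _ _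
  rw [← h1, h, map_zero]

/-- With the particles initially off J + 1, the element d_J can act and moves them onto Jᶜ, where
u_{Jᶜ} can act in turn. The n steps this takes are exactly as many as `hop` allows, so the image is
a basis vector. -/
theorem proj_ribbonR_ne_zero {m : ℕ} (hm : 0 < m) (hmn : m < n) :
    proj m n (elt n (ribbonR m n)) ≠ 0 := by
  intro h
  set J : Finset (ZMod n) := arc 0 (n - m) with hJ
  have hcard : J.card = n - m := card_arc (by omega)
  have hJu : J ≠ Finset.univ := arc_ne_univ (by omega)
  have hJ0 : J.Nonempty := Finset.card_pos.1 (by omega)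
  have hcc : Jᶜ.card = m := by rw [Finset.card_compl, ZMod.card]; omega
  have hI : Jᶜ ≠ Finset.univ := ne_univ_of_card_lt (by omega)
  obtain ⟨ω, h1, h2⟩ := exists_isCycIncWord hI
  obtain ⟨ω', h3, h4⟩ := exists_isCycDecWord hJu
  have hlen : ω.length = m := by
    rw [← (isReduced_of_nodup h1.1).eq, ← cycInc_eq h1 h2, length_cycInc hI, hcc]
  have hlen' : ω'.length = n - m := by
    rw [← (isReduced_of_nodup h3.1).eq, ← cycDec_eq h3 h4, length_cycDec hJu, hcard]
  have hS : (shift J)ᶜ.card = m := by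
    rw [Finset.card_compl, card_shift, ZMod.card]; omega
  obtain ⟨t, ht, htc, htl, htm⟩ := exists_run_of_isCycDecWord h3 (s := ((shift J)ᶜ, 0)) hS
    (by rw [hlen']; simp) (fun j hj => by
      rw [h4] at hj
      rw [Finset.mem_compl, mem_shift, add_sub_cancel_right, not_not]
      exact hj) (fun j hj hj' => by
      rw [h4] at hj'
      rwa [Finset.mem_compl, mem_shift])
  have htJ : t.1 = Jᶜ := by
    ext x
    rw [htm, Finset.mem_compl, Finset.mem_compl, mem_shift, h4, h4]
    tauto
  obtain ⟨u, hu, -⟩ := exists_run_of_isCycIncWord h1 (s := t) htc (by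
      rw [htl, hlen, hlen']; simp only; omega) (fun j hj => by rw [htJ, ← h2]; exact hj)
    (fun j _ hj => by rw [htJ, ← h2]; exact hj)
  have h5 := LinearMap.congr_fun (hopRep_eq_zero_of_proj h) (configVec (some ((shift J)ᶜ, 0)))
  rw [ribbonR_eq_compl hmn, ← hJ, elt_ribbon hJ0 hJu, elt_cycInc_eq h1 h2, elt_cycDec_eq h3 h4,
    map_mul, Module.End.mul_apply, hopRep_genProd, ht, hopRep_genProd, hu, LinearMap.zero_apply,
    configVec] at h5
  simp at h5

end AffNil
end

theorem theorem4p5 (m n : ℕ) [NeZero n] (hm : 0 < m) (hmn : m < n) :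
    (AffNil.proj m n (AffNil.ncKSchur n (AffNil.ribbonR m n)) =
        ∑ J ∈ Finset.powersetCard (n - m) (Finset.univ : Finset (ZMod n)),
          AffNil.proj m n (AffNil.elt n (AffNil.cycInc n Jᶜ * AffNil.cycDec n J))) ∧
    (∑ J ∈ Finset.powersetCard (n - m) (Finset.univ : Finset (ZMod n)),
          AffNil.proj m n (AffNil.elt n (AffNil.cycInc n Jᶜ * AffNil.cycDec n J)) =
        AffNil.proj m n (AffNil.ncE n m) * AffNil.proj m n (AffNil.ncH n (n - m))) ∧
    (∀ w : AffNil.AffSym n,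
      (AffNil.IsRibbon n w ∧ AffNil.IsZeroGrassmannian n w ∧
          AffNil.proj m n (AffNil.elt n w) ≠ 0) ↔
        w = AffNil.ribbonR m n) := by
  have : Fact (1 < n) := ⟨by omega⟩
  refine ⟨?_, AffNil.sum_proj_ribbon hm hmn, fun w => ⟨fun ⟨h1, h2, h3⟩ =>
    AffNil.eq_ribbonR_of_isRibbon hmn h1 (AffNil.isZeroGrassmannian_iff.1 h2) h3, ?_⟩⟩
  · rw [AffNil.sum_proj_ribbon hm hmn, AffNil.ncKSchur_ribbonR hm hmn, map_mul]
  · rintro rfl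
    exact ⟨AffNil.isRibbon_ribbonR hm hmn, AffNil.isZeroGrassmannian_iff.2
      (AffNil.grassAt_ribbonR hm hmn), AffNil.proj_ribbonR_ne_zero hm hmn⟩
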